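/- Setting. Let $n\ge 2$, let $\Omega\subset\mathbb R^n$ be a bounded Lipschitz domain, let $\Gamma_0,\Gamma_1\subset\partial\Omega$ be disjoint measurable sets, $\Gamma_0$ of positive surface measure, and let $T>0$. Let $\alpha>n-1$, $\beta>n$, $\omega>n$, $s>0$, and let $d$ satisfy $\alpha^{-1}+\beta^{-1}\le d^{-1}<(n-1)^{-1}$ and $d>\frac{\beta(n-1)}{\beta-1}$. Let $y_0\in W^{1-1/d,d}(\Gamma_0;\mathbb R^n)$ and put $$\mathbb Y=\{y\in W^{1,d}(\Omega;\mathbb R^n):\ y=y_0\text{ on }\Gamma_0\},$$ $$\mathbb Z=\{z=(F_p,p)\in W^{1,\beta}(\Omega;\mathbb R^{n\times n})\times W^{1,\omega}(\Omega;\mathbb R^m):\ \det F_p=1\text{ a.e.}\},\qquad \mathbb Q=\mathbb Y\times\mathbb Z .$$ Energy. Let $W_1:\mathbb R^{n\times n}\times\mathbb R^{n\times n\times n}\to\mathbb R\cup\{+\infty\}$ be continuous, convex in its second argument, with, for some $c>0$, $W_1(F,H)\ge c(|F|^\alpha+(\det F)^{-s}+|H|^{\alpha/(n-1)})$ if $\det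 F>0$ and $W_1(F,H)=+\infty$ otherwise. Let $W_2(F_p,G,p,\pi)$ be real-valued, continuous and convex in $(G,\pi)$, such that for some $C,c,c_1>0$ $$c(|F_p|^\beta+|G|^\beta+|p|^\omega+|\pi|^\omega)-c_1\le W_2(F_p,G,p,\pi)\le C(1+|F_p|^\beta+|G|^\beta+|p|^\omega+|\pi|^\omega),$$ and such that for some $c_2>0$, $v^*\in\mathbb R^m$ and some modulus of continuity $\hat\omega$, $$|W_2(F_p,G,p+av^*,\pi)-W_2(F_p,G,p,\pi)|\le\hat\omega(a)\,(W_2(F_p,G,p,\pi)+c_2)\quad\text{for all } a>0 .$$ Let $$L(t,y)=\int_\Omega f(t)\cdot y\,dx+\int_{\Gamma_1}g(t)\cdot y\,dS,$$ $$\mathcal I(t,q)=\int_\Omega W_1\big(\nabla yF_p^{-1},\nabla[(\operatorname{cof}\nabla y)F_p^\top]\big)+W_2(F_p,\nabla F_p,p,\nabla p)\,dx-L(t,y),\qquad q=(y,F_p,p)\in\mathbb Q,$$ where $\mathcal I(t,q)=+\infty$ if $(\operatorname{cof}\nabla y)F_p^\top$ has no weak gradient. Dissipation. For $q_i=(y_i,z_i)\in\mathbb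 Q$ let $\mathcal D(q_1,q_2)=\mathcal D(z_1,z_2)=\int_\Omega D(x,z_1(x),z_2(x))\,dx\in[0,+\infty]$, where $D:\Omega\times(\mathrm{SL}(n)\times\mathbb R^m)^2\to[0,+\infty]$ is such that $x\mapsto D(x,z_1(x),z_2(x))$ is measurable for $z_1,z_2\in\mathbb Z$, and assume: $\mathcal D$ is sequentially weakly lower semicontinuous on $\mathbb Z\times\mathbb Z$; if $(z_k)\subset\mathbb Z$ is bounded, $z\in\mathbb Z$ and $\min\{\mathcal D(z_k,z),\mathcal D(z,z_k)\}\to0$, then $z_k\rightharpoonup z$; $\mathcal D(z_1,z_2)=0$ if and only if $z_1=z_2$; $\mathcal D(z_1,z_3)\le\mathcal D(z_1,z_2)+\mathcal D(z_2,z_3)$. For $q:[0,T]\to\mathbb Q$ let $$\mathrm{Var}(\mathcal D,q;[0,T])=\sup\Big\{\sum_{i=1}^N\mathcal D(q(t_{i-1}),q(t_i)):\ 0=t_0<t_1<\dots<t_N=T\Big\}.$$ Loading. Assume $f\in C^1([0,T];L^{\tilde d}(\Omega;\mathbb R^n))$ and $g\in C^1([0,T];L^{\hat d}(\Gamma_1;\mathbb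 R^n))$, where $\tilde d\ge\frac{nd}{nd-n+d}$ and $\hat d\ge\frac{nd-d}{nd-n}$ if $d<n$, and $\tilde d>1$ and $\hat d>1$ if $d\ge n$. Incremental problems. Let $q^0\in\mathbb Q$ be stable at time $0$, i.e. $\mathcal I(0,q^0)\le\mathcal I(0,\tilde q)+\mathcal D(q^0,\tilde q)$ for all $\tilde q\in\mathbb Q$, with $\mathcal I(0,q^0)<+\infty$. For $\tau>0$ with $N=T/\tau\in\mathbb N$ let $q_\tau^0=q^0$ and, for $1\le k\le N$, let $q_\tau^k\in\mathbb Q$ minimize $q\mapsto\mathcal I(k\tau,q)+\mathcal D(q_\tau^{k-1},q)$ over $\mathbb Q$. Let $q_\tau=(y_\tau,z_\tau)$ be the piecewise constant interpolation, $q_\tau(t)=q_\tau^k$ for $t\in[k\tau,(k+1)\tau)$, $k<N$, and $q_\tau(T)=q_\tau^N$. Proposition. There is $\kappa\in\mathbb R$ such that for every such $\tau$ and every such choice of minimizers $$\|y_\tau\|_{L^\infty(0,T;W^{1,d}(\Omega;\mathbb R^n))}<\kappa,\qquad \mathrm{Var}(\mathcal D,q_\tau;[0,T])<\kappa,\qquad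 \|z_\tau\|_{L^\infty(0,T;W^{1,\beta}(\Omega;\mathbb R^{n\times n})\times W^{1,\omega}(\Omega;\mathbb R^m))}<\kappa .$$ -/

import Mathlib

open MeasureTheory Set Filter Topology
open scoped ENNReal NNReal

noncomputable section

namespace GPCPlasticity

/-! ### Vectors, matrices and third-order tensors, all with the Euclidean norm -/

/-- The space `ℝⁿ`. -/
abbrev Vec (n : ℕ) : Type := EuclideanSpace ℝ (Fin n)

/-- The space `ℝ^{n × n}` with the Euclidean (Frobenius) norm. -/
abbrev Mat (n : ℕ) : Type := EuclideanSpace ℝ (Fin n × Fin n)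

/-- The space `ℝ^{n × n × n}`; the last index is the index of the partial derivative. -/
abbrev Ten (n : ℕ) : Type := EuclideanSpace ℝ ((Fin n × Fin n) × Fin n)

/-- The space `ℝ^{m × n}`. -/
abbrev RectMat (m n : ℕ) : Type := EuclideanSpace ℝ (Fin m × Fin n)

/-- An element of `ℝ^{n × n}` as a Mathlib matrix. -/
def toMatrix {n : ℕ} (A : Mat n) : Matrix (Fin n) (Fin n) ℝ := Matrix.of fun i j => A (i, j)

/-- A Mathlib matrix as an element of `ℝ^{n × n}`. -/
def ofMatrix {n : ℕ} (A : Matrix (Fin n) (Fin n) ℝ) : Mat n :=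
  WithLp.toLp 2 fun ij => A ij.1 ij.2

/-- The determinant. -/
def det {n : ℕ} (A : Mat n) : ℝ := (toMatrix A).det

/-- The cofactor matrix; it equals `(det F) F^{-⊤}` when `F` is invertible. -/
def cof {n : ℕ} (F : Matrix (Fin n) (Fin n) ℝ) : Matrix (Fin n) (Fin n) ℝ :=
  F.adjugate.transpose

/-! ### Domains -/

/-- A bounded Lipschitz domain of `ℝⁿ`: a non-empty, open, connected, bounded set which, near each
of its boundary points, is the strict epigraph of a Lipschitz function, in the direction of some
unit vector `e`. The argument of `γ` is the projection of `x` on the hyperplane orthogonal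
to `e`. -/
structure IsBoundedLipschitzDomain {n : ℕ} (Ω : Set (Vec n)) : Prop where
  isOpen : IsOpen Ω
  isConnected : IsConnected Ω
  isBounded : Bornology.IsBounded Ω
  lipschitz : ∀ x₀ ∈ frontier Ω, ∃ (e : Vec n) (K : ℝ≥0) (γ : Vec n → ℝ) (r : ℝ),
    ‖e‖ = 1 ∧ LipschitzWith K γ ∧ 0 < r ∧
      ∀ x ∈ Metric.ball x₀ r, (x ∈ Ω ↔ γ (x - inner ℝ e x • e) < inner ℝ e x)

/-- The surface measure on `∂Ω`: the `(n-1)`-dimensional Hausdorff measure, in its normalization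
that agrees with the Lebesgue measure on hyperplanes, restricted to `∂Ω`. -/
def surfaceMeasure {n : ℕ} (Ω : Set (Vec n)) : Measure (Vec n) :=
  (Measure.euclideanHausdorffMeasure (n - 1)).restrict (frontier Ω)

/-! ### Sobolev spaces -/

/-- `G` is the weak gradient of `u : Ω → ℝ^ι`; the entry `(i, j)` of `G` is `∂u_i/∂x_j`. -/
structure HasWeakGrad {n : ℕ} {ι : Type} [Fintype ι] (Ω : Set (Vec n))
    (u : Vec n → EuclideanSpace ℝ ι) (G : Vec n → EuclideanSpace ℝ (ι × Fin n)) : Prop where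
  locallyIntegrableOn_fun : LocallyIntegrableOn u Ω
  locallyIntegrableOn_grad : LocallyIntegrableOn G Ω
  integral_eq : ∀ φ : Vec n → ℝ, ContDiff ℝ (⊤ : ℕ∞) φ → HasCompactSupport φ → tsupport φ ⊆ Ω →
    ∀ (i : ι) (j : Fin n),
      ∫ x in Ω, u x i * fderiv ℝ φ x (EuclideanSpace.single j 1) = -∫ x in Ω, G x (i, j) * φ x

/-- An element of `W^{1,p}(Ω; ℝ^ι)`, given together with its weak gradient. -/
structure SobolevFun {n : ℕ} (Ω : Set (Vec n)) (p : ℝ) (ι : Type) [Fintype ι] where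
  toFun : Vec n → EuclideanSpace ℝ ι
  grad : Vec n → EuclideanSpace ℝ (ι × Fin n)
  memLp_toFun : MemLp toFun (ENNReal.ofReal p) (volume.restrict Ω)
  memLp_grad : MemLp grad (ENNReal.ofReal p) (volume.restrict Ω)
  hasWeakGrad : HasWeakGrad Ω toFun grad

/-- The norm of `W^{1,p}(Ω; ℝ^ι)`: the sum of the `L^p` norms of `u` and of `∇u`. -/
def SobolevFun.sobolevNorm {n : ℕ} {Ω : Set (Vec n)} {p : ℝ} {ι : Type} [Fintype ι]
    (u : SobolevFun Ω p ι) : ℝ≥0∞ :=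
  eLpNorm u.toFun (ENNReal.ofReal p) (volume.restrict Ω) +
    eLpNorm u.grad (ENNReal.ofReal p) (volume.restrict Ω)

/-- The classical gradient of a differentiable function, with the same layout of the entries. -/
def classicalGrad {n : ℕ} {ι : Type} [Fintype ι] (φ : Vec n → EuclideanSpace ℝ ι) (x : Vec n) :
    EuclideanSpace ℝ (ι × Fin n) :=
  WithLp.toLp 2 fun ij => fderiv ℝ φ x (EuclideanSpace.single ij.2 1) ij.1

/-- `v` is the trace on `∂Ω` of `u ∈ W^{1,p}(Ω; ℝ^ι)`: there are functions, smooth up to the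
boundary, that converge to `u` in `W^{1,p}` and whose boundary values converge to `v` in
`L^p(∂Ω)`. On a bounded Lipschitz domain each `u` has exactly one trace (up to null sets). -/
def IsTrace {n : ℕ} {Ω : Set (Vec n)} {p : ℝ} {ι : Type} [Fintype ι]
    (u : SobolevFun Ω p ι) (v : Vec n → EuclideanSpace ℝ ι) : Prop :=
  AEStronglyMeasurable v (surfaceMeasure Ω) ∧
  ∃ φ : ℕ → Vec n → EuclideanSpace ℝ ι, (∀ k, ContDiff ℝ (⊤ : ℕ∞) (φ k)) ∧
    Tendsto (fun k => eLpNorm (φ k - u.toFun) (ENNReal.ofReal p) (volume.restrict Ω))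
      atTop (𝓝 0) ∧
    Tendsto (fun k => eLpNorm (classicalGrad (φ k) - u.grad) (ENNReal.ofReal p)
      (volume.restrict Ω)) atTop (𝓝 0) ∧
    Tendsto (fun k => eLpNorm (φ k - v) (ENNReal.ofReal p) (surfaceMeasure Ω)) atTop (𝓝 0)

/-- Membership in `W^{1-1/p,p}(Γ; ℝⁿ)`, `Γ ⊆ ∂Ω`, through the Gagliardo seminorm; the kernel
exponent is `(n-1) + (1-1/p) p = n + p - 2`. -/
def MemTraceSpace {n : ℕ} (Ω Γ : Set (Vec n)) (p : ℝ) (v : Vec n → Vec n) : Prop :=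
  MemLp v (ENNReal.ofReal p) ((surfaceMeasure Ω).restrict Γ) ∧
  ∫⁻ x in Γ, ∫⁻ x' in Γ, edist (v x) (v x') ^ p / edist x x' ^ ((n : ℝ) + p - 2)
    ∂surfaceMeasure Ω ∂surfaceMeasure Ω < ⊤

/-- Weak convergence `u_k ⇀ u` in `L^p(Ω; ℝ^ι)`, `1 < p < ∞`, tested with `L^{p'}`. -/
def WeakConvLp {n : ℕ} {ι : Type} [Fintype ι] (Ω : Set (Vec n)) (p : ℝ)
    (u : ℕ → Vec n → EuclideanSpace ℝ ι) (v : Vec n → EuclideanSpace ℝ ι) : Prop :=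
  ∀ φ : Vec n → EuclideanSpace ℝ ι,
    MemLp φ (ENNReal.ofReal (p / (p - 1))) (volume.restrict Ω) →
    Tendsto (fun k => ∫ x in Ω, inner ℝ (u k x) (φ x)) atTop (𝓝 (∫ x in Ω, inner ℝ (v x) (φ x)))

/-- Weak convergence in `W^{1,p}(Ω; ℝ^ι)`. -/
def WeakConvSobolev {n : ℕ} {Ω : Set (Vec n)} {p : ℝ} {ι : Type} [Fintype ι]
    (u : ℕ → SobolevFun Ω p ι) (v : SobolevFun Ω p ι) : Prop :=
  WeakConvLp Ω p (fun k => (u k).toFun) v.toFun ∧ WeakConvLp Ω p (fun k => (u k).grad) v.grad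

/-! ### The data of the problem -/

/-- The data of the elastoplastic problem. This is plain data; the assumptions on it are listed
in the predicates below. -/
structure Data (n m : ℕ) where
  /-- the reference configuration -/
  Ω : Set (Vec n)
  /-- the part of the boundary where the deformation is prescribed -/
  Γ₀ : Set (Vec n)
  /-- the part of the boundary where surface forces act -/
  Γ₁ : Set (Vec n)
  /-- the prescribed boundary values -/
  y₀ : Vec n → Vec n
  /-- the final time -/
  T : ℝ
  /-- the integrability exponent of deformation gradients -/
  d : ℝ
  /-- the growth exponent of the elastic energy -/
  α : ℝ
  /-- the growth exponent of the plastic energy in the plastic strain -/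
  β : ℝ
  /-- the growth exponent of the plastic energy in the hardening variables -/
  ω : ℝ
  /-- the exponent of the determinant in the growth of the elastic energy -/
  s : ℝ
  /-- the elastic energy density, a function of the elastic strain and of the gradient of its
  cofactor; its values are non-negative or infinite by the growth condition below -/
  W₁ : Mat n → Ten n → ℝ≥0∞
  /-- the plastic energy density `W₂(F_p, ∇F_p, p, ∇p)` -/
  W₂ : Mat n → Ten n → Vec m → RectMat m n → ℝ
  /-- the density of the dissipation distance; only its values at plastic strains of determinant
  one are ever used -/
  D : Vec n → Mat n × Vec m → Mat n × Vec m → ℝ≥0∞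
  /-- the integrability exponent of body forces -/
  dBody : ℝ≥0∞
  /-- the integrability exponent of surface forces -/
  dSurf : ℝ≥0∞
  one_le_dBody : Fact (1 ≤ dBody)
  one_le_dSurf : Fact (1 ≤ dSurf)
  /-- the body forces, `t ↦ f(t) ∈ L^{dBody}(Ω; ℝⁿ)` -/
  f : ℝ → Lp (Vec n) dBody (volume.restrict Ω)
  /-- the surface forces, `t ↦ g(t) ∈ L^{dSurf}(Γ₁; ℝⁿ)` -/
  g : ℝ → Lp (Vec n) dSurf ((surfaceMeasure Ω).restrict Γ₁)

attribute [instance] Data.one_le_dBody Data.one_le_dSurf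

namespace Data

variable {n m : ℕ}

/-! ### States -/

/-- The admissible deformations: `y ∈ W^{1,d}(Ω; ℝⁿ)` with `y = y₀` on `Γ₀` in the sense of
traces. The trace of `y`, which `y` determines, is recorded with it. -/
structure Deformation (P : Data n m) where
  y : SobolevFun P.Ω P.d (Fin n)
  trace : Vec n → Vec n
  isTrace : IsTrace y trace
  trace_eq : ∀ᵐ x ∂(surfaceMeasure P.Ω).restrict P.Γ₀, trace x = P.y₀ x

/-- The internal states `z = (F_p, p) ∈ W^{1,β}(Ω; ℝ^{n×n}) × W^{1,ω}(Ω; ℝ^m)` with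
`F_p ∈ SL(n)` almost everywhere. -/
structure PlasticState (P : Data n m) where
  Fp : SobolevFun P.Ω P.β (Fin n × Fin n)
  p : SobolevFun P.Ω P.ω (Fin m)
  det_eq_one : ∀ᵐ x ∂volume.restrict P.Ω, det (Fp.toFun x) = 1

/-- The states `q = (y, z)`. -/
structure State (P : Data n m) where
  y : P.Deformation
  z : P.PlasticState

variable {P : Data n m}

/-- The value `z(x) = (F_p(x), p(x))`. -/
def PlasticState.val (z : P.PlasticState) (x : Vec n) : Mat n × Vec m :=
  (z.Fp.toFun x, z.p.toFun x)

/-- Equality of internal states, i.e. almost everywhere in `Ω`. -/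
def PlasticState.AEEq (z z' : P.PlasticState) : Prop :=
  z.val =ᵐ[volume.restrict P.Ω] z'.val

/-- The norm of `W^{1,β}(Ω; ℝ^{n×n}) × W^{1,ω}(Ω; ℝ^m)`. -/
def PlasticState.sobolevNorm (z : P.PlasticState) : ℝ≥0∞ :=
  z.Fp.sobolevNorm + z.p.sobolevNorm

/-- Weak convergence of internal states. -/
def PlasticState.WeakConv (z : ℕ → P.PlasticState) (z' : P.PlasticState) : Prop :=
  WeakConvSobolev (fun k => (z k).Fp) z'.Fp ∧ WeakConvSobolev (fun k => (z k).p) z'.p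

/-! ### Energy and dissipation -/

/-- The elastic strain `F_e = ∇y F_p⁻¹`. -/
def State.elasticStrain (q : P.State) (x : Vec n) : Mat n :=
  ofMatrix (toMatrix (q.y.y.grad x) * (toMatrix (q.z.Fp.toFun x))⁻¹)

/-- The field `(cof ∇y) F_pᵀ`. -/
def State.cofElasticStrain (q : P.State) (x : Vec n) : Mat n :=
  ofMatrix (cof (toMatrix (q.y.y.grad x)) * (toMatrix (q.z.Fp.toFun x)).transpose)

/-- The elastic energy `∫_Ω W₁(∇y F_p⁻¹, ∇[(cof ∇y) F_pᵀ]) dx`. The infimum runs over the weak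
gradients `H` of `(cof ∇y) F_pᵀ`; there is at most one up to null sets, and the energy is `+∞`
if there is none. -/
def State.elasticEnergy (q : P.State) : ℝ≥0∞ :=
  ⨅ (H : Vec n → Ten n) (_ : HasWeakGrad P.Ω q.cofElasticStrain H),
    ∫⁻ x in P.Ω, P.W₁ (q.elasticStrain x) (H x)

/-- The plastic energy `∫_Ω W₂(F_p, ∇F_p, p, ∇p) dx`. -/
def PlasticState.plasticEnergy (z : P.PlasticState) : ℝ :=
  ∫ x in P.Ω, P.W₂ (z.Fp.toFun x) (z.Fp.grad x) (z.p.toFun x) (z.p.grad x)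

variable (P)

/-- The work of the external forces,
`L(t, y) = ∫_Ω f(t) · y dx + ∫_{Γ₁} g(t) · y dS`. -/
def load (t : ℝ) (y : P.Deformation) : ℝ :=
  (∫ x in P.Ω, inner ℝ (P.f t x) (y.y.toFun x)) +
    (∫ x in P.Γ₁, inner ℝ (P.g t x) (y.trace x) ∂surfaceMeasure P.Ω)

/-- The energy functional `I(t, q)`, with values in `ℝ ∪ {+∞}`. -/
def energy (t : ℝ) (q : P.State) : EReal :=
  (q.elasticEnergy : EReal) + ((q.z.plasticEnergy - P.load t q.y : ℝ) : EReal)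

/-- The dissipation distance `𝒟(z₁, z₂) = ∫_Ω D(x, z₁(x), z₂(x)) dx`. -/
def dissipation (z₁ z₂ : P.PlasticState) : ℝ≥0∞ :=
  ∫⁻ x in P.Ω, P.D x (z₁.val x) (z₂.val x)

/-- The state `q` is stable at time `t`. -/
def IsStable (t : ℝ) (q : P.State) : Prop :=
  ∀ q' : P.State, P.energy t q ≤ P.energy t q' + (P.dissipation q.z q'.z : EReal)

/-- The total dissipation `Var(𝒟, q; [a, b])` of a process: the supremum of
`∑ 𝒟(q(t_{i-1}), q(t_i))` over the partitions `a = t_0 < t_1 < ⋯ < t_N = b`. -/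
def var (q : ℝ → P.State) (a b : ℝ) : ℝ≥0∞ :=
  ⨆ (N : ℕ) (t : ℕ → ℝ) (_ : StrictMonoOn t (Set.Iic N) ∧ t 0 = a ∧ t N = b),
    ∑ i ∈ Finset.range N, P.dissipation (q (t i)).z (q (t (i + 1))).z

/-! ### Assumptions -/

/-- The assumptions on the domain, the parts of its boundary and the boundary data. -/
structure GeometryAssumptions : Prop where
  two_le : 2 ≤ n
  time_pos : 0 < P.T
  domain : IsBoundedLipschitzDomain P.Ω
  subset_zero : P.Γ₀ ⊆ frontier P.Ω
  subset_one : P.Γ₁ ⊆ frontier P.Ω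
  measurable_zero : MeasurableSet P.Γ₀
  measurable_one : MeasurableSet P.Γ₁
  disjoint : Disjoint P.Γ₀ P.Γ₁
  positive : 0 < surfaceMeasure P.Ω P.Γ₀
  boundary_data : MemTraceSpace P.Ω P.Γ₀ P.d P.y₀

/-- The assumptions on the exponents. -/
structure ExponentAssumptions : Prop where
  alpha : (n : ℝ) - 1 < P.α
  beta : (n : ℝ) < P.β
  omega : (n : ℝ) < P.ω
  s_pos : 0 < P.s
  d_gt : (n : ℝ) - 1 < P.d
  holder : P.α⁻¹ + P.β⁻¹ ≤ P.d⁻¹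
  d_gt_beta : P.β * ((n : ℝ) - 1) / (P.β - 1) < P.d

/-- The assumptions on the elastic energy density. -/
structure ElasticAssumptions : Prop where
  continuous : Continuous fun a : Mat n × Ten n => P.W₁ a.1 a.2
  growth : ∃ c : ℝ, 0 < c ∧ ∀ (F : Mat n) (H : Ten n),
    (0 < det F → ENNReal.ofReal
      (c * (‖F‖ ^ P.α + det F ^ (-P.s) + ‖H‖ ^ (P.α / ((n : ℝ) - 1)))) ≤ P.W₁ F H) ∧
    (det F ≤ 0 → P.W₁ F H = ⊤)
  convex : ∀ (F : Mat n) (H H' : Ten n) (a b : ℝ), 0 ≤ a → 0 ≤ b → a + b = 1 →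
    P.W₁ F (a • H + b • H') ≤ ENNReal.ofReal a * P.W₁ F H + ENNReal.ofReal b * P.W₁ F H'

/-- The assumptions on the plastic energy density. -/
structure PlasticAssumptions : Prop where
  continuous : Continuous fun a : Mat n × Ten n × Vec m × RectMat m n =>
    P.W₂ a.1 a.2.1 a.2.2.1 a.2.2.2
  growth : ∃ C c c₁ : ℝ, 0 < C ∧ 0 < c ∧ 0 < c₁ ∧
    ∀ (F : Mat n) (G : Ten n) (p : Vec m) (π : RectMat m n),
      P.W₂ F G p π ≤ C * (1 + ‖F‖ ^ P.β + ‖G‖ ^ P.β + ‖p‖ ^ P.ω + ‖π‖ ^ P.ω) ∧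
      c * (‖F‖ ^ P.β + ‖G‖ ^ P.β + ‖p‖ ^ P.ω + ‖π‖ ^ P.ω) - c₁ ≤ P.W₂ F G p π
  modulus : ∃ (c₂ : ℝ) (v : Vec m) (μ : ℝ → ℝ), 0 < c₂ ∧ (∀ a, 0 < a → 0 ≤ μ a) ∧
    Tendsto μ (𝓝[>] 0) (𝓝 0) ∧
    ∀ (a : ℝ), 0 < a → ∀ (F : Mat n) (G : Ten n) (p : Vec m) (π : RectMat m n),
      |P.W₂ F G (p + a • v) π - P.W₂ F G p π| ≤ μ a * (P.W₂ F G p π + c₂)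
  convex : ∀ (F : Mat n) (p : Vec m),
    ConvexOn ℝ Set.univ fun a : Ten n × RectMat m n => P.W₂ F a.1 p a.2

/-- The assumptions on the dissipation distance. -/
structure DissipationAssumptions : Prop where
  measurable : ∀ z₁ z₂ : P.PlasticState,
    AEMeasurable (fun x => P.D x (z₁.val x) (z₂.val x)) (volume.restrict P.Ω)
  lower_semicontinuous : ∀ (z z' : ℕ → P.PlasticState) (w w' : P.PlasticState),
    PlasticState.WeakConv z w → PlasticState.WeakConv z' w' →
      P.dissipation w w' ≤ liminf (fun k => P.dissipation (z k) (z' k)) atTop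
  positivity : ∀ (z : ℕ → P.PlasticState) (w : P.PlasticState),
    (∃ R : ℝ, ∀ k, (z k).sobolevNorm ≤ ENNReal.ofReal R) →
    Tendsto (fun k => min (P.dissipation (z k) w) (P.dissipation w (z k))) atTop (𝓝 0) →
      PlasticState.WeakConv z w
  eq_zero_iff : ∀ z₁ z₂ : P.PlasticState, P.dissipation z₁ z₂ = 0 ↔ z₁.AEEq z₂
  triangle : ∀ z₁ z₂ z₃ : P.PlasticState,
    P.dissipation z₁ z₃ ≤ P.dissipation z₁ z₂ + P.dissipation z₂ z₃

/-- The assumptions on the loading: `f` and `g` are `C¹` in time, with values in Lebesgue spaces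
whose exponents are as required by the Sobolev and trace embeddings of `W^{1,d}`. -/
structure LoadingAssumptions : Prop where
  body : ContDiffOn ℝ 1 P.f (Set.Icc 0 P.T)
  surface : ContDiffOn ℝ 1 P.g (Set.Icc 0 P.T)
  body_exponent : P.d < n → ENNReal.ofReal (n * P.d / (n * P.d - n + P.d)) ≤ P.dBody
  body_exponent_of_le : n ≤ P.d → 1 < P.dBody
  surface_exponent : P.d < n → ENNReal.ofReal ((n * P.d - P.d) / (n * P.d - n)) ≤ P.dSurf
  surface_exponent_of_le : n ≤ P.d → 1 < P.dSurf

/-! ### Time discretization -/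

/-- `q^0, …, q^N` solve the incremental problems with time step `τ` and initial state `q₀`:
`q^0 = q₀`, and for `1 ≤ k ≤ N` the state `q^k` minimizes `I(kτ, ·) + 𝒟(q^{k-1}, ·)` over all
states. -/
def IsIncrementalSolution (τ : ℝ) (N : ℕ) (q₀ : P.State) (q : ℕ → P.State) : Prop :=
  q 0 = q₀ ∧ ∀ k, 1 ≤ k → k ≤ N → ∀ q' : P.State,
    P.energy (k * τ) (q k) + (P.dissipation (q (k - 1)).z (q k).z : EReal) ≤
      P.energy (k * τ) q' + (P.dissipation (q (k - 1)).z q'.z : EReal)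

/-- The piecewise constant interpolation: `q_τ(t) = q^k` for `t ∈ [kτ, (k+1)τ)`. In particular
`q_τ(Nτ) = q^N`. -/
def interpolate (τ : ℝ) (q : ℕ → P.State) (t : ℝ) : P.State := q ⌊t / τ⌋₊

end Data

end GPCPlasticity

end

noncomputable section

namespace GPCPlasticity

/-! ### Local geometry of Lipschitz domains -/

section Geometry

variable {n : ℕ} {Ω : Set (Vec n)}

/-! The energy controls the norms of a state, minimality keeps the energy from growing by more than
a factor 1 + O(τ) per time step, and the triangle inequality turns the sum of the dissipated
increments into a bound on the total dissipation.

Coercivity (`exists_coercivity`): since det F_p = 1, ∇y = F_e F_p, and Young's inequality with 1/α +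
1/β ≤ 1/d bounds |∇y|^d by |F_e|^α + |F_p|^β + 1, which the growth of W₁ and W₂ controls. As the
trace of y on Γ₀ is prescribed, the Friedrichs inequality then bounds y in W^{1,d}. The load is at
most Λ‖y‖ and is absorbed by the power |∇y|^d because d > 1. The outcome is ‖y‖ + ‖z‖ ≤ A I(t, q) +
B, uniformly in t.

Discrete Gronwall (`IsIncrementalSolution.bound`): the competitor q^k in the problem for q^{k+1}
costs no dissipation, and only the load depends on time, with Lipschitz constant Λ‖y^k‖. For a_k = A
I(kτ, q^k) + B this gives a_{k+1} + A 𝒟(q^k, q^{k+1}) ≤ (1 + AΛτ) a_k. Since (1 + AΛτ)^k ≤ exp(AΛT)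
for kτ ≤ T, all bounds are independent of τ.

Most of the work lies in the Friedrichs, Sobolev and trace inequalities on a Lipschitz domain
(`exists_friedrichs`, `exists_sobolevFun_embedding`). They are proved for C¹ functions on the whole
space from the interior cone property, and passed to the limit along the smooth functions that
define the trace. -/

theorem le_inner_of_mem_closure {x₀ e : Vec n} {r : ℝ} {γ : Vec n → ℝ} (hγ : Continuous γ)
    (h : ∀ x ∈ Metric.ball x₀ r, (x ∈ Ω ↔ γ (x - inner ℝ e x • e) < inner ℝ e x))
    {x : Vec n} (hx : x ∈ closure Ω) (hxr : x ∈ Metric.ball x₀ r) :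
    γ (x - inner ℝ e x • e) ≤ inner ℝ e x := by
  have hc : IsClosed {x : Vec n | γ (x - inner ℝ e x • e) ≤ inner ℝ e x} :=
    isClosed_le (by fun_prop) (by fun_prop)
  have hsub : Metric.ball x₀ r ∩ Ω ⊆ {x : Vec n | γ (x - inner ℝ e x • e) ≤ inner ℝ e x} :=
    fun y hy => ((h y hy.1).1 hy.2).le
  exact closure_minimal hsub hc (Metric.isOpen_ball.inter_closure ⟨hxr, hx⟩)

theorem inner_eq_of_mem_frontier {x₀ e : Vec n} {r : ℝ} {γ : Vec n → ℝ} (hγ : Continuous γ)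
    (hΩ : IsOpen Ω)
    (h : ∀ x ∈ Metric.ball x₀ r, (x ∈ Ω ↔ γ (x - inner ℝ e x • e) < inner ℝ e x))
    {x : Vec n} (hx : x ∈ frontier Ω) (hxr : x ∈ Metric.ball x₀ r) :
    γ (x - inner ℝ e x • e) = inner ℝ e x := by
  rw [hΩ.frontier_eq] at hx
  exact le_antisymm (le_inner_of_mem_closure hγ h hx.1 hxr)
    (not_lt.1 fun hlt => hx.2 ((h x hxr).2 hlt))

/-- Along `v` the height over the hyperplane grows at the rate ⟪e, v⟫, while the graph of `γ` rises
at most at the rate K‖v - ⟪e, v⟫ e‖, which is strictly smaller. Hence the starting point may lie on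
the boundary, as the trace inequality requires. -/
theorem add_smul_mem_of_cone {x₀ e : Vec n} {r : ℝ} {K : ℝ≥0} {γ : Vec n → ℝ}
    (hγ : LipschitzWith K γ)
    (h : ∀ x ∈ Metric.ball x₀ r, (x ∈ Ω ↔ γ (x - inner ℝ e x • e) < inner ℝ e x))
    {v : Vec n} (hv : K * ‖v - inner ℝ e v • e‖ < inner ℝ e v)
    {x : Vec n} (hx : x ∈ closure Ω) (hxr : x ∈ Metric.ball x₀ r) {t : ℝ} (ht : 0 < t)
    (hxt : x + t • v ∈ Metric.ball x₀ r) : x + t • v ∈ Ω := by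
  rw [h _ hxt]
  have h1 := le_inner_of_mem_closure hγ.continuous h hx hxr
  have h2 := hγ.dist_le_mul (x + t • v - inner ℝ e (x + t • v) • e) (x - inner ℝ e x • e)
  have h3 : x + t • v - (inner ℝ e (x + t • v) : ℝ) • e - (x - (inner ℝ e x : ℝ) • e)
      = t • (v - (inner ℝ e v : ℝ) • e) := by
    rw [inner_add_right, inner_smul_right]; module
  rw [dist_eq_norm, dist_eq_norm, h3, norm_smul, Real.norm_of_nonneg ht.le] at h2
  have h4 := (abs_le.1 h2).2
  rw [inner_add_right, inner_smul_right]
  rw [inner_add_right, inner_smul_right] at h4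
  nlinarith [mul_lt_mul_of_pos_left hv ht]

/-- Near every point of its closure, a Lipschitz domain contains, with each of its points, the
segments that issue from it in a non-empty open set of directions. -/
theorem IsBoundedLipschitzDomain.exists_directions (hΩ : IsBoundedLipschitzDomain Ω)
    {x₀ : Vec n} (hx₀ : x₀ ∈ closure Ω) :
    ∃ r : ℝ, 0 < r ∧ ∃ U : Set (Vec n), IsOpen U ∧ U.Nonempty ∧ ∀ v ∈ U, ∀ x ∈ closure Ω,
      x ∈ Metric.ball x₀ r → ∀ t : ℝ, 0 < t → x + t • v ∈ Metric.ball x₀ r → x + t • v ∈ Ω := by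
  by_cases hx : x₀ ∈ Ω
  · obtain ⟨r, hr, hsub⟩ := Metric.isOpen_iff.1 hΩ.isOpen x₀ hx
    exact ⟨r, hr, univ, isOpen_univ, ⟨0, trivial⟩, fun v _ x _ _ t _ h => hsub h⟩
  · have hfr : x₀ ∈ frontier Ω := by rw [hΩ.isOpen.frontier_eq]; exact ⟨hx₀, hx⟩
    obtain ⟨e, K, γ, r, he, hγ, hr, h⟩ := hΩ.lipschitz x₀ hfr
    refine ⟨r, hr, {v | K * ‖v - (inner ℝ e v : ℝ) • e‖ < inner ℝ e v},
      isOpen_lt (by fun_prop) (by fun_prop), ⟨e, ?_⟩, ?_⟩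
    · simp [he]
    · exact fun v hv x hxc hxr t ht hxt => add_smul_mem_of_cone hγ h hv hxc hxr ht hxt

end Geometry

/-! ### The Poincaré inequality -/

section Poincare

variable {F : Type*} [NormedAddCommGroup F]

theorem enorm_rpow_sub_le {p : ℝ} (hp : 1 ≤ p) (a b c : F) :
    ‖a - c‖ₑ ^ p ≤ 2 ^ (p - 1) * (‖a - b‖ₑ ^ p + ‖b - c‖ₑ ^ p) := by
  refine le_trans ?_ (ENNReal.rpow_add_le_mul_rpow_add_rpow _ _ hp)
  gcongr
  simpa using enorm_add_le (a - b) (b - c)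

variable [NormedSpace ℝ F]

theorem rpow_setLIntegral_Icc_le {f : ℝ → ℝ≥0∞} (hf : Measurable f) {p : ℝ} (hp : 1 ≤ p) :
    (∫⁻ t in Icc (0 : ℝ) 1, f t) ^ p ≤ ∫⁻ t in Icc (0 : ℝ) 1, f t ^ p := by
  have hp0 : 0 < p := by linarith
  have : IsProbabilityMeasure (volume.restrict (Icc (0 : ℝ) 1)) := ⟨by simp⟩
  have h := eLpNorm'_le_eLpNorm'_of_exponent_le (f := f) (μ := volume.restrict (Icc (0 : ℝ) 1))
    zero_lt_one hp hf.aestronglyMeasurable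
  simp only [eLpNorm', enorm_eq_self, ENNReal.rpow_one, div_one] at h
  calc _ ≤ ((∫⁻ t in Icc (0 : ℝ) 1, f t ^ p) ^ (1 / p)) ^ p := by gcongr
    _ = _ := by rw [← ENNReal.rpow_mul, one_div_mul_cancel hp0.ne', ENNReal.rpow_one]

variable {n : ℕ} {Ω : Set (Vec n)}

theorem setLIntegral_comp_add_le {A B : Set (Vec n)} (hA : MeasurableSet A) (hB : MeasurableSet B)
    {h : Vec n} (hAB : ∀ x ∈ A, x + h ∈ B) (f : Vec n → ℝ≥0∞) :
    ∫⁻ x in A, f (x + h) ≤ ∫⁻ x in B, f x := by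
  rw [← lintegral_indicator hA, ← lintegral_indicator hB,
    ← lintegral_add_right_eq_self (fun x => B.indicator f x) h]
  refine lintegral_mono fun x => ?_
  by_cases hx : x ∈ A
  · rw [indicator_of_mem hx, indicator_of_mem (hAB x hx)]
  · rw [indicator_of_notMem hx]; exact zero_le

theorem hasDerivAt_comp_add_smul {φ : Vec n → F} (hφ : ContDiff ℝ 1 φ) (x h : Vec n) (t : ℝ) :
    HasDerivAt (fun s : ℝ => φ (x + s • h)) (fderiv ℝ φ (x + t • h) h) t := by
  have h1 : HasDerivAt (fun s : ℝ => x + s • h) h t := by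
    simpa using ((hasDerivAt_id t).smul_const h).const_add x
  exact ((hφ.differentiable one_ne_zero _).hasFDerivAt).comp_hasDerivAt t h1

theorem enorm_sub_le_lintegral_fderiv {φ : Vec n → F} (hφ : ContDiff ℝ 1 φ) (x h : Vec n) :
    ‖φ (x + h) - φ x‖ₑ ≤ ‖h‖ₑ * ∫⁻ t in Icc (0 : ℝ) 1, ‖fderiv ℝ φ (x + t • h)‖ₑ := by
  have hc : ContDiff ℝ 1 (fun s : ℝ => φ (x + s • h)) := hφ.comp (by fun_prop)
  have h1 := enorm_sub_le_lintegral_deriv_of_contDiffOn_Icc (a := 0) (b := 1) hc.contDiffOn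
    zero_le_one
  simp only [one_smul, zero_smul, add_zero] at h1
  refine h1.trans ?_
  have hm : Measurable fun t : ℝ => ‖fderiv ℝ φ (x + t • h)‖ₑ :=
    ((hφ.continuous_fderiv one_ne_zero).comp (by fun_prop)).enorm.measurable
  rw [← lintegral_const_mul _ hm]
  refine lintegral_mono fun t => ?_
  rw [(hasDerivAt_comp_add_smul hφ x h t).deriv, mul_comm]
  exact ContinuousLinearMap.le_opENorm _ _

/-- The increments of a function are controlled in `L^p` by its derivative. -/
theorem setLIntegral_enorm_sub_rpow_le {φ : Vec n → F} (hφ : ContDiff ℝ 1 φ) {p : ℝ} (hp : 1 ≤ p)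
    (hΩ : MeasurableSet Ω) {A : Set (Vec n)} (hA : MeasurableSet A) {h : Vec n}
    (hseg : ∀ x ∈ A, ∀ t ∈ Icc (0 : ℝ) 1, x + t • h ∈ Ω) :
    ∫⁻ x in A, ‖φ (x + h) - φ x‖ₑ ^ p ≤ ‖h‖ₑ ^ p * ∫⁻ x in Ω, ‖fderiv ℝ φ x‖ₑ ^ p := by
  have hp0 : 0 < p := by linarith
  have hD : Continuous fun x => ‖fderiv ℝ φ x‖ₑ := (hφ.continuous_fderiv one_ne_zero).enorm
  have hD2 : Measurable fun x => ‖fderiv ℝ φ x‖ₑ ^ p := hD.measurable.pow_const p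
  have hjoint : Measurable fun z : Vec n × ℝ => ‖fderiv ℝ φ (z.1 + z.2 • h)‖ₑ ^ p :=
    hD2.comp (by fun_prop)
  calc ∫⁻ x in A, ‖φ (x + h) - φ x‖ₑ ^ p
      ≤ ∫⁻ x in A, ‖h‖ₑ ^ p * ∫⁻ t in Icc (0 : ℝ) 1, ‖fderiv ℝ φ (x + t • h)‖ₑ ^ p := by
        refine lintegral_mono fun x => ?_
        calc ‖φ (x + h) - φ x‖ₑ ^ p
            ≤ (‖h‖ₑ * ∫⁻ t in Icc (0 : ℝ) 1, ‖fderiv ℝ φ (x + t • h)‖ₑ) ^ p := by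
              gcongr; exact enorm_sub_le_lintegral_fderiv hφ x h
          _ ≤ _ := by
              rw [ENNReal.mul_rpow_of_nonneg _ _ hp0.le]
              gcongr
              exact rpow_setLIntegral_Icc_le (hD.measurable.comp (by fun_prop)) hp
    _ = ‖h‖ₑ ^ p * ∫⁻ x in A, ∫⁻ t in Icc (0 : ℝ) 1, ‖fderiv ℝ φ (x + t • h)‖ₑ ^ p :=
        lintegral_const_mul _ hjoint.lintegral_prod_right'
    _ = ‖h‖ₑ ^ p * ∫⁻ t in Icc (0 : ℝ) 1, ∫⁻ x in A, ‖fderiv ℝ φ (x + t • h)‖ₑ ^ p := by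
        rw [lintegral_lintegral_swap hjoint.aemeasurable]
    _ ≤ ‖h‖ₑ ^ p * ∫⁻ t in Icc (0 : ℝ) 1, ∫⁻ x in Ω, ‖fderiv ℝ φ x‖ₑ ^ p := by
        gcongr ‖h‖ₑ ^ p * ?_
        refine setLIntegral_mono measurable_const fun t ht => ?_
        exact setLIntegral_comp_add_le hA hΩ (fun x hx => hseg x hx t ht) fun x => ‖fderiv ℝ φ x‖ₑ ^ p
    _ = _ := by simp

/-- The Poincaré inequality on a ball that lies well inside `Ω`. -/
theorem exists_poincare_ball (hΩ : MeasurableSet Ω) {p : ℝ} (hp : 1 ≤ p) {a : Vec n} {δ : ℝ}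
    (hδ : 0 < δ) (hsub : Metric.ball a (3 * δ) ⊆ Ω) :
    ∃ C : ℝ≥0∞, C ≠ ⊤ ∧ ∀ φ : Vec n → F, ContDiff ℝ 1 φ → ∃ c : F,
      ∫⁻ x in Metric.ball a δ, ‖φ x - c‖ₑ ^ p ≤ C * ∫⁻ x in Ω, ‖fderiv ℝ φ x‖ₑ ^ p := by
  have hp0 : 0 < p := by linarith
  have hB0 : volume (Metric.ball a δ) ≠ 0 := (Metric.measure_ball_pos _ _ hδ).ne'
  have hBt : volume (Metric.ball a δ) ≠ ⊤ := measure_ball_lt_top.ne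
  set R : ℝ≥0∞ := ENNReal.ofReal (2 * δ) ^ p with hR
  have hRt : R ≠ ⊤ := ENNReal.rpow_ne_top_of_nonneg hp0.le ENNReal.ofReal_ne_top
  refine ⟨(volume (Metric.ball a δ))⁻¹ * (R * volume (Metric.ball (0 : Vec n) (2 * δ))), ?_, ?_⟩
  · exact ENNReal.mul_ne_top (ENNReal.inv_ne_top.2 hB0) (ENNReal.mul_ne_top hRt
      measure_ball_lt_top.ne)
  intro φ hφ
  set I := ∫⁻ x in Ω, ‖fderiv ℝ φ x‖ₑ ^ p with hI
  have hc := hφ.continuous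
  have hm : Measurable fun z : Vec n × Vec n => ‖φ z.1 - φ z.2‖ₑ ^ p :=
    (Continuous.enorm (by fun_prop)).measurable.pow_const p
  have hm' : Measurable fun z : Vec n × Vec n => ‖φ (z.1 + z.2) - φ z.1‖ₑ ^ p :=
    (Continuous.enorm (by fun_prop)).measurable.pow_const p
  have key : ∫⁻ x in Metric.ball a δ, ∫⁻ y in Metric.ball a δ, ‖φ y - φ x‖ₑ ^ p ≤
      R * volume (Metric.ball (0 : Vec n) (2 * δ)) * I := by
    -- Substitute y = x + h. Two points of the ball differ by less than 2δ, and the segments from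
    -- `x` to x + h stay in the ball of radius 3δ.
    calc ∫⁻ x in Metric.ball a δ, ∫⁻ y in Metric.ball a δ, ‖φ y - φ x‖ₑ ^ p
        ≤ ∫⁻ x in Metric.ball a δ, ∫⁻ h in Metric.ball (0 : Vec n) (2 * δ),
            ‖φ (x + h) - φ x‖ₑ ^ p := by
          refine setLIntegral_mono hm'.lintegral_prod_right' fun x hx => ?_
          rw [← lintegral_indicator measurableSet_ball, ← lintegral_indicator measurableSet_ball,
            ← lintegral_add_left_eq_self _ x]
          refine lintegral_mono fun h => ?_
          by_cases hh : x + h ∈ Metric.ball a δ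
          · have : h ∈ Metric.ball (0 : Vec n) (2 * δ) := by
              rw [mem_ball_zero_iff]
              rw [mem_ball_iff_norm] at hh hx
              calc ‖h‖ = ‖(x + h - a) - (x - a)‖ := by congr 1; abel
                _ ≤ ‖x + h - a‖ + ‖x - a‖ := norm_sub_le _ _
                _ < 2 * δ := by linarith
            simp only [indicator_of_mem hh, indicator_of_mem this, le_refl]
          · simp only [indicator_of_notMem hh, zero_le]
      _ = ∫⁻ h in Metric.ball (0 : Vec n) (2 * δ), ∫⁻ x in Metric.ball a δ,
            ‖φ (x + h) - φ x‖ₑ ^ p := lintegral_lintegral_swap hm'.aemeasurable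
      _ ≤ ∫⁻ h in Metric.ball (0 : Vec n) (2 * δ), R * I := by
          refine setLIntegral_mono measurable_const fun h hh => ?_
          refine (setLIntegral_enorm_sub_rpow_le hφ hp hΩ measurableSet_ball
            fun x hx t ht => hsub ?_).trans ?_
          · rw [mem_ball_iff_norm] at hx ⊢
            rw [mem_ball_zero_iff] at hh
            have h1 : ‖t • h‖ ≤ ‖h‖ := by
              rw [norm_smul, Real.norm_of_nonneg ht.1]
              exact mul_le_of_le_one_left (norm_nonneg _) ht.2
            calc ‖x + t • h - a‖ = ‖(x - a) + t • h‖ := by congr 1; abel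
              _ ≤ ‖x - a‖ + ‖t • h‖ := norm_add_le _ _
              _ < 3 * δ := by linarith
          · rw [hR]
            gcongr
            rw [← ofReal_norm]
            exact ENNReal.ofReal_le_ofReal (mem_ball_zero_iff.1 hh).le
      _ = _ := by rw [setLIntegral_const]; ring
  -- The constant is the value of `φ` at a point where the inner integral does not exceed its
  -- average; no mean value of `φ` is needed.
  obtain ⟨x, -, hx⟩ := exists_le_setLAverage (μ := volume) hB0 hBt
    (f := fun x => ∫⁻ y in Metric.ball a δ, ‖φ y - φ x‖ₑ ^ p)
    (hm.comp measurable_swap).lintegral_prod_right'.aemeasurable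
  refine ⟨φ x, hx.trans ?_⟩
  rw [setLAverage_eq, ENNReal.div_eq_inv_mul, mul_assoc]
  gcongr

/-- The Poincaré inequality for `V ∩ Ω`, with the derivative on all of `Ω` on the right-hand
side. -/
def PoincareOn (F : Type*) [NormedAddCommGroup F] [NormedSpace ℝ F] (Ω : Set (Vec n)) (p : ℝ)
    (V : Set (Vec n)) : Prop :=
  ∃ C : ℝ≥0∞, C ≠ ⊤ ∧ ∀ φ : Vec n → F, ContDiff ℝ 1 φ → ∃ c : F,
    ∫⁻ x in V ∩ Ω, ‖φ x - c‖ₑ ^ p ≤ C * ∫⁻ x in Ω, ‖fderiv ℝ φ x‖ₑ ^ p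

/-- A translation along an admissible direction carries Ω near `x₀` into a ball well inside Ω,
through segments that stay in Ω. The inequality on that ball is pulled back, at the price of the
increment of `φ` along the segments, which the derivative controls. -/
theorem IsBoundedLipschitzDomain.exists_poincareOn_nhds (hΩ : IsBoundedLipschitzDomain Ω) {p : ℝ}
    (hp : 1 ≤ p) {x₀ : Vec n} (hx₀ : x₀ ∈ closure Ω) :
    ∃ V : Set (Vec n), IsOpen V ∧ x₀ ∈ V ∧ PoincareOn F Ω p V := by
  have hp0 : 0 < p := by linarith
  have hΩm := hΩ.isOpen.measurableSet
  obtain ⟨r, hr, U, -, ⟨v, hv⟩, hcone⟩ := hΩ.exists_directions hx₀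
  obtain ⟨t₀, ht₀, ht₀r⟩ : ∃ t₀ : ℝ, 0 < t₀ ∧ x₀ + t₀ • v ∈ Metric.ball x₀ r := by
    have : Tendsto (fun t : ℝ => x₀ + t • v) (𝓝[>] 0) (𝓝 x₀) := by
      have h : Tendsto (fun t : ℝ => x₀ + t • v) (𝓝 0) (𝓝 (x₀ + (0 : ℝ) • v)) :=
        (by fun_prop : Continuous fun t : ℝ => x₀ + t • v).tendsto 0
      rw [zero_smul, add_zero] at h
      exact h.mono_left nhdsWithin_le_nhds
    obtain ⟨t, h1, h2⟩ := ((this.eventually (Metric.ball_mem_nhds x₀ hr)).and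
      self_mem_nhdsWithin).exists
    exact ⟨t, h2, h1⟩
  set h := t₀ • v with hh
  have hmem : x₀ + h ∈ Ω ∩ Metric.ball x₀ r :=
    ⟨hcone v hv x₀ hx₀ (Metric.mem_ball_self hr) t₀ ht₀ ht₀r, ht₀r⟩
  obtain ⟨ε, hε, hεsub⟩ := Metric.isOpen_iff.1 (hΩ.isOpen.inter Metric.isOpen_ball) _ hmem
  -- The bound ε / 3 keeps the tripled ball about x₀ + h in Ω and in the ball of radius `r`; the
  -- bound `r` keeps the starting points in the latter, so that by convexity whole segments stay
  -- there.
  set δ := min (ε / 3) r with hδdef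
  have hδ : 0 < δ := lt_min (by positivity) hr
  have hδε : 3 * δ ≤ ε := by linarith [min_le_left (ε / 3) r]
  have hballsub : Metric.ball (x₀ + h) (3 * δ) ⊆ Ω ∩ Metric.ball x₀ r :=
    (Metric.ball_subset_ball hδε).trans hεsub
  obtain ⟨C, hC, hball⟩ := exists_poincare_ball (F := F) hΩm hp hδ
    (hballsub.trans inter_subset_left)
  refine ⟨Metric.ball x₀ δ, Metric.isOpen_ball, Metric.mem_ball_self hδ,
    2 ^ (p - 1) * (‖h‖ₑ ^ p + C), ?_, fun φ hφ => ?_⟩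
  · have : (2 : ℝ≥0∞) ^ (p - 1) ≠ ⊤ :=
      ENNReal.rpow_ne_top_of_nonneg (by linarith) ENNReal.ofNat_ne_top
    exact ENNReal.mul_ne_top this (ENNReal.add_ne_top.2
      ⟨ENNReal.rpow_ne_top_of_nonneg hp0.le enorm_ne_top, hC⟩)
  obtain ⟨c, hc⟩ := hball φ hφ
  refine ⟨c, ?_⟩
  have hφc := hφ.continuous
  have hAm : MeasurableSet (Metric.ball x₀ δ ∩ Ω) := measurableSet_ball.inter hΩm
  have hshift : ∀ x ∈ Metric.ball x₀ δ, x + h ∈ Metric.ball (x₀ + h) δ := by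
    intro x hx
    rw [mem_ball_iff_norm] at hx ⊢
    simpa using hx
  have h1 := setLIntegral_enorm_sub_rpow_le hφ hp hΩm hAm (h := h) (fun x hx t ht => by
    have hxr : x ∈ Metric.ball x₀ r := Metric.ball_subset_ball (min_le_right _ _) hx.1
    have hxhr : x + h ∈ Metric.ball x₀ r :=
      (hballsub (Metric.ball_subset_ball (by linarith) (hshift x hx.1))).2
    have hxt : x + t • h ∈ Metric.ball x₀ r :=
      (convex_ball x₀ r).add_smul_mem hxr hxhr ht
    rcases ht.1.eq_or_lt with h0 | h0
    · rw [← h0, zero_smul, add_zero]; exact hx.2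
    · rw [hh, smul_smul] at hxt ⊢
      exact hcone v hv x (subset_closure hx.2) hxr _ (by positivity) hxt)
  have h2 : ∫⁻ x in Metric.ball x₀ δ ∩ Ω, ‖φ (x + h) - c‖ₑ ^ p ≤
      ∫⁻ x in Metric.ball (x₀ + h) δ, ‖φ x - c‖ₑ ^ p :=
    setLIntegral_comp_add_le hAm measurableSet_ball (fun x hx => hshift x hx.1)
      fun x => ‖φ x - c‖ₑ ^ p
  have hm1 : Measurable fun x => ‖φ (x + h) - φ x‖ₑ ^ p :=
    (Continuous.enorm (by fun_prop)).measurable.pow_const p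
  have hm2 : Measurable fun x => ‖φ (x + h) - c‖ₑ ^ p :=
    (Continuous.enorm (by fun_prop)).measurable.pow_const p
  calc ∫⁻ x in Metric.ball x₀ δ ∩ Ω, ‖φ x - c‖ₑ ^ p
      ≤ ∫⁻ x in Metric.ball x₀ δ ∩ Ω,
          2 ^ (p - 1) * (‖φ (x + h) - φ x‖ₑ ^ p + ‖φ (x + h) - c‖ₑ ^ p) := by
        refine lintegral_mono fun x => ?_
        have := enorm_rpow_sub_le hp (φ x) (φ (x + h)) c
        rwa [enorm_sub_rev (φ x) (φ (x + h))] at this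
    _ = 2 ^ (p - 1) * ((∫⁻ x in Metric.ball x₀ δ ∩ Ω, ‖φ (x + h) - φ x‖ₑ ^ p) +
          ∫⁻ x in Metric.ball x₀ δ ∩ Ω, ‖φ (x + h) - c‖ₑ ^ p) := by
        rw [lintegral_const_mul' _ _ (ENNReal.rpow_ne_top_of_nonneg (by linarith)
          ENNReal.ofNat_ne_top), lintegral_add_left hm1]
    _ ≤ 2 ^ (p - 1) * ((‖h‖ₑ ^ p * ∫⁻ x in Ω, ‖fderiv ℝ φ x‖ₑ ^ p) +
          C * ∫⁻ x in Ω, ‖fderiv ℝ φ x‖ₑ ^ p) := by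
        gcongr
        exact h2.trans hc
    _ = _ := by ring

/-- The constants c₁ and c₂ of the two pieces are compared on the overlap: both are close to `φ`
there, and the overlap, being open and non-empty, has positive measure. -/
theorem PoincareOn.union {p : ℝ} (hp : 1 ≤ p) (hΩ : IsOpen Ω) (hΩt : volume Ω ≠ ⊤)
    {V W : Set (Vec n)} (hV : IsOpen V) (hW : IsOpen W) (hne : (Ω ∩ (V ∩ W)).Nonempty)
    (h₁ : PoincareOn F Ω p V) (h₂ : PoincareOn F Ω p W) : PoincareOn F Ω p (V ∪ W) := by
  have hp0 : 0 < p := by linarith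
  obtain ⟨C₁, hC₁, h₁⟩ := h₁
  obtain ⟨C₂, hC₂, h₂⟩ := h₂
  set S := Ω ∩ (V ∩ W) with hS
  have hSo : IsOpen S := hΩ.inter (hV.inter hW)
  have hS0 : volume S ≠ 0 := (hSo.measure_pos volume hne).ne'
  have hSt : volume S ≠ ⊤ := measure_ne_top_of_subset inter_subset_left hΩt
  set A : ℝ≥0∞ := 2 ^ (p - 1) with hA
  have hAt : A ≠ ⊤ := ENNReal.rpow_ne_top_of_nonneg (by linarith) ENNReal.ofNat_ne_top
  set B : ℝ≥0∞ := (volume S)⁻¹ * (A * (C₁ + C₂)) with hB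
  have hBt : B ≠ ⊤ := ENNReal.mul_ne_top (ENNReal.inv_ne_top.2 hS0)
    (ENNReal.mul_ne_top hAt (ENNReal.add_ne_top.2 ⟨hC₁, hC₂⟩))
  refine ⟨C₁ + A * (C₂ + B * volume Ω), ?_, fun φ hφ => ?_⟩
  · exact ENNReal.add_ne_top.2 ⟨hC₁, ENNReal.mul_ne_top hAt (ENNReal.add_ne_top.2
      ⟨hC₂, ENNReal.mul_ne_top hBt hΩt⟩)⟩
  obtain ⟨c₁, hc₁⟩ := h₁ φ hφ
  obtain ⟨c₂, hc₂⟩ := h₂ φ hφ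
  set I := ∫⁻ x in Ω, ‖fderiv ℝ φ x‖ₑ ^ p with hI
  have hφc := hφ.continuous
  have hm : ∀ c : F, Measurable fun x => ‖φ x - c‖ₑ ^ p := fun c =>
    (Continuous.enorm (by fun_prop)).measurable.pow_const p
  have hcc : ‖c₂ - c₁‖ₑ ^ p ≤ B * I := by
    have h3 : ‖c₂ - c₁‖ₑ ^ p * volume S ≤ A * (C₁ + C₂) * I := by
      calc ‖c₂ - c₁‖ₑ ^ p * volume S = ∫⁻ x in S, ‖c₂ - c₁‖ₑ ^ p := by
            rw [setLIntegral_const]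
        _ ≤ ∫⁻ x in S, A * (‖φ x - c₂‖ₑ ^ p + ‖φ x - c₁‖ₑ ^ p) := by
            refine lintegral_mono fun x => ?_
            have := enorm_rpow_sub_le hp c₂ (φ x) c₁
            rwa [enorm_sub_rev c₂ (φ x)] at this
        _ = A * ((∫⁻ x in S, ‖φ x - c₂‖ₑ ^ p) + ∫⁻ x in S, ‖φ x - c₁‖ₑ ^ p) := by
            rw [lintegral_const_mul' _ _ hAt, lintegral_add_left (hm _)]
        _ ≤ A * (C₂ * I + C₁ * I) := by
            gcongr
            · exact (lintegral_mono_set (t := W ∩ Ω) fun x hx => ⟨hx.2.2, hx.1⟩).trans hc₂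
            · exact (lintegral_mono_set (t := V ∩ Ω) fun x hx => ⟨hx.2.1, hx.1⟩).trans hc₁
        _ = _ := by ring
    rwa [hB, mul_assoc, ← ENNReal.div_eq_inv_mul,
      ENNReal.le_div_iff_mul_le (Or.inl hS0) (Or.inl hSt)]
  refine ⟨c₁, ?_⟩
  calc ∫⁻ x in (V ∪ W) ∩ Ω, ‖φ x - c₁‖ₑ ^ p
      ≤ (∫⁻ x in V ∩ Ω, ‖φ x - c₁‖ₑ ^ p) + ∫⁻ x in W ∩ Ω, ‖φ x - c₁‖ₑ ^ p := by
        rw [union_inter_distrib_right]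
        exact lintegral_union_le _ _ _
    _ ≤ C₁ * I + ∫⁻ x in W ∩ Ω, A * (‖φ x - c₂‖ₑ ^ p + ‖c₂ - c₁‖ₑ ^ p) := by
        gcongr with x
        exact enorm_rpow_sub_le hp _ _ _
    _ = C₁ * I + A * ((∫⁻ x in W ∩ Ω, ‖φ x - c₂‖ₑ ^ p) + ‖c₂ - c₁‖ₑ ^ p * volume (W ∩ Ω)) := by
        rw [lintegral_const_mul' _ _ hAt, lintegral_add_left (hm _),
          setLIntegral_const]
    _ ≤ C₁ * I + A * (C₂ * I + B * I * volume Ω) := by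
        gcongr
        exact inter_subset_right
    _ = _ := by ring

/-- The Poincaré inequality on a bounded Lipschitz domain. -/
theorem IsBoundedLipschitzDomain.exists_poincare (hΩ : IsBoundedLipschitzDomain Ω) {p : ℝ}
    (hp : 1 ≤ p) :
    ∃ C : ℝ≥0∞, C ≠ ⊤ ∧ ∀ φ : Vec n → F, ContDiff ℝ 1 φ → ∃ c : F,
      ∫⁻ x in Ω, ‖φ x - c‖ₑ ^ p ≤ C * ∫⁻ x in Ω, ‖fderiv ℝ φ x‖ₑ ^ p := by
  have hΩt : volume Ω ≠ ⊤ := hΩ.isBounded.measure_lt_top.ne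
  choose! V hVo hVmem hVP using fun x₀ (hx₀ : x₀ ∈ closure Ω) =>
    hΩ.exists_poincareOn_nhds (F := F) hp hx₀
  obtain ⟨I, hI, hcov⟩ := hΩ.isBounded.isCompact_closure.elim_nhds_subcover V
    fun x hx => (hVo x hx).mem_nhds (hVmem x hx)
  have hcovΩ : Ω ⊆ ⋃ x ∈ I, V x := subset_closure.trans hcov
  obtain ⟨w, hw⟩ := hΩ.isConnected.nonempty
  obtain ⟨i₀, hi₀, hwi⟩ := mem_iUnion₂.1 (hcovΩ hw)
  classical
  -- Take a largest subfamily, containing `i₀`, whose union satisfies the inequality. If it did not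
  -- cover Ω, connectedness would give a remaining piece that meets it inside Ω and could be added.
  set G : Finset (Finset (Vec n)) := I.powerset.filter fun J =>
    i₀ ∈ J ∧ PoincareOn F Ω p (⋃ x ∈ J, V x) with hG
  have hGne : G.Nonempty := by
    refine ⟨{i₀}, ?_⟩
    simp only [hG, Finset.mem_filter, Finset.mem_powerset, Finset.singleton_subset_iff,
      Finset.mem_singleton, true_and, iUnion_iUnion_eq_left]
    exact ⟨hi₀, hVP i₀ (hI i₀ hi₀)⟩
  obtain ⟨J, hJ, hmax⟩ := G.exists_max_image Finset.card hGne
  simp only [hG, Finset.mem_filter, Finset.mem_powerset] at hJ hmax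
  obtain ⟨hJI, hi₀J, hJP⟩ := hJ
  have hopen : ∀ J' ⊆ I, IsOpen (⋃ x ∈ J', V x) := fun J' hJ' =>
    isOpen_biUnion fun x hx => hVo x (hI x (hJ' hx))
  have hJΩ : Ω ⊆ ⋃ x ∈ J, V x := by
    by_contra hnot
    obtain ⟨z, hz, hzJ⟩ := not_subset.1 hnot
    obtain ⟨k, hk, hzk⟩ := mem_iUnion₂.1 (hcovΩ hz)
    have hkJ : k ∉ J := fun h => hzJ (mem_biUnion h hzk)
    obtain ⟨x, hxΩ, hxu, hxv⟩ := hΩ.isConnected.isPreconnected (⋃ x ∈ J, V x)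
      (⋃ x ∈ I \ J, V x) (hopen J hJI) (hopen _ Finset.sdiff_subset) (by
        intro x hx
        obtain ⟨i, hi, hxi⟩ := mem_iUnion₂.1 (hcovΩ hx)
        by_cases hiJ : i ∈ J
        · exact Or.inl (mem_biUnion hiJ hxi)
        · exact Or.inr (mem_biUnion (Finset.mem_sdiff.2 ⟨hi, hiJ⟩) hxi))
      ⟨w, hw, mem_biUnion hi₀J hwi⟩ ⟨z, hz, mem_biUnion (Finset.mem_sdiff.2 ⟨hk, hkJ⟩) hzk⟩
    obtain ⟨i, hi, hxi⟩ := mem_iUnion₂.1 hxv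
    obtain ⟨hiI, hiJ⟩ := Finset.mem_sdiff.1 hi
    have hle := hmax (insert i J) ⟨Finset.insert_subset hiI hJI, Finset.mem_insert_of_mem hi₀J, by
      rw [Finset.set_biUnion_insert]
      exact (hVP i (hI i hiI)).union hp hΩ.isOpen hΩt (hVo i (hI i hiI)) (hopen J hJI)
        ⟨x, hxΩ, hxi, hxu⟩ hJP⟩
    rw [Finset.card_insert_of_notMem hiJ] at hle
    omega
  rwa [PoincareOn, inter_eq_self_of_subset_right hJΩ] at hJP

end Poincare

/-! ### The Sobolev and trace inequalities with exponent one -/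

section SobolevOne

variable {n : ℕ} {Ω : Set (Vec n)}

/-- By uniqueness of Haar measure a linear change of variables only costs a constant. Its value is
irrelevant below; that it is neither zero nor infinite suffices. -/
theorem exists_lintegral_comp_linearEquiv {X : Type*} [NormedAddCommGroup X] [NormedSpace ℝ X]
    [FiniteDimensional ℝ X] [MeasurableSpace X] [BorelSpace X] (μ : Measure X)
    [μ.IsAddHaarMeasure] (L : X ≃L[ℝ] Vec n) :
    ∃ c : ℝ≥0∞, c ≠ 0 ∧ c ≠ ⊤ ∧ ∀ f : Vec n → ℝ≥0∞,
      ∫⁻ x, f (L x) ∂μ = c * ∫⁻ z, f z := by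
  have h := Measure.isAddLeftInvariant_eq_smul (μ.map L) (volume : Measure (Vec n))
  refine ⟨(Measure.addHaarScalarFactor (μ.map L) volume : ℝ≥0), ?_, ENNReal.coe_ne_top, ?_⟩
  · exact ENNReal.coe_ne_zero.2
      (Measure.addHaarScalarFactor_pos_of_isAddHaarMeasure (μ.map L) volume).ne'
  intro f
  calc ∫⁻ x, f (L x) ∂μ = ∫⁻ z, f z ∂(μ.map L) :=
        (lintegral_map_equiv f L.toHomeomorph.toMeasurableEquiv).symm
    _ = _ := by
      conv_lhs => rw [h]
      rw [lintegral_smul_measure]; rfl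

/-- A subspace with non-empty interior is the whole space, so `U` spans. This extracts coordinate
axes from the open set of admissible directions. -/
theorem exists_basis_subset {U : Set (Vec n)} (hU : IsOpen U) (hne : U.Nonempty) :
    ∃ b : Module.Basis (Fin n) ℝ (Vec n), ∀ i, b i ∈ U := by
  have hspan : ⊤ ≤ Submodule.span ℝ U := by
    refine ((Submodule.span ℝ U).eq_top_of_nonempty_interior' ?_).ge
    exact hne.mono (interior_maximal Submodule.subset_span hU)
  set b := Module.Basis.ofSpan hspan with hb
  have := Module.Finite.finite_basis b
  have : Fintype ((linearIndepOn_empty ℝ id).extend (empty_subset U)) := Fintype.ofFinite _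
  have hcard : Fintype.card ((linearIndepOn_empty ℝ id).extend (empty_subset U)) = n := by
    rw [← Module.finrank_eq_card_basis b]; simp
  refine ⟨b.reindex (Fintype.equivFinOfCardEq hcard), fun i => ?_⟩
  rw [Module.Basis.reindex_apply]
  exact Module.Basis.ofSpan_subset hspan (mem_range_self _)

/-- A function supported in a ball is controlled by the integral of its derivative along a
ray that, inside the ball, stays in `Ω`. -/
theorem enorm_le_lintegral_ray {u : Vec n → ℝ} (hu : ContDiff ℝ 1 u) {x₀ : Vec n} {r : ℝ}
    (hsupp : tsupport u ⊆ Metric.ball x₀ r) {v : Vec n} (hv : v ≠ 0) {x : Vec n}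
    (hcone : x ∈ Metric.ball x₀ r → ∀ t : ℝ, 0 < t → x + t • v ∈ Metric.ball x₀ r →
      x + t • v ∈ Ω) :
    ‖u x‖ₑ ≤ ‖v‖ₑ * ∫⁻ t : ℝ, Ω.indicator (fun z => ‖fderiv ℝ u z‖ₑ) (x + t • v) := by
  by_cases hx : x ∈ Metric.ball x₀ r
  swap
  · rw [image_eq_zero_of_notMem_tsupport fun h => hx (hsupp h)]; simp
  have hv' : 0 < ‖v‖ := norm_pos_iff.2 hv
  have hr : 0 < r := Metric.nonempty_ball.1 ⟨x, hx⟩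
  -- After this time the ray has travelled the diameter of the ball and has left it, so `u` vanishes
  -- there.
  set T := 2 * r / ‖v‖ with hT
  have hT0 : 0 < T := by positivity
  have hxT : x + T • v ∉ Metric.ball x₀ r := by
    intro h
    rw [mem_ball_iff_norm] at h hx
    have h1 : ‖T • v‖ = 2 * r := by
      rw [norm_smul, Real.norm_of_nonneg hT0.le, hT, div_mul_cancel₀ _ hv'.ne']
    have h2 : ‖T • v‖ ≤ ‖x + T • v - x₀‖ + ‖x - x₀‖ := by
      calc ‖T • v‖ = ‖(x + T • v - x₀) - (x - x₀)‖ := by congr 1; abel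
        _ ≤ _ := norm_sub_le _ _
    linarith
  have hc : ContDiff ℝ 1 (fun s : ℝ => u (x + s • v)) := hu.comp (by fun_prop)
  have h1 := enorm_sub_le_lintegral_deriv_of_contDiffOn_Icc (a := 0) (b := T) hc.contDiffOn hT0.le
  rw [image_eq_zero_of_notMem_tsupport fun h => hxT (hsupp h)] at h1
  simp only [zero_smul, add_zero, zero_sub, enorm_neg] at h1
  rw [← restrict_Ioc_eq_restrict_Icc] at h1
  refine h1.trans ?_
  rw [← lintegral_const_mul' _ _ enorm_ne_top]
  refine (setLIntegral_mono_ae' measurableSet_Ioc (.of_forall fun t ht => ?_)).trans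
    (setLIntegral_le_lintegral _ _)
  rw [(hasDerivAt_comp_add_smul hu x v t).deriv]
  -- Inside the ball the ray lies in Ω; outside it the derivative of `u` vanishes. So the indicator
  -- of Ω loses nothing.
  by_cases hxt : x + t • v ∈ Metric.ball x₀ r
  · rw [indicator_of_mem (hcone hx t ht.1 hxt), mul_comm]
    exact ContinuousLinearMap.le_opENorm _ _
  · have h2 : fderiv ℝ u (x + t • v) = 0 :=
      image_eq_zero_of_notMem_tsupport fun h => hxt (hsupp (tsupport_fderiv_subset ℝ h))
    rw [h2]; simp

/-- The Gagliardo–Nirenberg–Sobolev inequality for functions supported near a point of `closure Ω`,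
where `Ω` contains the segments issuing in `n` independent directions. -/
theorem exists_sobolev_one_of_tsupport_subset (hn : 2 ≤ n) (hΩ : MeasurableSet Ω) {x₀ : Vec n}
    {r : ℝ} (b : Module.Basis (Fin n) ℝ (Vec n))
    (hcone : ∀ i, ∀ x ∈ Ω, x ∈ Metric.ball x₀ r → ∀ t : ℝ, 0 < t →
      x + t • b i ∈ Metric.ball x₀ r → x + t • b i ∈ Ω) :
    ∃ C : ℝ≥0∞, C ≠ ⊤ ∧ ∀ u : Vec n → ℝ, ContDiff ℝ 1 u → tsupport u ⊆ Metric.ball x₀ r →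
      ∫⁻ x in Ω, ‖u x‖ₑ ^ ((n : ℝ) / (n - 1)) ≤
        C * (∫⁻ x in Ω, ‖fderiv ℝ u x‖ₑ) ^ ((n : ℝ) / (n - 1)) := by
  classical
  have hn2 : (2 : ℝ) ≤ n := by exact_mod_cast hn
  have hn1 : (0 : ℝ) < (n : ℝ) - 1 := by linarith
  set p : ℝ := (n : ℝ) / (n - 1) with hp
  have hp0 : 0 < p := by positivity
  -- In the coordinates of `b` the rays are parallel to the axes, which is the setting of the
  -- Gagliardo–Nirenberg product inequality.
  set L : (Fin n → ℝ) ≃L[ℝ] Vec n := b.equivFun.symm.toContinuousLinearEquiv with hL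
  obtain ⟨c, hc0, hct, hc⟩ := exists_lintegral_comp_linearEquiv
    (volume : Measure (Fin n → ℝ)) L
  set M : ℝ≥0∞ := ∑ i, ‖b i‖ₑ with hM
  have hMt : M ≠ ⊤ := ENNReal.sum_ne_top.2 fun i _ => enorm_ne_top
  have hupd : ∀ (x : Fin n → ℝ) (i : Fin n) (s : ℝ),
      L (Function.update x i s) = L x + (s - x i) • b i := by
    intro x i s
    have h1 : Function.update x i s = x + (s - x i) • Pi.single i (1 : ℝ) := by
      ext j
      by_cases hj : j = i
      · subst hj; simp
      · simp [hj]
    rw [h1, map_add, map_smul]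
    congr 2
    simp [hL, Module.Basis.equivFun_symm_apply, Pi.single_apply]
  refine ⟨c⁻¹ * (M * c) ^ p, ?_, fun u hu hsupp => ?_⟩
  · exact ENNReal.mul_ne_top (ENNReal.inv_ne_top.2 hc0)
      (ENNReal.rpow_ne_top_of_nonneg hp0.le (ENNReal.mul_ne_top hMt hct))
  set g : Vec n → ℝ≥0∞ := Ω.indicator fun z => ‖fderiv ℝ u z‖ₑ with hg
  have hgm : Measurable g :=
    (hu.continuous_fderiv one_ne_zero).enorm.measurable.indicator hΩ
  have hfm : Measurable fun x : Fin n → ℝ => M * g (L x) :=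
    (hgm.comp L.continuous.measurable).const_mul _
  have hconj : Real.HolderConjugate (Fintype.card (Fin n)) p := by
    rw [Fintype.card_fin]
    exact Real.HolderConjugate.conjExponent (by linarith)
  have hpoint : ∀ x : Fin n → ℝ, Ω.indicator (fun z => ‖u z‖ₑ ^ p) (L x) ≤
      ∏ i, (∫⁻ s, M * g (L (Function.update x i s))) ^
        ((1 : ℝ) / ((Fintype.card (Fin n) : ℝ) - 1)) := by
    intro x
    by_cases hx : L x ∈ Ω
    swap
    · rw [indicator_of_notMem hx]; exact zero_le
    rw [indicator_of_mem hx]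
    have h1 : ∀ i, ‖u (L x)‖ₑ ≤ ∫⁻ s, M * g (L (Function.update x i s)) := by
      intro i
      refine (enorm_le_lintegral_ray hu hsupp (b.ne_zero i) (hcone i (L x) hx)).trans ?_
      rw [lintegral_const_mul' _ _ hMt]
      refine mul_le_mul' ?_ ?_
      · exact Finset.single_le_sum (f := fun i => ‖b i‖ₑ) (fun _ _ => zero_le)
          (Finset.mem_univ i)
      · simp_rw [hupd]
        exact (lintegral_sub_right_eq_self (μ := (volume : Measure ℝ))
          (fun t => g (L x + t • b i)) (x i)).ge
    -- The power n/(n-1) is distributed over `n` factors of exponent 1/(n-1), one for each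
    -- direction.
    calc ‖u (L x)‖ₑ ^ p
        = ∏ _i : Fin n, ‖u (L x)‖ₑ ^ ((1 : ℝ) / ((Fintype.card (Fin n) : ℝ) - 1)) := by
          rw [Finset.prod_const, ← ENNReal.rpow_natCast, ← ENNReal.rpow_mul]
          congr 1
          simp only [Fintype.card_fin, Finset.card_univ, hp]
          field_simp
      _ ≤ _ := by
          refine Finset.prod_le_prod' fun i _ => ?_
          have : (0 : ℝ) ≤ 1 / ((Fintype.card (Fin n) : ℝ) - 1) := by
            rw [Fintype.card_fin]; positivity
          gcongr
          exact h1 i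
  have hmain : c * ∫⁻ x in Ω, ‖u x‖ₑ ^ p ≤ (M * (c * ∫⁻ x in Ω, ‖fderiv ℝ u x‖ₑ)) ^ p := by
    calc c * ∫⁻ x in Ω, ‖u x‖ₑ ^ p
        = ∫⁻ x : Fin n → ℝ, Ω.indicator (fun z => ‖u z‖ₑ ^ p) (L x) := by
          rw [hc, lintegral_indicator hΩ]
      _ ≤ ∫⁻ x : Fin n → ℝ, ∏ i, (∫⁻ s, M * g (L (Function.update x i s))) ^
            ((1 : ℝ) / ((Fintype.card (Fin n) : ℝ) - 1)) := lintegral_mono hpoint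
      _ ≤ (∫⁻ x : Fin n → ℝ, M * g (L x)) ^ p :=
          lintegral_prod_lintegral_pow_le (fun _ => volume) hconj hfm
      _ = _ := by rw [lintegral_const_mul' _ _ hMt, hc, hg, lintegral_indicator hΩ]
  rw [mul_comm, ← ENNReal.le_div_iff_mul_le (Or.inl hc0) (Or.inl hct), ENNReal.div_eq_inv_mul,
    ← mul_assoc M c, ENNReal.mul_rpow_of_nonneg _ _ hp0.le, ← mul_assoc] at hmain
  exact hmain

/-- Cutting off: every function agrees near `x₀` with one that is supported in a given ball. -/
theorem exists_cutoff (x₀ : Vec n) {r : ℝ} (hr : 0 < r) :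
    ∃ B : ℝ≥0∞, B ≠ ⊤ ∧ ∀ w : Vec n → ℝ, ContDiff ℝ 1 w → ∃ u : Vec n → ℝ, ContDiff ℝ 1 u ∧
      tsupport u ⊆ Metric.ball x₀ r ∧ (∀ x ∈ Metric.ball x₀ (r / 3), u x = w x) ∧
      ∀ x, ‖fderiv ℝ u x‖ₑ ≤ B * (‖w x‖ₑ + ‖fderiv ℝ w x‖ₑ) := by
  let ψ : ContDiffBump x₀ := ⟨r / 3, r / 2, by positivity, by linarith⟩
  have hψ : ContDiff ℝ 1 ψ := ψ.contDiff
  obtain ⟨B, hB⟩ := (hψ.continuous_fderiv one_ne_zero).bounded_above_of_compact_support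
    (ψ.hasCompactSupport.fderiv ℝ)
  refine ⟨ENNReal.ofReal B + 1, by simp, fun w hw => ⟨fun x => ψ x * w x, hψ.mul hw, ?_, ?_, ?_⟩⟩
  · refine (tsupport_mul_subset_left).trans ?_
    rw [ψ.tsupport_eq]
    exact Metric.closedBall_subset_ball (by simp only [ψ]; linarith)
  · intro x hx
    simp only [ψ.one_of_mem_closedBall (Metric.ball_subset_closedBall hx), one_mul]
  · intro x
    have hd : fderiv ℝ (fun x => ψ x * w x) x = ψ x • fderiv ℝ w x + w x • fderiv ℝ ψ x :=
      fderiv_fun_mul (hψ.differentiable one_ne_zero x) (hw.differentiable one_ne_zero x)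
    rw [hd]
    refine (enorm_add_le (ψ x • fderiv ℝ w x) (w x • fderiv ℝ ψ x)).trans ?_
    rw [enorm_smul, enorm_smul]
    have h1 : ‖ψ x‖ₑ ≤ 1 := by
      rw [← ofReal_norm, Real.norm_of_nonneg ψ.nonneg]
      exact ENNReal.ofReal_le_one.2 ψ.le_one
    have h2 : ‖fderiv ℝ ψ x‖ₑ ≤ ENNReal.ofReal B := by
      rw [← ofReal_norm]
      exact ENNReal.ofReal_le_ofReal (hB x)
    calc ‖ψ x‖ₑ * ‖fderiv ℝ w x‖ₑ + ‖w x‖ₑ * ‖fderiv ℝ ψ x‖ₑ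
        ≤ 1 * ‖fderiv ℝ w x‖ₑ + ‖w x‖ₑ * ENNReal.ofReal B := by gcongr
      _ ≤ (1 * ‖fderiv ℝ w x‖ₑ + ‖w x‖ₑ * ENNReal.ofReal B) +
          (‖w x‖ₑ + ENNReal.ofReal B * ‖fderiv ℝ w x‖ₑ) := le_self_add
      _ = _ := by ring

/-- Local bounds for a class of functions add up to a bound on a compact set. -/
theorem exists_setLIntegral_le_of_local {X : Type*} [TopologicalSpace X] [MeasurableSpace X]
    {ι : Type*} {K : Set X} (hK : IsCompact K) (μ : Measure X) (f : ι → X → ℝ≥0∞) (N : ι → ℝ≥0∞)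
    (h : ∀ x ∈ K, ∃ V ∈ 𝓝 x, ∃ C : ℝ≥0∞, C ≠ ⊤ ∧ ∀ i, ∫⁻ y in V, f i y ∂μ ≤ C * N i) :
    ∃ C : ℝ≥0∞, C ≠ ⊤ ∧ ∀ i, ∫⁻ y in K, f i y ∂μ ≤ C * N i := by
  refine hK.induction_on (p := fun S => ∃ C : ℝ≥0∞, C ≠ ⊤ ∧ ∀ i, ∫⁻ y in S, f i y ∂μ ≤ C * N i)
    ⟨0, by simp⟩ ?_ ?_ ?_
  · rintro s t hst ⟨C, hC, h⟩
    exact ⟨C, hC, fun i => (lintegral_mono_set hst).trans (h i)⟩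
  · rintro s t ⟨C, hC, h⟩ ⟨C', hC', h'⟩
    refine ⟨C + C', ENNReal.add_ne_top.2 ⟨hC, hC'⟩, fun i => ?_⟩
    rw [add_mul]
    exact (lintegral_union_le _ _ _).trans (add_le_add (h i) (h' i))
  · intro x hx
    obtain ⟨V, hV, h⟩ := h x hx
    exact ⟨V, mem_nhdsWithin_of_mem_nhds hV, h⟩

/-- The Sobolev inequality with exponent one on a bounded Lipschitz domain. -/
theorem IsBoundedLipschitzDomain.exists_sobolev_one (hn : 2 ≤ n)
    (hΩ : IsBoundedLipschitzDomain Ω) :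
    ∃ C : ℝ≥0∞, C ≠ ⊤ ∧ ∀ w : Vec n → ℝ, ContDiff ℝ 1 w →
      ∫⁻ x in Ω, ‖w x‖ₑ ^ ((n : ℝ) / (n - 1)) ≤
        C * (∫⁻ x in Ω, (‖w x‖ₑ + ‖fderiv ℝ w x‖ₑ)) ^ ((n : ℝ) / (n - 1)) := by
  have hn2 : (2 : ℝ) ≤ n := by exact_mod_cast hn
  have hp0 : (0 : ℝ) ≤ (n : ℝ) / (n - 1) := div_nonneg (by linarith) (by linarith)
  have hΩm := hΩ.isOpen.measurableSet
  obtain ⟨C, hC, h⟩ := exists_setLIntegral_le_of_local hΩ.isBounded.isCompact_closure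
    (volume.restrict Ω) (ι := {w : Vec n → ℝ // ContDiff ℝ 1 w})
    (fun w x => ‖w.1 x‖ₑ ^ ((n : ℝ) / (n - 1)))
    (fun w => (∫⁻ x in Ω, (‖w.1 x‖ₑ + ‖fderiv ℝ w.1 x‖ₑ)) ^ ((n : ℝ) / (n - 1))) (by
      intro x₀ hx₀
      obtain ⟨r, hr, U, hU, hne, hcone⟩ := hΩ.exists_directions hx₀
      obtain ⟨b, hb⟩ := exists_basis_subset hU hne
      obtain ⟨C, hC, hloc⟩ := exists_sobolev_one_of_tsupport_subset hn hΩm b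
        fun i x hx => hcone (b i) (hb i) x (subset_closure hx)
      obtain ⟨B, hB, hcut⟩ := exists_cutoff x₀ hr
      refine ⟨Metric.ball x₀ (r / 3), Metric.ball_mem_nhds _ (by positivity),
        C * B ^ ((n : ℝ) / (n - 1)), ENNReal.mul_ne_top hC
          (ENNReal.rpow_ne_top_of_nonneg hp0 hB), fun ⟨w, hw⟩ => ?_⟩
      obtain ⟨u, hu, hsupp, heq, hDu⟩ := hcut w hw
      calc ∫⁻ x in Metric.ball x₀ (r / 3), ‖w x‖ₑ ^ ((n : ℝ) / (n - 1)) ∂volume.restrict Ω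
          = ∫⁻ x in Metric.ball x₀ (r / 3), ‖u x‖ₑ ^ ((n : ℝ) / (n - 1)) ∂volume.restrict Ω :=
            setLIntegral_congr_fun measurableSet_ball fun x hx => by simp only [heq x hx]
        _ ≤ ∫⁻ x in Ω, ‖u x‖ₑ ^ ((n : ℝ) / (n - 1)) := setLIntegral_le_lintegral _ _
        _ ≤ C * (∫⁻ x in Ω, ‖fderiv ℝ u x‖ₑ) ^ ((n : ℝ) / (n - 1)) := hloc u hu hsupp
        _ ≤ C * (B * ∫⁻ x in Ω, (‖w x‖ₑ + ‖fderiv ℝ w x‖ₑ)) ^ ((n : ℝ) / (n - 1)) := by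
            rw [← lintegral_const_mul' _ _ hB]
            gcongr with x
            exact hDu x
        _ = _ := by rw [ENNReal.mul_rpow_of_nonneg _ _ hp0, mul_assoc])
  refine ⟨C, hC, fun w hw => ?_⟩
  have := h ⟨w, hw⟩
  rwa [Measure.restrict_restrict isClosed_closure.measurableSet,
    inter_eq_self_of_subset_right subset_closure] at this

/-- The trace inequality for functions supported near a boundary point. -/
theorem exists_trace_one_of_tsupport_subset (hn : 2 ≤ n) (hΩ : IsOpen Ω) {x₀ e : Vec n} {r : ℝ}
    {K : ℝ≥0} {γ : Vec n → ℝ} (he : ‖e‖ = 1) (hγ : LipschitzWith K γ)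
    (h : ∀ x ∈ Metric.ball x₀ r, (x ∈ Ω ↔ γ (x - inner ℝ e x • e) < inner ℝ e x)) :
    ∃ C : ℝ≥0∞, C ≠ ⊤ ∧ ∀ u : Vec n → ℝ, ContDiff ℝ 1 u → tsupport u ⊆ Metric.ball x₀ r →
      ∫⁻ x, ‖u x‖ₑ ∂(surfaceMeasure Ω) ≤ C * ∫⁻ x in Ω, ‖fderiv ℝ u x‖ₑ := by
  have he0 : e ≠ 0 := by rintro rfl; simp at he
  set H : Submodule ℝ (Vec n) := (Submodule.span ℝ {e})ᗮ with hH
  have hfin : Module.finrank ℝ H = n - 1 := by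
    have := Submodule.finrank_add_finrank_orthogonal (Submodule.span ℝ {e})
    rw [finrank_span_singleton he0, finrank_euclideanSpace_fin] at this
    change Module.finrank ℝ (Submodule.span ℝ {e})ᗮ = _
    omega
  -- `M` gives coordinates on the hyperplane orthogonal to `e`; adding the height along `e` yields
  -- the coordinates `T` of the whole space, in which Fubini is applied, while `Φ` parametrizes the
  -- graph of `γ`.
  set M : (Fin (n - 1) → ℝ) ≃L[ℝ] H :=
    (Module.finBasisOfFinrankEq ℝ H hfin).equivFun.symm.toContinuousLinearEquiv with hM
  have hinner : ∀ a, inner ℝ e (M a : Vec n) = (0 : ℝ) := fun a =>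
    (Submodule.mem_orthogonal_singleton_iff_inner_right).1 (M a).2
  have hee : inner ℝ e e = (1 : ℝ) := by rw [real_inner_self_eq_norm_sq, he]; norm_num
  set T₀ : ((Fin (n - 1) → ℝ) × ℝ) →ₗ[ℝ] Vec n :=
    (H.subtype ∘ₗ M.toLinearEquiv.toLinearMap ∘ₗ LinearMap.fst ℝ _ _) +
      (LinearMap.snd ℝ (Fin (n - 1) → ℝ) ℝ).smulRight e with hT₀
  have hT₀a : ∀ a t, T₀ (a, t) = (M a : Vec n) + t • e := fun a t => rfl
  have hinj : Function.Injective T₀ := by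
    rw [injective_iff_map_eq_zero]
    rintro ⟨a, t⟩ hat
    rw [hT₀a] at hat
    have ht : t = 0 := by
      have := congrArg (fun z => inner ℝ e z) hat
      simpa [inner_add_right, hinner, inner_smul_right, hee, he0] using this
    subst ht
    rw [zero_smul, add_zero] at hat
    have : M a = 0 := Subtype.ext hat
    rw [map_eq_zero_iff M M.injective] at this
    rw [this]; rfl
  set T : ((Fin (n - 1) → ℝ) × ℝ) ≃L[ℝ] Vec n :=
    (LinearMap.linearEquivOfInjective T₀ hinj
      (by simp; omega)).toContinuousLinearEquiv with hT
  have hTa : ∀ a t, T (a, t) = (M a : Vec n) + t • e := hT₀a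
  obtain ⟨c, hc0, hct, hc⟩ := exists_lintegral_comp_linearEquiv
    ((volume : Measure (Fin (n - 1) → ℝ)).prod (volume : Measure ℝ)) T
  set Φ : (Fin (n - 1) → ℝ) → Vec n := fun a => (M a : Vec n) + γ (M a) • e with hΦ
  obtain ⟨K', hΦK⟩ : ∃ K', LipschitzWith K' Φ := by
    have h1 : LipschitzWith _ fun a => (M a : Vec n) :=
      (H.subtypeL.comp M.toContinuousLinearMap).lipschitz
    have h2 : LipschitzWith _ fun a => γ (M a) • e :=
      ((ContinuousLinearMap.id ℝ ℝ).smulRight e).lipschitz.comp (hγ.comp h1)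
    exact ⟨_, h1.add h2⟩
  -- The factor between the normalized Hausdorff measure of the surface measure and Mathlib's
  -- `hausdorffMeasure`.
  set k : ℝ≥0∞ := ((Measure.addHaarScalarFactor
    (volume : Measure (EuclideanSpace ℝ (Fin (n - 1)))) (Measure.hausdorffMeasure (n - 1 : ℕ)) : ℝ≥0) : ℝ≥0∞)
    with hk
  set A : ℝ≥0∞ := k * (K' : ℝ≥0∞) ^ ((n - 1 : ℕ) : ℝ) with hA
  have hAt : A ≠ ⊤ := ENNReal.mul_ne_top ENNReal.coe_ne_top
    (ENNReal.rpow_ne_top_of_nonneg (by positivity) ENNReal.coe_ne_top)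
  set S := frontier Ω ∩ Metric.ball x₀ r with hS
  have hSm : MeasurableSet S := isClosed_frontier.measurableSet.inter measurableSet_ball
  have hSΦ : S ⊆ range Φ := by
    intro x hx
    have h1 := inner_eq_of_mem_frontier hγ.continuous hΩ h hx.1 hx.2
    have hxH : x - (inner ℝ e x : ℝ) • e ∈ H := by
      rw [hH, Submodule.mem_orthogonal_singleton_iff_inner_right, inner_sub_right,
        inner_smul_right, hee]
      ring
    refine ⟨M.symm ⟨_, hxH⟩, ?_⟩
    simp only [hΦ, ContinuousLinearEquiv.apply_symm_apply, h1]
    abel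
  -- A Lipschitz map enlarges Hausdorff measure by a bounded factor, so surface measure is dominated
  -- by the image of Lebesgue measure under `Φ`. An upper bound is enough; no area formula enters.
  have hmeas : (Measure.euclideanHausdorffMeasure (n - 1) : Measure (Vec n)).restrict S ≤
      A • (volume : Measure (Fin (n - 1) → ℝ)).map Φ := by
    refine Measure.le_iff.2 fun Q hQ => ?_
    rw [Measure.restrict_apply hQ, Measure.smul_apply,
      Measure.map_apply hΦK.continuous.measurable hQ, Measure.euclideanHausdorffMeasure_def,
      Measure.smul_apply]
    have h1 : Q ∩ S ⊆ Φ '' (Φ ⁻¹' Q) := by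
      rintro x ⟨hxQ, hxS⟩
      obtain ⟨a, rfl⟩ := hSΦ hxS
      exact ⟨a, hxQ, rfl⟩
    have h2 := hΦK.hausdorffMeasure_image_le (d := ((n - 1 : ℕ) : ℝ)) (by positivity) (Φ ⁻¹' Q)
    have h3 : (Measure.hausdorffMeasure ((n - 1 : ℕ) : ℝ) : Measure (Fin (n - 1) → ℝ)) =
        volume := by
      have := hausdorffMeasure_pi_real (ι := Fin (n - 1))
      rwa [Fintype.card_fin] at this
    rw [h3] at h2
    rw [hA, smul_eq_mul, mul_assoc]
    exact mul_le_mul_right ((measure_mono h1).trans h2) k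
  refine ⟨A * c, ENNReal.mul_ne_top hAt hct, fun u hu hsupp => ?_⟩
  set g : Vec n → ℝ≥0∞ := Ω.indicator fun z => ‖fderiv ℝ u z‖ₑ with hg
  have hgm : Measurable g :=
    (hu.continuous_fderiv one_ne_zero).enorm.measurable.indicator hΩ.measurableSet
  have hray : ∀ a, S.indicator (fun x => ‖u x‖ₑ) (Φ a) ≤ ∫⁻ t : ℝ, g (T (a, t)) := by
    intro a
    by_cases ha : Φ a ∈ S
    swap
    · rw [indicator_of_notMem ha]; exact zero_le
    rw [indicator_of_mem ha]
    refine (enorm_le_lintegral_ray (Ω := Ω) hu hsupp he0 fun hx t ht hxt =>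
      add_smul_mem_of_cone hγ h (by simp [he]) (frontier_subset_closure ha.1) hx ht hxt).trans ?_
    have h1 : ‖e‖ₑ = 1 := by rw [← ofReal_norm, he, ENNReal.ofReal_one]
    rw [h1, one_mul, ← lintegral_add_left_eq_self (fun t => g (T (a, t))) (γ (M a))]
    refine (lintegral_congr fun t => ?_).le
    rw [hTa, hΦ, add_smul, add_assoc]
  calc ∫⁻ x, ‖u x‖ₑ ∂(surfaceMeasure Ω)
      = ∫⁻ x, S.indicator (fun x => ‖u x‖ₑ) x
          ∂((Measure.euclideanHausdorffMeasure (n - 1) : Measure (Vec n)).restrict S) := by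
        rw [lintegral_indicator hSm, Measure.restrict_restrict hSm, inter_self, surfaceMeasure, hS,
          inter_comm, ← Measure.restrict_restrict measurableSet_ball]
        refine (setLIntegral_eq_of_support_subset fun x hx => ?_).symm
        by_contra hxb
        exact hx (by simp [image_eq_zero_of_notMem_tsupport fun h => hxb (hsupp h)])
    _ ≤ ∫⁻ x, S.indicator (fun x => ‖u x‖ₑ) x ∂(A • (volume : Measure (Fin (n - 1) → ℝ)).map Φ) :=
        lintegral_mono' hmeas le_rfl
    _ = A * ∫⁻ a, S.indicator (fun x => ‖u x‖ₑ) (Φ a) := by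
        rw [lintegral_smul_measure, lintegral_map (hu.continuous.enorm.measurable.indicator hSm)
          hΦK.continuous.measurable, smul_eq_mul]
    _ ≤ A * ∫⁻ a, ∫⁻ t : ℝ, g (T (a, t)) := by gcongr; exact hray _
    _ = A * ∫⁻ z, g (T z) ∂((volume : Measure (Fin (n - 1) → ℝ)).prod (volume : Measure ℝ)) := by
        rw [lintegral_prod (fun z => g (T z)) (hgm.comp T.continuous.measurable).aemeasurable]
    _ = A * c * ∫⁻ x in Ω, ‖fderiv ℝ u x‖ₑ := by
        rw [hc, hg, lintegral_indicator hΩ.measurableSet, mul_assoc A c]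

/-- The trace inequality with exponent one on a bounded Lipschitz domain. -/
theorem IsBoundedLipschitzDomain.exists_trace_one (hn : 2 ≤ n)
    (hΩ : IsBoundedLipschitzDomain Ω) :
    ∃ C : ℝ≥0∞, C ≠ ⊤ ∧ ∀ w : Vec n → ℝ, ContDiff ℝ 1 w →
      ∫⁻ x, ‖w x‖ₑ ∂(surfaceMeasure Ω) ≤ C * ∫⁻ x in Ω, (‖w x‖ₑ + ‖fderiv ℝ w x‖ₑ) := by
  have hK : IsCompact (frontier Ω) :=
    hΩ.isBounded.isCompact_closure.of_isClosed_subset isClosed_frontier frontier_subset_closure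
  obtain ⟨C, hC, h⟩ := exists_setLIntegral_le_of_local hK
    (surfaceMeasure Ω) (ι := {w : Vec n → ℝ // ContDiff ℝ 1 w})
    (fun w x => ‖w.1 x‖ₑ) (fun w => ∫⁻ x in Ω, (‖w.1 x‖ₑ + ‖fderiv ℝ w.1 x‖ₑ)) (by
      intro x₀ hx₀
      obtain ⟨e, K, γ, r, he, hγ, hr, hloc⟩ := hΩ.lipschitz x₀ hx₀
      obtain ⟨C, hC, hloc⟩ := exists_trace_one_of_tsupport_subset hn hΩ.isOpen he hγ hloc
      obtain ⟨B, hB, hcut⟩ := exists_cutoff x₀ hr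
      refine ⟨Metric.ball x₀ (r / 3), Metric.ball_mem_nhds _ (by positivity),
        C * B, ENNReal.mul_ne_top hC hB, fun ⟨w, hw⟩ => ?_⟩
      obtain ⟨u, hu, hsupp, heq, hDu⟩ := hcut w hw
      calc ∫⁻ x in Metric.ball x₀ (r / 3), ‖w x‖ₑ ∂surfaceMeasure Ω
          = ∫⁻ x in Metric.ball x₀ (r / 3), ‖u x‖ₑ ∂surfaceMeasure Ω :=
            setLIntegral_congr_fun measurableSet_ball fun x hx => by simp only [heq x hx]
        _ ≤ ∫⁻ x, ‖u x‖ₑ ∂surfaceMeasure Ω := setLIntegral_le_lintegral _ _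
        _ ≤ C * ∫⁻ x in Ω, ‖fderiv ℝ u x‖ₑ := hloc u hu hsupp
        _ ≤ C * (B * ∫⁻ x in Ω, (‖w x‖ₑ + ‖fderiv ℝ w x‖ₑ)) := by
            rw [← lintegral_const_mul' _ _ hB]
            gcongr with x
            exact hDu x
        _ = _ := by rw [mul_assoc])
  refine ⟨C, hC, fun w hw => ?_⟩
  have := h ⟨w, hw⟩
  rwa [surfaceMeasure, Measure.restrict_restrict isClosed_frontier.measurableSet,
    inter_self] at this

end SobolevOne

/-! ### The Sobolev and trace embeddings -/

section Embedding

theorem eLpNorm_ofReal_eq {α ε : Type*} [MeasurableSpace α] [ENorm ε] {μ : Measure α} {p : ℝ}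
    (hp : 0 < p) (f : α → ε) :
    eLpNorm f (ENNReal.ofReal p) μ = (∫⁻ x, ‖f x‖ₑ ^ p ∂μ) ^ (1 / p) := by
  rw [eLpNorm_eq_lintegral_rpow_enorm_toReal (by simpa using hp) ENNReal.ofReal_ne_top,
    ENNReal.toReal_ofReal hp.le]

variable {F : Type*} [NormedAddCommGroup F] {n : ℕ} {Ω : Set (Vec n)}

/-- This a priori finiteness allows a power of the integral to be cancelled in the critical
embedding. -/
theorem IsBoundedLipschitzDomain.lintegral_rpow_ne_top (hΩ : IsBoundedLipschitzDomain Ω)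
    {φ : Vec n → F} (hφ : Continuous φ) {q : ℝ} (hq : 0 ≤ q) :
    ∫⁻ x in Ω, ‖φ x‖ₑ ^ q ≠ ⊤ := by
  obtain ⟨B, hB⟩ := hΩ.isBounded.isCompact_closure.exists_bound_of_continuousOn hφ.continuousOn
  refine ne_top_of_le_ne_top ?_ (setLIntegral_mono (g := fun _ => ENNReal.ofReal B ^ q)
    measurable_const fun x hx => ?_)
  · rw [setLIntegral_const]
    exact ENNReal.mul_ne_top (ENNReal.rpow_ne_top_of_nonneg hq ENNReal.ofReal_ne_top)
      hΩ.isBounded.measure_lt_top.ne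
  · gcongr
    rw [← ofReal_norm]
    exact ENNReal.ofReal_le_ofReal (hB x (subset_closure hx))

variable [InnerProductSpace ℝ F]

theorem lintegral_add_rpow_le_eLpNorm {φ : Vec n → F} (hφ : ContDiff ℝ 1 φ) (μ : Measure (Vec n))
    {d : ℝ} (hd : 1 ≤ d) :
    (∫⁻ x, (‖φ x‖ₑ + ‖fderiv ℝ φ x‖ₑ) ^ d ∂μ) ^ (1 / d) ≤
      eLpNorm φ (ENNReal.ofReal d) μ + eLpNorm (fderiv ℝ φ) (ENNReal.ofReal d) μ := by
  have hd0 : 0 < d := by linarith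
  rw [eLpNorm_ofReal_eq hd0, eLpNorm_ofReal_eq hd0]
  exact ENNReal.lintegral_Lp_add_le hφ.continuous.enorm.measurable.aemeasurable
    (hφ.continuous_fderiv one_ne_zero).enorm.measurable.aemeasurable hd

/-- The derivative of |φ|^g is at most g |φ|^(g-1) |∇φ|, and Hölder separates the two factors. With
this, the inequalities of exponent one applied to |φ|^g yield those of exponent `d`. -/
theorem lintegral_enorm_norm_rpow_le {φ : Vec n → F} (hφ : ContDiff ℝ 1 φ) (μ : Measure (Vec n))
    {d g : ℝ} (hd : 1 < d) (hg : 1 < g) :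
    ∫⁻ x, (‖‖φ x‖ ^ g‖ₑ + ‖fderiv ℝ (fun z => ‖φ z‖ ^ g) x‖ₑ) ∂μ ≤
      ENNReal.ofReal g * ((∫⁻ x, ‖φ x‖ₑ ^ ((g - 1) * (d / (d - 1))) ∂μ) ^ (1 - 1 / d) *
        (∫⁻ x, (‖φ x‖ₑ + ‖fderiv ℝ φ x‖ₑ) ^ d ∂μ) ^ (1 / d)) := by
  have hg0 : 0 < g := by linarith
  have hpt : ∀ x, ‖‖φ x‖ ^ g‖ₑ + ‖fderiv ℝ (fun z => ‖φ z‖ ^ g) x‖ₑ ≤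
      ENNReal.ofReal g * (‖φ x‖ₑ ^ (g - 1) * (‖φ x‖ₑ + ‖fderiv ℝ φ x‖ₑ)) := by
    intro x
    have h1 : ‖‖φ x‖ ^ g‖ₑ = ‖φ x‖ₑ ^ (g - 1) * ‖φ x‖ₑ := by
      rw [Real.enorm_rpow_of_nonneg (norm_nonneg _) hg0.le, enorm_norm]
      conv_rhs => rw [← ENNReal.rpow_one ‖φ x‖ₑ, ← ENNReal.rpow_mul, one_mul,
        ← ENNReal.rpow_add_of_nonneg _ _ (by linarith) zero_le_one, sub_add_cancel]
    have h2 := enorm_fderiv_norm_rpow_le (hφ.differentiable one_ne_zero) (x := x)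
      (p := g.toNNReal) (by simpa using hg)
    rw [Real.coe_toNNReal g hg0.le] at h2
    change _ ≤ ENNReal.ofReal g * _ * _ at h2
    have h4 : 1 ≤ ENNReal.ofReal g := by
      rw [← ENNReal.ofReal_one]; exact ENNReal.ofReal_le_ofReal hg.le
    calc _ ≤ ‖φ x‖ₑ ^ (g - 1) * ‖φ x‖ₑ +
          ENNReal.ofReal g * ‖φ x‖ₑ ^ (g - 1) * ‖fderiv ℝ φ x‖ₑ := add_le_add h1.le h2
      _ ≤ ENNReal.ofReal g * (‖φ x‖ₑ ^ (g - 1) * ‖φ x‖ₑ) +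
          ENNReal.ofReal g * ‖φ x‖ₑ ^ (g - 1) * ‖fderiv ℝ φ x‖ₑ := by
            exact add_le_add_left (le_mul_of_one_le_left' h4) _
      _ = _ := by ring
  refine (lintegral_mono hpt).trans ?_
  rw [lintegral_const_mul' _ _ ENNReal.ofReal_ne_top]
  gcongr
  have hc := (Real.HolderConjugate.conjExponent hd).symm
  have h5 := ENNReal.lintegral_mul_le_Lp_mul_Lq μ hc
    (f := fun x => ‖φ x‖ₑ ^ (g - 1)) (g := fun x => ‖φ x‖ₑ + ‖fderiv ℝ φ x‖ₑ)
    (hφ.continuous.enorm.measurable.pow_const _).aemeasurable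
    (hφ.continuous.enorm.measurable.add
      (hφ.continuous_fderiv one_ne_zero).enorm.measurable).aemeasurable
  refine h5.trans_eq ?_
  have h6 : 1 / Real.conjExponent d = 1 - 1 / d := by
    rw [Real.conjExponent]
    have : d - 1 ≠ 0 := by linarith
    field_simp
  rw [h6]
  simp_rw [← ENNReal.rpow_mul, Real.conjExponent]

/-- The embeddings of `W^{1,d}`, `1 < d < n`, with the critical exponents, for functions that are
smooth up to the boundary. -/
theorem IsBoundedLipschitzDomain.exists_critical_embedding (hn : 2 ≤ n)
    (hΩ : IsBoundedLipschitzDomain Ω) {d : ℝ} (hd : 1 < d) (hdn : d < n) :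
    ∃ C : ℝ≥0∞, C ≠ ⊤ ∧ ∀ φ : Vec n → F, ContDiff ℝ 1 φ →
      eLpNorm φ (ENNReal.ofReal (n * d / (n - d))) (volume.restrict Ω) ≤
        C * (eLpNorm φ (ENNReal.ofReal d) (volume.restrict Ω) +
          eLpNorm (fderiv ℝ φ) (ENNReal.ofReal d) (volume.restrict Ω)) ∧
      eLpNorm φ (ENNReal.ofReal ((n - 1) * d / (n - d))) (surfaceMeasure Ω) ≤
        C * (eLpNorm φ (ENNReal.ofReal d) (volume.restrict Ω) +
          eLpNorm (fderiv ℝ φ) (ENNReal.ofReal d) (volume.restrict Ω)) := by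
  have hn2 : (2 : ℝ) ≤ n := by exact_mod_cast hn
  have hd0 : 0 < d := by linarith
  have hnd : 0 < (n : ℝ) - d := by linarith
  have hn1 : 0 < (n : ℝ) - 1 := by linarith
  have hd1 : 0 < d - 1 := by linarith
  -- The choice of `g` makes g·n/(n-1) and (g-1)·d/(d-1) both equal to `q`: the same integral `X` of
  -- |φ|^q stands on both sides of the Sobolev inequality for |φ|^g, with a smaller power on the
  -- right.
  set q : ℝ := n * d / (n - d) with hq
  set g : ℝ := (n - 1) * d / (n - d) with hg
  set s : ℝ := (n : ℝ) / (n - 1) with hs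
  have hs0 : 0 < s := by positivity
  have hq0 : 0 < q := by positivity
  have hg1 : 1 < g := by
    rw [hg, lt_div_iff₀ hnd]; nlinarith
  have hg0 : 0 < g := by linarith
  have hgs : g * s = q := by rw [hg, hs, hq]; field_simp
  have hgd : (g - 1) * (d / (d - 1)) = q := by rw [hg, hq]; field_simp; ring
  have hexp : 1 - (1 - 1 / d) * s = 1 / g := by rw [hg, hs]; field_simp; ring
  have hexp2 : q * (1 - 1 / d) = g - 1 := by rw [hg, hq]; field_simp; ring
  have hd' : 0 < 1 - 1 / d := by rw [sub_pos, div_lt_one hd0]; exact hd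
  obtain ⟨C₁, hC₁, hsob⟩ := hΩ.exists_sobolev_one hn
  obtain ⟨C₂, hC₂, htr⟩ := hΩ.exists_trace_one hn
  set G := ENNReal.ofReal g with hG
  have hGt : G ≠ ⊤ := ENNReal.ofReal_ne_top
  set D₁ : ℝ≥0∞ := C₁ ^ (1 / s) * G with hD₁
  have hD₁t : D₁ ≠ ⊤ := ENNReal.mul_ne_top (ENNReal.rpow_ne_top_of_nonneg (by positivity) hC₁) hGt
  set D₂ : ℝ≥0∞ := (C₂ * (G * D₁ ^ (g - 1))) ^ (1 / g) with hD₂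
  have hD₂t : D₂ ≠ ⊤ := ENNReal.rpow_ne_top_of_nonneg (by positivity) (ENNReal.mul_ne_top hC₂
    (ENNReal.mul_ne_top hGt (ENNReal.rpow_ne_top_of_nonneg (by linarith) hD₁t)))
  refine ⟨D₁ + D₂, ENNReal.add_ne_top.2 ⟨hD₁t, hD₂t⟩, fun φ hφ => ?_⟩
  have hw : ContDiff ℝ 1 fun z => ‖φ z‖ ^ g := hφ.norm_rpow hg1
  have hwe : ∀ x, ‖‖φ x‖ ^ g‖ₑ = ‖φ x‖ₑ ^ g := fun x => by
    rw [Real.enorm_rpow_of_nonneg (norm_nonneg _) hg0.le, enorm_norm]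
  set X := ∫⁻ x in Ω, ‖φ x‖ₑ ^ q with hX
  set A := (∫⁻ x in Ω, (‖φ x‖ₑ + ‖fderiv ℝ φ x‖ₑ) ^ d) ^ (1 / d) with hA
  have hXt : X ≠ ⊤ := hΩ.lintegral_rpow_ne_top hφ.continuous hq0.le
  have hI := lintegral_enorm_norm_rpow_le hφ (volume.restrict Ω) hd hg1
  rw [hgd, ← hA, ← hX] at hI
  have hAle : A ≤ eLpNorm φ (ENNReal.ofReal d) (volume.restrict Ω) +
      eLpNorm (fderiv ℝ φ) (ENNReal.ofReal d) (volume.restrict Ω) :=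
    lintegral_add_rpow_le_eLpNorm hφ _ hd.le
  have h1 := hsob _ hw
  have h2 : X ≤ C₁ * (G * (X ^ (1 - 1 / d) * A)) ^ s := by
    calc X = ∫⁻ x in Ω, ‖‖φ x‖ ^ g‖ₑ ^ s := by
          simp_rw [hwe, ← ENNReal.rpow_mul, hgs, hX]
      _ ≤ _ := h1.trans (by gcongr)
  have h3 : X ^ (1 / q) ≤ D₁ * A := by
    -- Cancelling a power of `X` requires it to be neither zero nor infinite; by `hexp` the power
    -- 1/g remains on the left.
    rcases eq_or_ne X 0 with h0 | h0
    · rw [h0, ENNReal.zero_rpow_of_pos (by positivity)]; exact zero_le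
    have h4 : X ^ (1 / g) ≤ C₁ * (G * A) ^ s := by
      have h5 : X ^ (1 / g) * X ^ ((1 - 1 / d) * s) ≤
          C₁ * (G * A) ^ s * X ^ ((1 - 1 / d) * s) := by
        rw [← ENNReal.rpow_add _ _ h0 hXt, ← hexp, sub_add_cancel, ENNReal.rpow_one]
        refine h2.trans_eq ?_
        rw [ENNReal.rpow_mul, mul_assoc, ← ENNReal.mul_rpow_of_nonneg _ _ hs0.le]
        congr 2
        ring
      refine (ENNReal.mul_le_mul_iff_left ?_ ?_).1 h5
      · exact (ENNReal.rpow_pos (pos_iff_ne_zero.2 h0) hXt).ne'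
      · exact ENNReal.rpow_ne_top_of_nonneg (by positivity) hXt
    calc X ^ (1 / q) = (X ^ (1 / g)) ^ (1 / s) := by
          rw [← ENNReal.rpow_mul, ← hgs]; congr 1; field_simp
      _ ≤ (C₁ * (G * A) ^ s) ^ (1 / s) := by gcongr
      _ = _ := by
          rw [ENNReal.mul_rpow_of_nonneg _ _ (by positivity), ← ENNReal.rpow_mul,
            mul_one_div_cancel hs0.ne', ENNReal.rpow_one, hD₁, mul_assoc]
  have h6 : (∫⁻ x, ‖φ x‖ₑ ^ g ∂surfaceMeasure Ω) ^ (1 / g) ≤ D₂ * A := by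
    -- For the trace the Hölder factor is already bounded by the volume embedding, so nothing has to
    -- be absorbed.
    have h7 : X ^ (1 - 1 / d) ≤ (D₁ * A) ^ (g - 1) := by
      calc X ^ (1 - 1 / d) = (X ^ (1 / q)) ^ (g - 1) := by
            rw [← ENNReal.rpow_mul, ← hexp2]; congr 1; field_simp
        _ ≤ _ := by gcongr
    have h8 : ∫⁻ x, ‖φ x‖ₑ ^ g ∂surfaceMeasure Ω ≤ C₂ * (G * D₁ ^ (g - 1)) * A ^ g := by
      calc ∫⁻ x, ‖φ x‖ₑ ^ g ∂surfaceMeasure Ω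
          = ∫⁻ x, ‖‖φ x‖ ^ g‖ₑ ∂surfaceMeasure Ω := by simp_rw [hwe]
        _ ≤ C₂ * (G * ((D₁ * A) ^ (g - 1) * A)) := (htr _ hw).trans (by
            gcongr
            exact hI.trans (by gcongr))
        _ = C₂ * (G * D₁ ^ (g - 1)) * (A ^ (g - 1) * A ^ (1 : ℝ)) := by
            rw [ENNReal.mul_rpow_of_nonneg _ _ (by linarith), ENNReal.rpow_one]; ring
        _ = _ := by
            rw [← ENNReal.rpow_add_of_nonneg _ _ (by linarith) zero_le_one, sub_add_cancel]
    calc _ ≤ (C₂ * (G * D₁ ^ (g - 1)) * A ^ g) ^ (1 / g) := by gcongr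
      _ = _ := by
          rw [ENNReal.mul_rpow_of_nonneg _ _ (by positivity), ← ENNReal.rpow_mul,
            mul_one_div_cancel hg0.ne', ENNReal.rpow_one]
  rw [eLpNorm_ofReal_eq hq0, eLpNorm_ofReal_eq hg0]
  exact ⟨h3.trans (by gcongr; exact le_self_add), h6.trans (by gcongr; exact le_add_self)⟩

theorem IsBoundedLipschitzDomain.isFiniteMeasure_restrict (hΩ : IsBoundedLipschitzDomain Ω) :
    IsFiniteMeasure (volume.restrict Ω) :=
  MeasureTheory.isFiniteMeasure_restrict.2 hΩ.isBounded.measure_lt_top.ne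

/-- This is the trace inequality for the constant function 1. -/
theorem IsBoundedLipschitzDomain.isFiniteMeasure_surfaceMeasure (hn : 2 ≤ n)
    (hΩ : IsBoundedLipschitzDomain Ω) : IsFiniteMeasure (surfaceMeasure Ω) := by
  obtain ⟨C, hC, h⟩ := hΩ.exists_trace_one hn
  have h1 := h (fun _ => 1) contDiff_const
  have hD : ∀ x : Vec n, ‖fderiv ℝ (fun _ : Vec n => (1 : ℝ)) x‖ₑ = 0 := fun x => by
    rw [← ofReal_norm, fderiv_fun_const, Pi.zero_apply, norm_zero, ENNReal.ofReal_zero]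
  have := hΩ.isFiniteMeasure_restrict
  simp only [enorm_one, lintegral_one, hD, add_zero] at h1
  exact ⟨h1.trans_lt (ENNReal.mul_lt_top hC.lt_top (measure_lt_top _ _))⟩

/-- For d < n take d' = d. For d ≥ n lower the exponent to some d' slightly less than `n`: both
critical exponents tend to infinity as d' tends to `n`, hence exceed any given finite exponents. -/
theorem exists_subcritical_exponent (hn : 2 ≤ n) {d : ℝ} (hd : (n : ℝ) - 1 < d) {q r : ℝ≥0∞}
    (hq : q ≠ ⊤) (hr : r ≠ ⊤) (hqd : d < n → q ≤ ENNReal.ofReal (n * d / (n - d)))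
    (hrd : d < n → r ≤ ENNReal.ofReal ((n - 1) * d / (n - d))) :
    ∃ d' : ℝ, 1 < d' ∧ d' < n ∧ d' ≤ d ∧ q ≤ ENNReal.ofReal (n * d' / (n - d')) ∧
      r ≤ ENNReal.ofReal ((n - 1) * d' / (n - d')) := by
  have hn2 : (2 : ℝ) ≤ n := by exact_mod_cast hn
  rcases lt_or_ge d n with h | h
  · exact ⟨d, by linarith, h, le_rfl, hqd h, hrd h⟩
  set R : ℝ := 1 + q.toReal + r.toReal with hR
  have hq0 : 0 ≤ q.toReal := ENNReal.toReal_nonneg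
  have hr0 : 0 ≤ r.toReal := ENNReal.toReal_nonneg
  have hRpos : 0 < R := by positivity
  have hR1 : (1 : ℝ) / (2 * R) ≤ 1 / 2 := by
    rw [div_le_div_iff₀ (by positivity) (by norm_num)]; linarith
  have hR2 : 0 < (1 : ℝ) / (2 * R) := by positivity
  have hR3 : R * (1 / (2 * R)) = 1 / 2 := by field_simp
  have key : R ≤ ((n : ℝ) - 1) * (n - 1 / (2 * R)) / (n - (n - 1 / (2 * R))) := by
    rw [sub_sub_cancel, le_div_iff₀ hR2, hR3]
    nlinarith
  refine ⟨n - 1 / (2 * R), by linarith, by linarith, by linarith, ?_, ?_⟩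
  · rw [← ENNReal.ofReal_toReal hq]
    refine ENNReal.ofReal_le_ofReal ((by linarith : q.toReal ≤ R).trans (key.trans ?_))
    rw [sub_sub_cancel]
    gcongr
    · linarith
    · linarith
  · rw [← ENNReal.ofReal_toReal hr]
    exact ENNReal.ofReal_le_ofReal ((by linarith : r.toReal ≤ R).trans key)

theorem exists_eLpNorm_le_mul_eLpNorm {α : Type*} [MeasurableSpace α] (μ : Measure α)
    [IsFiniteMeasure μ] {p q : ℝ≥0∞} (hpq : p ≤ q) :
    ∃ C : ℝ≥0∞, C ≠ ⊤ ∧ ∀ {E : Type*} [NormedAddCommGroup E] (f : α → E),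
      AEStronglyMeasurable f μ → eLpNorm f p μ ≤ C * eLpNorm f q μ := by
  rcases eq_or_ne p 0 with rfl | hp
  · exact ⟨0, by simp, fun f _ => by simp⟩
  refine ⟨μ univ ^ (1 / p.toReal - 1 / q.toReal), ?_, fun f hf => ?_⟩
  · refine ENNReal.rpow_ne_top_of_nonneg ?_ (measure_ne_top _ _)
    rw [sub_nonneg]
    rcases eq_or_ne q ⊤ with rfl | hq
    · simp
    · exact one_div_le_one_div_of_le (ENNReal.toReal_pos hp (ne_top_of_le_ne_top hq hpq))
        (ENNReal.toReal_mono hq hpq)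
  · rw [mul_comm]; exact eLpNorm_le_eLpNorm_mul_rpow_measure_univ hpq hf

/-- The Sobolev and trace embeddings for functions that are smooth up to the boundary. -/
theorem IsBoundedLipschitzDomain.exists_embedding (hn : 2 ≤ n)
    (hΩ : IsBoundedLipschitzDomain Ω) {d : ℝ} (hd : (n : ℝ) - 1 < d) {q r : ℝ≥0∞}
    (hq : q ≠ ⊤) (hr : r ≠ ⊤) (hqd : d < n → q ≤ ENNReal.ofReal (n * d / (n - d)))
    (hrd : d < n → r ≤ ENNReal.ofReal ((n - 1) * d / (n - d))) :
    ∃ C : ℝ≥0∞, C ≠ ⊤ ∧ ∀ φ : Vec n → F, ContDiff ℝ 1 φ →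
      eLpNorm φ q (volume.restrict Ω) ≤
        C * (eLpNorm φ (ENNReal.ofReal d) (volume.restrict Ω) +
          eLpNorm (fderiv ℝ φ) (ENNReal.ofReal d) (volume.restrict Ω)) ∧
      eLpNorm φ r (surfaceMeasure Ω) ≤
        C * (eLpNorm φ (ENNReal.ofReal d) (volume.restrict Ω) +
          eLpNorm (fderiv ℝ φ) (ENNReal.ofReal d) (volume.restrict Ω)) := by
  have := hΩ.isFiniteMeasure_restrict
  have := hΩ.isFiniteMeasure_surfaceMeasure hn
  obtain ⟨d', hd1, hdn, hdd, hq', hr'⟩ := exists_subcritical_exponent hn hd hq hr hqd hrd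
  obtain ⟨C, hC, hemb⟩ := hΩ.exists_critical_embedding (F := F) hn hd1 hdn
  obtain ⟨C₁, hC₁, h₁⟩ := exists_eLpNorm_le_mul_eLpNorm (volume.restrict Ω) hq'
  obtain ⟨C₂, hC₂, h₂⟩ := exists_eLpNorm_le_mul_eLpNorm (surfaceMeasure Ω) hr'
  obtain ⟨C₃, hC₃, h₃⟩ := exists_eLpNorm_le_mul_eLpNorm (volume.restrict Ω)
    (ENNReal.ofReal_le_ofReal hdd)
  refine ⟨(C₁ + C₂) * (C * C₃), ENNReal.mul_ne_top (ENNReal.add_ne_top.2 ⟨hC₁, hC₂⟩)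
    (ENNReal.mul_ne_top hC hC₃), fun φ hφ => ?_⟩
  have hφm : ∀ μ : Measure (Vec n), AEStronglyMeasurable φ μ :=
    fun μ => hφ.continuous.aestronglyMeasurable
  have hDm : AEStronglyMeasurable (fderiv ℝ φ) (volume.restrict Ω) :=
    (hφ.continuous_fderiv one_ne_zero).aestronglyMeasurable
  obtain ⟨hA, hB⟩ := hemb φ hφ
  have hS : C * (eLpNorm φ (ENNReal.ofReal d') (volume.restrict Ω) +
      eLpNorm (fderiv ℝ φ) (ENNReal.ofReal d') (volume.restrict Ω)) ≤
      C * C₃ * (eLpNorm φ (ENNReal.ofReal d) (volume.restrict Ω) +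
      eLpNorm (fderiv ℝ φ) (ENNReal.ofReal d) (volume.restrict Ω)) := by
    rw [mul_assoc, mul_add C₃]
    gcongr
    · exact h₃ φ (hφm _)
    · exact h₃ _ hDm
  constructor
  · refine (h₁ φ (hφm _)).trans ?_
    rw [mul_assoc]
    exact mul_le_mul' le_self_add (hA.trans hS)
  · refine (h₂ φ (hφm _)).trans ?_
    rw [mul_assoc]
    exact mul_le_mul' le_add_self (hB.trans hS)

end Embedding

/-! ### Inequalities for Sobolev functions with a trace -/

section Trace

variable {n : ℕ} {Ω : Set (Vec n)} {ι : Type} [Fintype ι]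

/-- Traces are defined through the Euclidean norm of the array of partial derivatives, whereas the
embeddings use the operator norm of the derivative. The factor `n` is crude, but only a constant
matters. -/
theorem norm_fderiv_le_classicalGrad (φ : Vec n → EuclideanSpace ℝ ι) (x : Vec n) :
    ‖fderiv ℝ φ x‖ ≤ n * ‖classicalGrad φ x‖ := by
  refine ContinuousLinearMap.opNorm_le_bound _ (by positivity) fun h => ?_
  have h1 : ∀ j : Fin n, ‖fderiv ℝ φ x (EuclideanSpace.single j 1)‖ ≤ ‖classicalGrad φ x‖ := by
    intro j
    rw [EuclideanSpace.norm_eq, EuclideanSpace.norm_eq]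
    refine Real.sqrt_le_sqrt ?_
    rw [Fintype.sum_prod_type]
    refine Finset.sum_le_sum fun i _ => ?_
    exact Finset.single_le_sum (f := fun j => ‖classicalGrad φ x (i, j)‖ ^ 2)
      (fun _ _ => by positivity) (Finset.mem_univ j)
  have h2 : h = ∑ j, h j • EuclideanSpace.single j (1 : ℝ) := by
    conv_lhs => rw [← (EuclideanSpace.basisFun (Fin n) ℝ).sum_repr h]
    simp
  calc ‖fderiv ℝ φ x h‖ = ‖∑ j, h j • fderiv ℝ φ x (EuclideanSpace.single j 1)‖ := by
        conv_lhs => rw [h2]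
        simp only [map_sum, map_smul]
    _ ≤ ∑ j, ‖h j • fderiv ℝ φ x (EuclideanSpace.single j 1)‖ := norm_sum_le _ _
    _ ≤ ∑ _j : Fin n, ‖h‖ * ‖classicalGrad φ x‖ := by
        refine Finset.sum_le_sum fun j _ => ?_
        rw [norm_smul]
        gcongr
        · exact PiLp.norm_apply_le h j
        · exact h1 j
    _ = n * ‖classicalGrad φ x‖ * ‖h‖ := by
        rw [Finset.sum_const, Finset.card_univ, Fintype.card_fin, nsmul_eq_mul]; ring

theorem eLpNorm_fderiv_le_classicalGrad (φ : Vec n → EuclideanSpace ℝ ι) (p : ℝ≥0∞)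
    (μ : Measure (Vec n)) :
    eLpNorm (fderiv ℝ φ) p μ ≤ n * eLpNorm (classicalGrad φ) p μ := by
  have := eLpNorm_le_mul_eLpNorm_of_ae_le_mul
    (.of_forall fun x => norm_fderiv_le_classicalGrad φ x) (p := p) (μ := μ)
  rwa [ENNReal.ofReal_natCast] at this

theorem continuous_classicalGrad {φ : Vec n → EuclideanSpace ℝ ι} (hφ : ContDiff ℝ 1 φ) :
    Continuous (classicalGrad φ) := by
  have := hφ.continuous_fderiv one_ne_zero
  unfold classicalGrad
  fun_prop

/-- Pass to an almost everywhere convergent subsequence and apply Fatou. The exponent `q` of the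
bound need not be the exponent `p` of the convergence, so higher integrability is inherited by the
limit. -/
theorem eLpNorm_le_of_tendsto {α E : Type*} [MeasurableSpace α] {μ : Measure α}
    [NormedAddCommGroup E] {p q : ℝ≥0∞} (hp : p ≠ 0) {f : ℕ → α → E} {g : α → E}
    (hf : ∀ k, AEStronglyMeasurable (f k) μ) (hg : AEStronglyMeasurable g μ)
    (hfg : Tendsto (fun k => eLpNorm (f k - g) p μ) atTop (𝓝 0)) {B : ℕ → ℝ≥0∞} {b : ℝ≥0∞}
    (hB : ∀ k, eLpNorm (f k) q μ ≤ B k) (hb : Tendsto B atTop (𝓝 b)) :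
    eLpNorm g q μ ≤ b := by
  obtain ⟨ns, hns, hae⟩ :=
    (tendstoInMeasure_of_tendsto_eLpNorm hp hf hg hfg).exists_seq_tendsto_ae
  refine (Lp.eLpNorm_lim_le_liminf_eLpNorm (fun k => hf (ns k)) g hae).trans ?_
  rw [← (hb.comp hns.tendsto_atTop).liminf_eq]
  exact liminf_le_liminf (.of_forall fun k => hB (ns k))

/-- The trace is the limit of the boundary values of functions `φ k` that satisfy the bounds. -/
theorem IsTrace.exists_approx {d : ℝ} (hd : 1 ≤ d) {u : SobolevFun Ω d ι}
    {v : Vec n → EuclideanSpace ℝ ι} (h : IsTrace u v) :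
    ∃ (φ : ℕ → Vec n → EuclideanSpace ℝ ι) (ε : ℕ → ℝ≥0∞), (∀ k, ContDiff ℝ 1 (φ k)) ∧
      Tendsto ε atTop (𝓝 0) ∧
      Tendsto (fun k => eLpNorm (φ k - u.toFun) (ENNReal.ofReal d) (volume.restrict Ω))
        atTop (𝓝 0) ∧
      Tendsto (fun k => eLpNorm (φ k - v) (ENNReal.ofReal d) (surfaceMeasure Ω)) atTop (𝓝 0) ∧
      (∀ k, eLpNorm (φ k) (ENNReal.ofReal d) (volume.restrict Ω) ≤
        eLpNorm u.toFun (ENNReal.ofReal d) (volume.restrict Ω) + ε k) ∧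
      (∀ k, eLpNorm (fderiv ℝ (φ k)) (ENNReal.ofReal d) (volume.restrict Ω) ≤
        n * eLpNorm u.grad (ENNReal.ofReal d) (volume.restrict Ω) + ε k) ∧
      ∀ k, ∀ Γ : Set (Vec n), eLpNorm (φ k) (ENNReal.ofReal d) ((surfaceMeasure Ω).restrict Γ) ≤
        eLpNorm v (ENNReal.ofReal d) ((surfaceMeasure Ω).restrict Γ) + ε k := by
  obtain ⟨hv, φ, hφ, h1, h2, h3⟩ := h
  have hp : 1 ≤ ENNReal.ofReal d := by
    rw [← ENNReal.ofReal_one]; exact ENNReal.ofReal_le_ofReal hd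
  have hφ1 : ∀ k, ContDiff ℝ 1 (φ k) := fun k => (hφ k).of_le (by exact_mod_cast le_top)
  have tri : ∀ {E : Type} [NormedAddCommGroup E] {μ : Measure (Vec n)} {a b : Vec n → E},
      AEStronglyMeasurable a μ → AEStronglyMeasurable b μ →
      eLpNorm a (ENNReal.ofReal d) μ ≤ eLpNorm b (ENNReal.ofReal d) μ +
        eLpNorm (a - b) (ENNReal.ofReal d) μ := by
    intro E _ μ a b ha hb
    have := eLpNorm_add_le hb (ha.sub hb) hp
    rwa [add_sub_cancel] at this
  -- The three approximation errors are added, so that a single null sequence serves all the bounds.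
  refine ⟨φ, fun k => eLpNorm (φ k - u.toFun) (ENNReal.ofReal d) (volume.restrict Ω) +
    n * eLpNorm (classicalGrad (φ k) - u.grad) (ENNReal.ofReal d) (volume.restrict Ω) +
    eLpNorm (φ k - v) (ENNReal.ofReal d) (surfaceMeasure Ω), hφ1, ?_, h1, h3, ?_, ?_, ?_⟩
  · have := (h1.add (ENNReal.Tendsto.const_mul h2 (Or.inr (ENNReal.natCast_ne_top n)))).add h3
    simpa using this
  · intro k
    refine (tri (hφ1 k).continuous.aestronglyMeasurable u.memLp_toFun.1).trans ?_
    gcongr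
    exact le_self_add.trans le_self_add
  · intro k
    refine (eLpNorm_fderiv_le_classicalGrad _ _ _).trans ?_
    calc _ ≤ n * (eLpNorm u.grad (ENNReal.ofReal d) (volume.restrict Ω) +
          eLpNorm (classicalGrad (φ k) - u.grad) (ENNReal.ofReal d) (volume.restrict Ω)) := by
          gcongr
          exact tri (continuous_classicalGrad (hφ1 k)).aestronglyMeasurable u.memLp_grad.1
      _ ≤ _ := by
          rw [mul_add]
          gcongr
          exact le_add_self.trans le_self_add
  · intro k Γ
    refine (tri (hφ1 k).continuous.aestronglyMeasurable hv.restrict).trans ?_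
    gcongr
    exact (eLpNorm_mono_measure _ Measure.restrict_le_self).trans le_add_self

/-- The Sobolev and trace embeddings of `W^{1,d}` on a bounded Lipschitz domain. -/
theorem IsBoundedLipschitzDomain.exists_sobolevFun_embedding (hn : 2 ≤ n)
    (hΩ : IsBoundedLipschitzDomain Ω) {d : ℝ} (hd : (n : ℝ) - 1 < d) {q r : ℝ≥0∞}
    (hq : q ≠ ⊤) (hr : r ≠ ⊤) (hqd : d < n → q ≤ ENNReal.ofReal (n * d / (n - d)))
    (hrd : d < n → r ≤ ENNReal.ofReal ((n - 1) * d / (n - d))) :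
    ∃ C : ℝ≥0∞, C ≠ ⊤ ∧ ∀ (u : SobolevFun Ω d ι) (v : Vec n → EuclideanSpace ℝ ι), IsTrace u v →
      eLpNorm u.toFun q (volume.restrict Ω) ≤ C * u.sobolevNorm ∧
      eLpNorm v r (surfaceMeasure Ω) ≤ C * u.sobolevNorm := by
  have hn2 : (2 : ℝ) ≤ n := by exact_mod_cast hn
  have hd1 : 1 ≤ d := by linarith
  have hd0 : ENNReal.ofReal d ≠ 0 := by simp; linarith
  obtain ⟨C, hC, hemb⟩ := hΩ.exists_embedding (F := EuclideanSpace ℝ ι) hn hd hq hr hqd hrd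
  refine ⟨C * n, ENNReal.mul_ne_top hC (ENNReal.natCast_ne_top n), fun u v huv => ?_⟩
  -- The approximating functions come with the trace, so no density theorem for smooth functions is
  -- needed.
  obtain ⟨φ, ε, hφ, hε, hu, hv, hb, hDb, -⟩ := huv.exists_approx hd1
  set B : ℕ → ℝ≥0∞ := fun k =>
    C * ((eLpNorm u.toFun (ENNReal.ofReal d) (volume.restrict Ω) + ε k) +
      (n * eLpNorm u.grad (ENNReal.ofReal d) (volume.restrict Ω) + ε k)) with hBdef
  have hB : Tendsto B atTop (𝓝 (C * (eLpNorm u.toFun (ENNReal.ofReal d) (volume.restrict Ω) +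
      n * eLpNorm u.grad (ENNReal.ofReal d) (volume.restrict Ω)))) := by
    have := ENNReal.Tendsto.const_mul
      ((tendsto_const_nhds (x := eLpNorm u.toFun (ENNReal.ofReal d) (volume.restrict Ω))).add hε
        |>.add ((tendsto_const_nhds
          (x := n * eLpNorm u.grad (ENNReal.ofReal d) (volume.restrict Ω))).add hε))
      (Or.inr hC) (a := C)
    simpa using this
  have hfin : C * (eLpNorm u.toFun (ENNReal.ofReal d) (volume.restrict Ω) +
      n * eLpNorm u.grad (ENNReal.ofReal d) (volume.restrict Ω)) ≤ C * n * u.sobolevNorm := by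
    have h1 : (1 : ℝ≥0∞) ≤ n := by exact_mod_cast (by omega : 1 ≤ n)
    rw [SobolevFun.sobolevNorm, mul_assoc, mul_add (n : ℝ≥0∞)]
    gcongr
    exact le_mul_of_one_le_left' h1
  have hφB : ∀ k, C * (eLpNorm (φ k) (ENNReal.ofReal d) (volume.restrict Ω) +
      eLpNorm (fderiv ℝ (φ k)) (ENNReal.ofReal d) (volume.restrict Ω)) ≤ B k := fun k =>
    mul_le_mul_right (add_le_add (hb k) (hDb k)) C
  have hm : ∀ (μ : Measure (Vec n)) k, AEStronglyMeasurable (φ k) μ :=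
    fun μ k => (hφ k).continuous.aestronglyMeasurable
  exact ⟨(eLpNorm_le_of_tendsto hd0 (hm _) u.memLp_toFun.1 hu
      (fun k => (hemb _ (hφ k)).1.trans (hφB k)) hB).trans hfin,
    (eLpNorm_le_of_tendsto hd0 (hm _) huv.1 hv
      (fun k => (hemb _ (hφ k)).2.trans (hφB k)) hB).trans hfin⟩

/-- The Friedrichs inequality for functions that are smooth up to the boundary. -/
theorem IsBoundedLipschitzDomain.exists_friedrichs_contDiff (hn : 2 ≤ n)
    (hΩ : IsBoundedLipschitzDomain Ω) {d : ℝ} (hd : (n : ℝ) - 1 < d) {Γ : Set (Vec n)}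
    (hΓ : surfaceMeasure Ω Γ ≠ 0) :
    ∃ C : ℝ≥0∞, C ≠ ⊤ ∧ ∀ φ : Vec n → EuclideanSpace ℝ ι, ContDiff ℝ 1 φ →
      eLpNorm φ (ENNReal.ofReal d) (volume.restrict Ω) ≤
        C * (eLpNorm (fderiv ℝ φ) (ENNReal.ofReal d) (volume.restrict Ω) +
          eLpNorm φ (ENNReal.ofReal d) ((surfaceMeasure Ω).restrict Γ)) := by
  have hn2 : (2 : ℝ) ≤ n := by exact_mod_cast hn
  have hd1 : 1 ≤ d := by linarith
  have hd0 : 0 < d := by linarith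
  have hp0 : ENNReal.ofReal d ≠ 0 := by simpa using hd0
  have hp1 : 1 ≤ ENNReal.ofReal d := by
    rw [← ENNReal.ofReal_one]; exact ENNReal.ofReal_le_ofReal hd1
  have hfΩ := hΩ.isFiniteMeasure_restrict
  have hfσ := hΩ.isFiniteMeasure_surfaceMeasure hn
  obtain ⟨C₁, hC₁, hpoin⟩ := hΩ.exists_poincare (F := EuclideanSpace ℝ ι) hd1
  obtain ⟨C₂, hC₂, hemb⟩ := hΩ.exists_embedding (F := EuclideanSpace ℝ ι) hn hd
    (q := ENNReal.ofReal d) (r := ENNReal.ofReal d) ENNReal.ofReal_ne_top ENNReal.ofReal_ne_top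
    (fun h => ENNReal.ofReal_le_ofReal (by
      rw [le_div_iff₀ (by linarith)]; nlinarith))
    (fun h => ENNReal.ofReal_le_ofReal (by
      rw [le_div_iff₀ (by linarith)]; nlinarith))
  set D := C₁ ^ (1 / d) with hD
  have hDt : D ≠ ⊤ := ENNReal.rpow_ne_top_of_nonneg (by positivity) hC₁
  set a : ℝ≥0∞ := volume Ω ^ (1 / d) with ha
  have hat : a ≠ ⊤ := ENNReal.rpow_ne_top_of_nonneg (by positivity) hΩ.isBounded.measure_lt_top.ne
  set b : ℝ≥0∞ := surfaceMeasure Ω Γ ^ (1 / d) with hb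
  have hbt : b ≠ ⊤ := ENNReal.rpow_ne_top_of_nonneg (by positivity) (measure_ne_top _ _)
  have hb0 : b ≠ 0 := (ENNReal.rpow_pos (pos_iff_ne_zero.2 hΓ) (measure_ne_top _ _)).ne'
  refine ⟨D + a * b⁻¹ * (1 + C₂ * (D + 1)), ENNReal.add_ne_top.2 ⟨hDt, ENNReal.mul_ne_top
    (ENNReal.mul_ne_top hat (ENNReal.inv_ne_top.2 hb0)) (ENNReal.add_ne_top.2
      ⟨ENNReal.one_ne_top, ENNReal.mul_ne_top hC₂ (ENNReal.add_ne_top.2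
        ⟨hDt, ENNReal.one_ne_top⟩)⟩)⟩, fun φ hφ => ?_⟩
  obtain ⟨c, hc⟩ := hpoin φ hφ
  set I := eLpNorm (fderiv ℝ φ) (ENNReal.ofReal d) (volume.restrict Ω) with hI
  set J := eLpNorm φ (ENNReal.ofReal d) ((surfaceMeasure Ω).restrict Γ) with hJ
  have hφc : ContDiff ℝ 1 fun x => φ x - c := hφ.sub contDiff_const
  have hDφc : fderiv ℝ (fun x => φ x - c) = fderiv ℝ φ := by
    ext1 x; exact fderiv_sub_const c
  have h1 : eLpNorm (fun x => φ x - c) (ENNReal.ofReal d) (volume.restrict Ω) ≤ D * I := by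
    rw [hI, eLpNorm_ofReal_eq hd0, eLpNorm_ofReal_eq hd0, hD,
      ← ENNReal.mul_rpow_of_nonneg _ _ (by positivity)]
    gcongr
  have h2 : eLpNorm (fun x => φ x - c) (ENNReal.ofReal d) ((surfaceMeasure Ω).restrict Γ) ≤
      C₂ * (D * I + I) := by
    refine (eLpNorm_mono_measure _ Measure.restrict_le_self).trans
      ((hemb _ hφc).2.trans ?_)
    rw [hDφc]
    gcongr
  have hm : ∀ μ : Measure (Vec n), AEStronglyMeasurable φ μ :=
    fun μ => hφ.continuous.aestronglyMeasurable
  have hmc : ∀ μ : Measure (Vec n), AEStronglyMeasurable (fun x => φ x - c) μ :=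
    fun μ => hφc.continuous.aestronglyMeasurable
  -- The Poincaré constant `c` is read off on Γ, where it differs from `φ` by the trace of φ - c. As
  -- Γ has positive surface measure, `b` can be divided out.
  have h3 : ‖c‖ₑ * b ≤ J + C₂ * (D * I + I) := by
    have h4 : eLpNorm (fun _ : Vec n => c) (ENNReal.ofReal d) ((surfaceMeasure Ω).restrict Γ) =
        ‖c‖ₑ * b := by
      rw [eLpNorm_const' _ hp0 ENNReal.ofReal_ne_top, ENNReal.toReal_ofReal hd0.le,
        Measure.restrict_apply_univ]
    rw [← h4]
    refine le_trans ?_ (add_le_add_right h2 J)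
    have := eLpNorm_sub_le (hm ((surfaceMeasure Ω).restrict Γ)) (hmc _) hp1
    simpa [Pi.sub_def] using this
  have h5 : ‖c‖ₑ ≤ b⁻¹ * (J + C₂ * (D * I + I)) := by
    rwa [← ENNReal.div_eq_inv_mul, ENNReal.le_div_iff_mul_le (Or.inl hb0) (Or.inl hbt)]
  have h6 : eLpNorm (fun _ : Vec n => c) (ENNReal.ofReal d) (volume.restrict Ω) = ‖c‖ₑ * a := by
    rw [eLpNorm_const' _ hp0 ENNReal.ofReal_ne_top, ENNReal.toReal_ofReal hd0.le,
      Measure.restrict_apply_univ]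
  calc eLpNorm φ (ENNReal.ofReal d) (volume.restrict Ω)
      ≤ eLpNorm (fun x => φ x - c) (ENNReal.ofReal d) (volume.restrict Ω) +
        eLpNorm (fun _ : Vec n => c) (ENNReal.ofReal d) (volume.restrict Ω) := by
        have := eLpNorm_add_le (hmc (volume.restrict Ω))
          (aestronglyMeasurable_const (b := c)) hp1
        simpa [Pi.add_def] using this
    _ ≤ D * I + b⁻¹ * (J + C₂ * (D * I + I)) * a := by rw [h6]; gcongr
    _ = D * I + a * b⁻¹ * (1 * J + C₂ * (D + 1) * I) := by ring
    _ ≤ D * (I + J) + a * b⁻¹ * (1 * (I + J) + C₂ * (D + 1) * (I + J)) := by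
        gcongr
        · exact le_self_add
        · exact le_add_self
        · exact le_self_add
    _ = _ := by ring

/-- The Friedrichs inequality: the norm of `W^{1,d}` is controlled by the gradient and by the trace
on a part of the boundary. -/
theorem IsBoundedLipschitzDomain.exists_friedrichs (hn : 2 ≤ n)
    (hΩ : IsBoundedLipschitzDomain Ω) {d : ℝ} (hd : (n : ℝ) - 1 < d) {Γ : Set (Vec n)}
    (hΓ : surfaceMeasure Ω Γ ≠ 0) :
    ∃ C : ℝ≥0∞, C ≠ ⊤ ∧ ∀ (u : SobolevFun Ω d ι) (v : Vec n → EuclideanSpace ℝ ι), IsTrace u v →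
      u.sobolevNorm ≤ C * (eLpNorm u.grad (ENNReal.ofReal d) (volume.restrict Ω) +
        eLpNorm v (ENNReal.ofReal d) ((surfaceMeasure Ω).restrict Γ)) := by
  have hn2 : (2 : ℝ) ≤ n := by exact_mod_cast hn
  have hd1 : 1 ≤ d := by linarith
  have hd0 : ENNReal.ofReal d ≠ 0 := by simp; linarith
  obtain ⟨C, hC, hfr⟩ := hΩ.exists_friedrichs_contDiff (ι := ι) hn hd hΓ
  refine ⟨C * n + 1, ENNReal.add_ne_top.2 ⟨ENNReal.mul_ne_top hC (ENNReal.natCast_ne_top n),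
    ENNReal.one_ne_top⟩, fun u v huv => ?_⟩
  obtain ⟨φ, ε, hφ, hε, hu, -, -, hDb, hvb⟩ := huv.exists_approx hd1
  set I := eLpNorm u.grad (ENNReal.ofReal d) (volume.restrict Ω) with hI
  set J := eLpNorm v (ENNReal.ofReal d) ((surfaceMeasure Ω).restrict Γ) with hJ
  have hB : Tendsto (fun k => C * ((n * I + ε k) + (J + ε k))) atTop (𝓝 (C * (n * I + J))) := by
    have := ENNReal.Tendsto.const_mul ((tendsto_const_nhds (x := n * I)).add hε
        |>.add ((tendsto_const_nhds (x := J)).add hε)) (Or.inr hC) (a := C)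
    simpa using this
  have h1 := eLpNorm_le_of_tendsto hd0 (fun k => (hφ k).continuous.aestronglyMeasurable)
    u.memLp_toFun.1 hu
    (fun k => (hfr _ (hφ k)).trans (mul_le_mul_right (add_le_add (hDb k) (hvb k Γ)) C)) hB
  have hn1 : (1 : ℝ≥0∞) ≤ n := by exact_mod_cast (by omega : 1 ≤ n)
  calc u.sobolevNorm ≤ C * (n * I + J) + I := add_le_add_left h1 _
    _ ≤ C * (n * I + n * J) + (I + J) := by
        gcongr
        · exact le_mul_of_one_le_left' hn1
        · exact le_self_add
    _ = _ := by ring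

end Trace

/-! ### The work of the external forces -/

section Load

/-- Conjugation of exponents reverses the order, and x/(x-1) is conjugate to `x`. This turns the
lower bounds on the exponents of the forces into upper bounds on the exponents required of the
deformation. -/
theorem conjExponent_le_ofReal {p : ℝ≥0∞} {x : ℝ} (hx : 1 < x)
    (hp : ENNReal.ofReal (x / (x - 1)) ≤ p) : p.conjExponent ≤ ENNReal.ofReal x := by
  have hx1 : 0 < x - 1 := by linarith
  have h1 : ENNReal.ofReal (x - 1)⁻¹ ≤ p - 1 := by
    have h2 : x / (x - 1) = 1 + (x - 1)⁻¹ := by field_simp; ring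
    rw [h2, ENNReal.ofReal_add zero_le_one (by positivity), ENNReal.ofReal_one] at hp
    exact ENNReal.le_sub_of_add_le_left ENNReal.one_ne_top hp
  rw [ENNReal.ofReal_inv_of_pos hx1] at h1
  calc p.conjExponent = 1 + (p - 1)⁻¹ := rfl
    _ ≤ 1 + ENNReal.ofReal (x - 1) := by
        gcongr
        exact ENNReal.inv_le_iff_inv_le.1 h1
    _ = ENNReal.ofReal x := by
        rw [← ENNReal.ofReal_one, ← ENNReal.ofReal_add zero_le_one hx1.le, add_sub_cancel]

theorem conjExponent_ne_top {p : ℝ≥0∞} (hp : 1 < p) : p.conjExponent ≠ ⊤ :=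
  ENNReal.add_ne_top.2 ⟨ENNReal.one_ne_top, ENNReal.inv_ne_top.2 (tsub_pos_of_lt hp).ne'⟩

variable {α E : Type*} [MeasurableSpace α] {μ : Measure α} [NormedAddCommGroup E]
  [InnerProductSpace ℝ E] {p q : ℝ≥0∞}

theorem eLpNorm_inner_le [p.HolderConjugate q] {a b : α → E} (ha : AEStronglyMeasurable a μ)
    (hb : AEStronglyMeasurable b μ) :
    eLpNorm (fun x => inner ℝ (a x) (b x)) 1 μ ≤ eLpNorm a p μ * eLpNorm b q μ := by
  have := eLpNorm_le_eLpNorm_mul_eLpNorm_of_nnnorm (p := p) (q := q) (r := 1) ha hb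
    (fun u v : E => inner ℝ u v) 1 (.of_forall fun x => by
      rw [one_mul]; exact nnnorm_inner_le_nnnorm _ _)
  simpa using this

theorem integrable_inner_of_memLp [p.HolderConjugate q] {a b : α → E} (ha : MemLp a p μ)
    (hb : MemLp b q μ) : Integrable (fun x => inner ℝ (a x) (b x)) μ := by
  rw [← memLp_one_iff_integrable]
  exact ⟨ha.1.inner hb.1, (eLpNorm_inner_le (p := p) (q := q) ha.1 hb.1).trans_lt
    (ENNReal.mul_lt_top ha.2 hb.2)⟩

theorem abs_integral_inner_le [Fact (1 ≤ p)] [p.HolderConjugate q] (a : Lp E p μ) {b : α → E}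
    (hb : MemLp b q μ) :
    |∫ x, inner ℝ (a x) (b x) ∂μ| ≤ ‖a‖ * (eLpNorm b q μ).toReal := by
  rw [← Real.norm_eq_abs, Lp.norm_def, ← ENNReal.toReal_mul]
  refine (norm_integral_le_lintegral_norm _).trans ?_
  refine ENNReal.toReal_mono (ENNReal.mul_ne_top (Lp.memLp a).2.ne hb.2.ne) ?_
  refine le_trans (le_of_eq ?_) (eLpNorm_inner_le (p := p) (q := q) (Lp.memLp a).1 hb.1)
  rw [eLpNorm_one_eq_lintegral_enorm]
  simp_rw [ofReal_norm]

theorem integral_inner_sub_left [Fact (1 ≤ p)] [p.HolderConjugate q] (a a' : Lp E p μ) {b : α → E}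
    (hb : MemLp b q μ) :
    ∫ x, inner ℝ (a x) (b x) ∂μ - ∫ x, inner ℝ (a' x) (b x) ∂μ =
      ∫ x, inner ℝ ((a - a' : Lp E p μ) x) (b x) ∂μ := by
  rw [← integral_sub (integrable_inner_of_memLp (q := q) (Lp.memLp a) hb)
    (integrable_inner_of_memLp (q := q) (Lp.memLp a') hb)]
  refine integral_congr_ae ?_
  filter_upwards [Lp.coeFn_sub a a'] with x hx
  rw [hx, Pi.sub_apply, inner_sub_left]

end Load

theorem SobolevFun.sobolevNorm_ne_top {n : ℕ} {Ω : Set (Vec n)} {p : ℝ} {ι : Type} [Fintype ι]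
    (u : SobolevFun Ω p ι) : u.sobolevNorm ≠ ⊤ :=
  ENNReal.add_ne_top.2 ⟨u.memLp_toFun.2.ne, u.memLp_grad.2.ne⟩

namespace Data

variable {n m : ℕ} {P : Data n m}

/-- The work of the external forces is bounded, and Lipschitz continuous in time, with constants
proportional to the norm of the deformation. -/
theorem exists_load_bound (hgeom : P.GeometryAssumptions) (hexp : P.ExponentAssumptions)
    (hload : P.LoadingAssumptions) :
    ∃ Λ : ℝ, 0 < Λ ∧ ∀ y : P.Deformation,
      (∀ t ∈ Icc 0 P.T, |P.load t y| ≤ Λ * y.y.sobolevNorm.toReal) ∧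
      ∀ s ∈ Icc 0 P.T, ∀ t ∈ Icc 0 P.T,
        |P.load t y - P.load s y| ≤ Λ * |t - s| * y.y.sobolevNorm.toReal := by
  have hn := hgeom.two_le
  have hn2 : (2 : ℝ) ≤ n := by exact_mod_cast hn
  have hd := hexp.d_gt
  have hd1 : 1 < P.d := by linarith
  have hΩ := hgeom.domain
  -- The exponents nd/(nd-n+d) and (nd-d)/(nd-n) of the assumptions are conjugate to the critical
  -- Sobolev exponent nd/(n-d) and the critical trace exponent (n-1)d/(n-d).
  have hbx : P.d < n → P.dBody.conjExponent ≤ ENNReal.ofReal (n * P.d / (n - P.d)) := by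
    intro h
    have h1 : 0 < (n : ℝ) - P.d := by linarith
    refine conjExponent_le_ofReal ?_ (le_trans (le_of_eq ?_) (hload.body_exponent h))
    · rw [lt_div_iff₀ h1]; nlinarith
    · congr 1
      have h2 : (n : ℝ) * P.d / (n - P.d) - 1 = (n * P.d - n + P.d) / (n - P.d) := by
        field_simp; ring
      rw [h2, div_div_div_cancel_right₀ h1.ne']
  have hsx : P.d < n → P.dSurf.conjExponent ≤ ENNReal.ofReal ((n - 1) * P.d / (n - P.d)) := by
    intro h
    have h1 : 0 < (n : ℝ) - P.d := by linarith
    refine conjExponent_le_ofReal ?_ (le_trans (le_of_eq ?_) (hload.surface_exponent h))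
    · rw [lt_div_iff₀ h1]; nlinarith
    · congr 1
      have h2 : ((n : ℝ) - 1) * P.d / (n - P.d) - 1 = (n * P.d - n) / (n - P.d) := by
        field_simp; ring
      rw [h2, div_div_div_cancel_right₀ h1.ne']
      ring
  have hbt : P.dBody.conjExponent ≠ ⊤ := by
    rcases lt_or_ge P.d n with h | h
    · exact ne_top_of_le_ne_top ENNReal.ofReal_ne_top (hbx h)
    · exact conjExponent_ne_top (hload.body_exponent_of_le h)
  have hst : P.dSurf.conjExponent ≠ ⊤ := by
    rcases lt_or_ge P.d n with h | h
    · exact ne_top_of_le_ne_top ENNReal.ofReal_ne_top (hsx h)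
    · exact conjExponent_ne_top (hload.surface_exponent_of_le h)
  obtain ⟨C, hC, hemb⟩ := hΩ.exists_sobolevFun_embedding (ι := Fin n) hn hd hbt hst hbx hsx
  -- Of the C¹ dependence on time, only boundedness and Lipschitz continuity on [0, T] are used.
  obtain ⟨Kf, hKf⟩ := hload.body.exists_lipschitzOnWith one_ne_zero (convex_Icc _ _) isCompact_Icc
  obtain ⟨Kg, hKg⟩ := hload.surface.exists_lipschitzOnWith one_ne_zero (convex_Icc _ _)
    isCompact_Icc
  obtain ⟨Bf, hBf⟩ := isCompact_Icc.exists_bound_of_continuousOn hload.body.continuousOn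
  obtain ⟨Bg, hBg⟩ := isCompact_Icc.exists_bound_of_continuousOn hload.surface.continuousOn
  have h0 : (0 : ℝ) ∈ Icc 0 P.T := ⟨le_rfl, hgeom.time_pos.le⟩
  have hBf0 : 0 ≤ Bf := (norm_nonneg _).trans (hBf 0 h0)
  have hBg0 : 0 ≤ Bg := (norm_nonneg _).trans (hBg 0 h0)
  have hC0 : 0 ≤ C.toReal := ENNReal.toReal_nonneg
  refine ⟨(Bf + Bg + Kf + Kg) * C.toReal + 1, by positivity, fun y => ?_⟩
  set Y := y.y.sobolevNorm.toReal with hY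
  have hY0 : 0 ≤ Y := ENNReal.toReal_nonneg
  obtain ⟨hq, hr⟩ := hemb y.y y.trace y.isTrace
  have hCY : C * y.y.sobolevNorm ≠ ⊤ := ENNReal.mul_ne_top hC y.y.sobolevNorm_ne_top
  have hu : MemLp y.y.toFun P.dBody.conjExponent (volume.restrict P.Ω) :=
    ⟨y.y.memLp_toFun.1, hq.trans_lt hCY.lt_top⟩
  have hr' : eLpNorm y.trace P.dSurf.conjExponent ((surfaceMeasure P.Ω).restrict P.Γ₁) ≤
      C * y.y.sobolevNorm := (eLpNorm_mono_measure _ Measure.restrict_le_self).trans hr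
  have hv : MemLp y.trace P.dSurf.conjExponent ((surfaceMeasure P.Ω).restrict P.Γ₁) :=
    ⟨y.isTrace.1.restrict, hr'.trans_lt hCY.lt_top⟩
  have hu' : (eLpNorm y.y.toFun P.dBody.conjExponent (volume.restrict P.Ω)).toReal ≤
      C.toReal * Y := by
    rw [hY, ← ENNReal.toReal_mul]; exact ENNReal.toReal_mono hCY hq
  have hv' : (eLpNorm y.trace P.dSurf.conjExponent
      ((surfaceMeasure P.Ω).restrict P.Γ₁)).toReal ≤ C.toReal * Y := by
    rw [hY, ← ENNReal.toReal_mul]; exact ENNReal.toReal_mono hCY hr'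
  have hF : ∀ (a : Lp (Vec n) P.dBody (volume.restrict P.Ω)) (B : ℝ), ‖a‖ ≤ B →
      |∫ x in P.Ω, inner ℝ (a x) (y.y.toFun x)| ≤ B * (C.toReal * Y) := fun a B ha =>
    (abs_integral_inner_le a hu).trans (mul_le_mul ha hu' ENNReal.toReal_nonneg
      ((norm_nonneg _).trans ha))
  have hG : ∀ (a : Lp (Vec n) P.dSurf ((surfaceMeasure P.Ω).restrict P.Γ₁)) (B : ℝ), ‖a‖ ≤ B →
      |∫ x in P.Γ₁, inner ℝ (a x) (y.trace x) ∂surfaceMeasure P.Ω| ≤ B * (C.toReal * Y) :=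
    fun a B ha => (abs_integral_inner_le a hv).trans (mul_le_mul ha hv' ENNReal.toReal_nonneg
      ((norm_nonneg _).trans ha))
  constructor
  · intro t ht
    have h1 := hF (P.f t) Bf (hBf t ht)
    have h2 := hG (P.g t) Bg (hBg t ht)
    calc |P.load t y| ≤ Bf * (C.toReal * Y) + Bg * (C.toReal * Y) :=
          (abs_add_le _ _).trans (add_le_add h1 h2)
      _ ≤ Bf * (C.toReal * Y) + Bg * (C.toReal * Y) +
          ((Kf + Kg) * (C.toReal * Y) + Y) := le_add_of_nonneg_right (by positivity)
      _ = _ := by ring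
  · intro s hs t ht
    have h1 := hF (P.f t - P.f s) (Kf * |t - s|) (by
      rw [← dist_eq_norm, ← Real.dist_eq]; exact hKf.dist_le_mul t ht s hs)
    have h2 := hG (P.g t - P.g s) (Kg * |t - s|) (by
      rw [← dist_eq_norm, ← Real.dist_eq]; exact hKg.dist_le_mul t ht s hs)
    rw [← integral_inner_sub_left _ _ hu] at h1
    rw [← integral_inner_sub_left _ _ hv] at h2
    calc |P.load t y - P.load s y|
        ≤ Kf * |t - s| * (C.toReal * Y) + Kg * |t - s| * (C.toReal * Y) := by
          refine le_trans (le_of_eq ?_) ((abs_add_le _ _).trans (add_le_add h1 h2))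
          simp only [load]
          congr 1
          ring
      _ ≤ Kf * |t - s| * (C.toReal * Y) + Kg * |t - s| * (C.toReal * Y) +
          ((Bf + Bg) * |t - s| * (C.toReal * Y) + |t - s| * Y) :=
          le_add_of_nonneg_right (by positivity)
      _ = _ := by ring

end Data

/-! ### Coercivity of the energy -/

section Coercivity

theorem norm_ofMatrix_mul_le {n : ℕ} (A B : Matrix (Fin n) (Fin n) ℝ) :
    ‖ofMatrix (A * B)‖ ≤ ‖ofMatrix A‖ * ‖ofMatrix B‖ := by
  have hsq : ∀ M : Matrix (Fin n) (Fin n) ℝ, ‖ofMatrix M‖ ^ 2 = ∑ i, ∑ j, M i j ^ 2 := fun M => by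
    rw [EuclideanSpace.norm_sq_eq, Fintype.sum_prod_type]
    simp [ofMatrix]
  refine le_of_sq_le_sq ?_ (by positivity)
  rw [mul_pow, hsq, hsq, hsq, Finset.sum_comm (f := fun i j => B i j ^ 2), Finset.sum_mul_sum]
  refine Finset.sum_le_sum fun i _ => Finset.sum_le_sum fun j _ => ?_
  rw [Matrix.mul_apply]
  exact Finset.sum_mul_sq_le_sq_mul_sq _ _ _

/-- Young's inequality for a product of powers. -/
theorem mul_rpow_le_add_add_one {a b d α β : ℝ} (ha : 0 ≤ a) (hb : 0 ≤ b) (hd : 0 < d)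
    (hα : 0 < α) (hβ : 0 < β) (h : α⁻¹ + β⁻¹ ≤ d⁻¹) :
    (a * b) ^ d ≤ a ^ α + (b ^ β + 1) := by
  -- Both factors are bounded by powers of `M`. The summand 1 ensures M ≥ 1, so that the exponent
  -- 1/α + 1/β may be raised to 1/d.
  set M := a ^ α + (b ^ β + 1) with hM
  have h1 : 0 ≤ a ^ α := Real.rpow_nonneg ha _
  have h2 : 0 ≤ b ^ β := Real.rpow_nonneg hb _
  have hM1 : 1 ≤ M := by linarith
  have ha' : a ≤ M ^ α⁻¹ := by
    calc a = (a ^ α) ^ α⁻¹ := by rw [← Real.rpow_mul ha, mul_inv_cancel₀ hα.ne', Real.rpow_one]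
      _ ≤ _ := Real.rpow_le_rpow h1 (by linarith) (by positivity)
  have hb' : b ≤ M ^ β⁻¹ := by
    calc b = (b ^ β) ^ β⁻¹ := by rw [← Real.rpow_mul hb, mul_inv_cancel₀ hβ.ne', Real.rpow_one]
      _ ≤ _ := Real.rpow_le_rpow h2 (by linarith) (by positivity)
  have h3 : a * b ≤ M ^ d⁻¹ := by
    calc a * b ≤ M ^ α⁻¹ * M ^ β⁻¹ := mul_le_mul ha' hb' hb (by positivity)
      _ = M ^ (α⁻¹ + β⁻¹) := (Real.rpow_add (by linarith) _ _).symm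
      _ ≤ _ := Real.rpow_le_rpow_of_exponent_le hM1 h
  calc (a * b) ^ d ≤ (M ^ d⁻¹) ^ d := Real.rpow_le_rpow (by positivity) h3 hd.le
    _ = M := by rw [← Real.rpow_mul (by linarith), inv_mul_cancel₀ hd.ne', Real.rpow_one]

/-- Superlinear growth of a power. -/
theorem exists_mul_le_rpow_add {d : ℝ} (hd : 1 < d) (M : ℝ) :
    ∃ R : ℝ, 0 ≤ R ∧ ∀ G : ℝ, 0 ≤ G → M * G ≤ G ^ d + R := by
  set M' := max M 1 with hM'
  have hM1 : 1 ≤ M' := le_max_right _ _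
  -- The threshold at which G^d overtakes M' G: below it the linear term is at most M' r, above it
  -- the power wins.
  set r := M' ^ (d - 1)⁻¹ with hr
  have hr0 : 0 ≤ r := Real.rpow_nonneg (by linarith) _
  refine ⟨M' * r, by positivity, fun G hG => ?_⟩
  have h1 : M * G ≤ M' * G := mul_le_mul_of_nonneg_right (le_max_left _ _) hG
  have h0 : 0 ≤ G ^ d := Real.rpow_nonneg hG _
  refine h1.trans ?_
  rcases le_total G r with h | h
  · have : M' * G ≤ M' * r := by gcongr
    linarith
  · have hrpos : 0 < r := Real.rpow_pos_of_pos (by linarith) _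
    have hGpos : 0 < G := hrpos.trans_le h
    have h2 : M' ≤ G ^ (d - 1) := by
      calc M' = r ^ (d - 1) := by
            rw [hr, ← Real.rpow_mul (by linarith), inv_mul_cancel₀ (by linarith), Real.rpow_one]
        _ ≤ _ := Real.rpow_le_rpow hr0 h (by linarith)
    have h3 : G ^ d = G ^ (d - 1) * G := by
      conv_rhs => rw [← Real.rpow_one G, ← Real.rpow_mul hG, one_mul, ← Real.rpow_add hGpos,
        sub_add_cancel]
    rw [h3]
    have : M' * G ≤ G ^ (d - 1) * G := by gcongr
    have : 0 ≤ M' * r := by positivity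
    linarith

theorem MemLp.integrable_rpow_ofReal {α E : Type*} [MeasurableSpace α] {μ : Measure α}
    [NormedAddCommGroup E] {p : ℝ} (hp : 0 < p) {f : α → E} (hf : MemLp f (ENNReal.ofReal p) μ) :
    Integrable (fun x => ‖f x‖ ^ p) μ := by
  have := hf.integrable_norm_rpow (by simpa using hp) ENNReal.ofReal_ne_top
  rwa [ENNReal.toReal_ofReal hp.le] at this

theorem MemLp.toReal_eLpNorm_rpow {α E : Type*} [MeasurableSpace α] {μ : Measure α}
    [NormedAddCommGroup E] {p : ℝ} (hp : 0 < p) {f : α → E} (hf : MemLp f (ENNReal.ofReal p) μ) :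
    (eLpNorm f (ENNReal.ofReal p) μ).toReal ^ p = ∫ x, ‖f x‖ ^ p ∂μ := by
  have h := hf.eLpNorm_eq_integral_rpow_norm (by simpa using hp) ENNReal.ofReal_ne_top
  rw [ENNReal.toReal_ofReal hp.le] at h
  have h0 : 0 ≤ ∫ x, ‖f x‖ ^ p ∂μ := integral_nonneg fun x => by positivity
  rw [h, ENNReal.toReal_ofReal (by positivity), ← Real.rpow_mul h0, inv_mul_cancel₀ hp.ne',
    Real.rpow_one]

theorem le_one_add_rpow {x p : ℝ} (hx : 0 ≤ x) (hp : 1 ≤ p) : x ≤ 1 + x ^ p := by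
  rcases le_total x 1 with h | h
  · have := Real.rpow_nonneg hx p
    linarith
  · have := Real.rpow_le_rpow_of_exponent_le h hp
    rw [Real.rpow_one] at this
    linarith

namespace Data

variable {n m : ℕ} {P : Data n m}

/-- The sum of the powers of the norms that control `W₂`. -/
def PlasticState.powerSum (z : P.PlasticState) (x : Vec n) : ℝ :=
  ‖z.Fp.toFun x‖ ^ P.β + ‖z.Fp.grad x‖ ^ P.β + ‖z.p.toFun x‖ ^ P.ω + ‖z.p.grad x‖ ^ P.ω

theorem PlasticState.integrable_powerSum (hβ : 0 < P.β) (hω : 0 < P.ω) (z : P.PlasticState) :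
    Integrable z.powerSum (volume.restrict P.Ω) :=
  (((MemLp.integrable_rpow_ofReal hβ z.Fp.memLp_toFun).add
    (MemLp.integrable_rpow_ofReal hβ z.Fp.memLp_grad)).add
    (MemLp.integrable_rpow_ofReal hω z.p.memLp_toFun)).add
    (MemLp.integrable_rpow_ofReal hω z.p.memLp_grad)

theorem PlasticState.sobolevNorm_ne_top (z : P.PlasticState) : z.sobolevNorm ≠ ⊤ :=
  ENNReal.add_ne_top.2 ⟨z.Fp.sobolevNorm_ne_top, z.p.sobolevNorm_ne_top⟩

/-- Each of the four norms satisfies x ≤ 1 + x^p with its own exponent, which accounts for the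
constant 4. -/
theorem PlasticState.toReal_sobolevNorm_le (hβ : 1 ≤ P.β) (hω : 1 ≤ P.ω) (z : P.PlasticState) :
    z.sobolevNorm.toReal ≤ 4 + ∫ x in P.Ω, z.powerSum x := by
  have hβ0 : 0 < P.β := by linarith
  have hω0 : 0 < P.ω := by linarith
  have key : ∀ {E : Type} [NormedAddCommGroup E] {p : ℝ} (_ : 1 ≤ p) {f : Vec n → E},
      MemLp f (ENNReal.ofReal p) (volume.restrict P.Ω) →
      (eLpNorm f (ENNReal.ofReal p) (volume.restrict P.Ω)).toReal ≤
        1 + ∫ x in P.Ω, ‖f x‖ ^ p := by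
    intro E _ p hp f hf
    rw [← MemLp.toReal_eLpNorm_rpow (by linarith) hf]
    exact le_one_add_rpow ENNReal.toReal_nonneg hp
  have i1 := MemLp.integrable_rpow_ofReal hβ0 z.Fp.memLp_toFun
  have i2 := MemLp.integrable_rpow_ofReal hβ0 z.Fp.memLp_grad
  have i3 := MemLp.integrable_rpow_ofReal hω0 z.p.memLp_toFun
  have i4 := MemLp.integrable_rpow_ofReal hω0 z.p.memLp_grad
  have h1 := key hβ z.Fp.memLp_toFun
  have h2 := key hβ z.Fp.memLp_grad
  have h3 := key hω z.p.memLp_toFun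
  have h4 := key hω z.p.memLp_grad
  simp only [PlasticState.powerSum]
  rw [integral_add (by fun_prop) i4, integral_add (by fun_prop) i3, integral_add i1 i2,
    PlasticState.sobolevNorm,
    ENNReal.toReal_add z.Fp.sobolevNorm_ne_top z.p.sobolevNorm_ne_top, SobolevFun.sobolevNorm,
    SobolevFun.sobolevNorm,
    ENNReal.toReal_add z.Fp.memLp_toFun.2.ne z.Fp.memLp_grad.2.ne,
    ENNReal.toReal_add z.p.memLp_toFun.2.ne z.p.memLp_grad.2.ne]
  linarith

/-- The plastic energy controls the powers of the norms of the internal variables. -/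
theorem exists_powerSum_le (hgeom : P.GeometryAssumptions) (hexp : P.ExponentAssumptions)
    (hW₂ : P.PlasticAssumptions) :
    ∃ K₁ K₂ : ℝ, 0 < K₁ ∧ 0 ≤ K₂ ∧ ∀ z : P.PlasticState,
      ∫ x in P.Ω, z.powerSum x ≤ K₁ * z.plasticEnergy + K₂ := by
  have hn2 : (2 : ℝ) ≤ n := by exact_mod_cast hgeom.two_le
  have hβ0 : 0 < P.β := by linarith [hexp.beta]
  have hω0 : 0 < P.ω := by linarith [hexp.omega]
  have hfin := hgeom.domain.isFiniteMeasure_restrict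
  obtain ⟨C, c, c₁, hC, hc, hc₁, hgr⟩ := hW₂.growth
  set V := (volume.restrict P.Ω).real univ with hV
  have hV0 : 0 ≤ V := measureReal_nonneg
  refine ⟨c⁻¹, c⁻¹ * (c₁ * V), by positivity, by positivity, fun z => ?_⟩
  have hi := z.integrable_powerSum hβ0 hω0
  have hlow : ∀ x, c * z.powerSum x - c₁ ≤
      P.W₂ (z.Fp.toFun x) (z.Fp.grad x) (z.p.toFun x) (z.p.grad x) := fun x => (hgr _ _ _ _).2
  have hup : ∀ x, P.W₂ (z.Fp.toFun x) (z.Fp.grad x) (z.p.toFun x) (z.p.grad x) ≤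
      C * (1 + z.powerSum x) := fun x => by
    refine (hgr _ _ _ _).1.trans (le_of_eq ?_)
    simp only [PlasticState.powerSum]; ring
  have hps : ∀ x, 0 ≤ z.powerSum x := fun x => by
    simp only [PlasticState.powerSum]; positivity
  have hil : Integrable (fun x => c * z.powerSum x - c₁) (volume.restrict P.Ω) :=
    (hi.const_mul c).sub (integrable_const _)
  -- Integrability, which rests on the upper growth bound, cannot be skipped: otherwise the integral
  -- in `plasticEnergy` would be 0 by default and the lower bound could not be integrated.
  have hWi : Integrable (fun x => P.W₂ (z.Fp.toFun x) (z.Fp.grad x) (z.p.toFun x) (z.p.grad x))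
      (volume.restrict P.Ω) := by
    refine Integrable.mono' (g := fun x => C * (1 + z.powerSum x) + (c * z.powerSum x + c₁))
      ((((integrable_const _).add hi).const_mul C).add ((hi.const_mul c).add (integrable_const _)))
      ?_ (.of_forall fun x => ?_)
    · exact hW₂.continuous.comp_aestronglyMeasurable (z.Fp.memLp_toFun.1.prodMk
        (z.Fp.memLp_grad.1.prodMk (z.p.memLp_toFun.1.prodMk z.p.memLp_grad.1)))
    · rw [Real.norm_eq_abs, abs_le]
      have h1 := hlow x
      have h2 := hup x
      have h3 : 0 ≤ C * (1 + z.powerSum x) := by have := hps x; positivity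
      have h4 : 0 ≤ c * z.powerSum x := by have := hps x; positivity
      constructor <;> linarith
  have h1 : c * (∫ x in P.Ω, z.powerSum x) - c₁ * V ≤ z.plasticEnergy := by
    have := integral_mono hil hWi hlow
    rw [integral_sub (hi.const_mul c) (integrable_const _), integral_const_mul, integral_const,
      smul_eq_mul, mul_comm _ c₁] at this
    exact this
  rw [← mul_add]
  rw [le_inv_mul_iff₀ hc]
  linarith

/-- The elastic energy and the plastic strain control the deformation gradient. -/
theorem exists_grad_rpow_le (hgeom : P.GeometryAssumptions) (hexp : P.ExponentAssumptions)
    (hW₁ : P.ElasticAssumptions) :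
    ∃ K₁ K₂ : ℝ, 0 < K₁ ∧ 0 ≤ K₂ ∧ ∀ q : P.State, q.elasticEnergy ≠ ⊤ →
      (eLpNorm q.y.y.grad (ENNReal.ofReal P.d) (volume.restrict P.Ω)).toReal ^ P.d ≤
        K₁ * q.elasticEnergy.toReal + (∫ x in P.Ω, q.z.powerSum x) + K₂ := by
  have hn2 : (2 : ℝ) ≤ n := by exact_mod_cast hgeom.two_le
  have hβ0 : 0 < P.β := by linarith [hexp.beta]
  have hω0 : 0 < P.ω := by linarith [hexp.omega]
  have hα0 : 0 < P.α := by linarith [hexp.alpha]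
  have hd0 : 0 < P.d := by linarith [hexp.d_gt]
  have hfin := hgeom.domain.isFiniteMeasure_restrict
  obtain ⟨c, hc, hgr⟩ := hW₁.growth
  set V := (volume.restrict P.Ω).real univ with hV
  have hV0 : 0 ≤ V := measureReal_nonneg
  refine ⟨c⁻¹, V, by positivity, hV0, fun q hq => ?_⟩
  have hFe : ∫⁻ x in P.Ω, ENNReal.ofReal (‖q.elasticStrain x‖ ^ P.α) ≤
      ENNReal.ofReal (c⁻¹ * q.elasticEnergy.toReal) := by
    have h1 : ENNReal.ofReal c * ∫⁻ x in P.Ω, ENNReal.ofReal (‖q.elasticStrain x‖ ^ P.α) ≤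
        q.elasticEnergy := by
      -- The bound on the elastic strain does not involve `H`, so it passes to the infimum over weak
      -- gradients.
      refine le_iInf₂ fun H _ => ?_
      rw [← lintegral_const_mul' _ _ ENNReal.ofReal_ne_top]
      refine lintegral_mono fun x => ?_
      rw [← ENNReal.ofReal_mul hc.le]
      obtain ⟨h2, h3⟩ := hgr (q.elasticStrain x) (H x)
      rcases lt_or_ge 0 (det (q.elasticStrain x)) with h | h
      · refine le_trans (ENNReal.ofReal_le_ofReal ?_) (h2 h)
        have h4 : 0 ≤ det (q.elasticStrain x) ^ (-P.s) := Real.rpow_nonneg h.le _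
        have h5 : 0 ≤ ‖H x‖ ^ (P.α / ((n : ℝ) - 1)) := by positivity
        gcongr
        linarith
      · rw [h3 h]; exact le_top
    rw [ENNReal.ofReal_mul (by positivity), ENNReal.ofReal_toReal hq,
      ENNReal.ofReal_inv_of_pos hc, ← ENNReal.div_eq_inv_mul,
      ENNReal.le_div_iff_mul_le (Or.inl (by simpa using hc)) (Or.inl ENNReal.ofReal_ne_top),
      mul_comm]
    exact h1
  have hFpi := MemLp.integrable_rpow_ofReal hβ0 q.z.Fp.memLp_toFun
  have hFp1 : Integrable (fun x => ‖q.z.Fp.toFun x‖ ^ P.β + 1) (volume.restrict P.Ω) :=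
    hFpi.add (integrable_const _)
  have hpt : ∀ᵐ x ∂volume.restrict P.Ω, ENNReal.ofReal (‖q.y.y.grad x‖ ^ P.d) ≤
      ENNReal.ofReal (‖q.elasticStrain x‖ ^ P.α) +
        ENNReal.ofReal (‖q.z.Fp.toFun x‖ ^ P.β + 1) := by
    filter_upwards [q.z.det_eq_one] with x hx
    rw [← ENNReal.ofReal_add (by positivity) (by positivity)]
    refine ENNReal.ofReal_le_ofReal (le_trans ?_ (mul_rpow_le_add_add_one (norm_nonneg _)
      (norm_nonneg _) hd0 hα0 hβ0 hexp.holder))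
    refine Real.rpow_le_rpow (norm_nonneg _) ?_ hd0.le
    -- Because det F_p = 1, the matrix inverse in the elastic strain is a true inverse, and ∇y = F_e
    -- F_p.
    have hu : IsUnit (toMatrix (q.z.Fp.toFun x)).det := by
      rw [show (toMatrix (q.z.Fp.toFun x)).det = 1 from hx]; exact isUnit_one
    have h1 : q.y.y.grad x = ofMatrix (toMatrix (q.elasticStrain x) *
        toMatrix (q.z.Fp.toFun x)) := by
      have h2 : toMatrix (q.elasticStrain x) =
          toMatrix (q.y.y.grad x) * (toMatrix (q.z.Fp.toFun x))⁻¹ := rfl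
      rw [h2, Matrix.mul_assoc, Matrix.nonsing_inv_mul _ hu, Matrix.mul_one]
      rfl
    rw [h1]
    exact norm_ofMatrix_mul_le _ _
  have hle : ENNReal.ofReal (∫ x in P.Ω, ‖q.y.y.grad x‖ ^ P.d) ≤
      ENNReal.ofReal (c⁻¹ * q.elasticEnergy.toReal) +
        ENNReal.ofReal (∫ x in P.Ω, (‖q.z.Fp.toFun x‖ ^ P.β + 1)) := by
    rw [ofReal_integral_eq_lintegral_ofReal
        (MemLp.integrable_rpow_ofReal hd0 q.y.y.memLp_grad)
        (.of_forall fun x => by simp only [Pi.zero_apply]; positivity),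
      ofReal_integral_eq_lintegral_ofReal hFp1
        (.of_forall fun x => by simp only [Pi.zero_apply]; positivity)]
    refine (lintegral_mono_ae hpt).trans ?_
    -- Additivity needs measurability of one summand only, here that of F_p; measurability of the
    -- elastic strain is not required.
    rw [lintegral_add_right' _ hFp1.1.aemeasurable.ennreal_ofReal]
    gcongr
  have hE0 : 0 ≤ c⁻¹ * q.elasticEnergy.toReal := by positivity
  have hI0 : 0 ≤ ∫ x in P.Ω, (‖q.z.Fp.toFun x‖ ^ P.β + 1) :=
    integral_nonneg fun x => by positivity
  rw [← ENNReal.ofReal_add hE0 hI0, ENNReal.ofReal_le_ofReal_iff (by positivity),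
    integral_add hFpi (integrable_const _), integral_const, smul_eq_mul, mul_one] at hle
  rw [MemLp.toReal_eLpNorm_rpow hd0 q.y.y.memLp_grad]
  have hmono : ∫ x in P.Ω, ‖q.z.Fp.toFun x‖ ^ P.β ≤ ∫ x in P.Ω, q.z.powerSum x := by
    refine integral_mono hFpi (q.z.integrable_powerSum hβ0 hω0) fun x => ?_
    have h1 : 0 ≤ ‖q.z.Fp.grad x‖ ^ P.β := by positivity
    have h2 : 0 ≤ ‖q.z.p.toFun x‖ ^ P.ω := by positivity
    have h3 : 0 ≤ ‖q.z.p.grad x‖ ^ P.ω := by positivity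
    simp only [PlasticState.powerSum]
    linarith
  linarith

/-- The energy of a state, as a real number. -/
def State.realEnergy (t : ℝ) (q : P.State) : ℝ :=
  q.elasticEnergy.toReal + (q.z.plasticEnergy - P.load t q.y)

theorem energy_eq_coe {t : ℝ} {q : P.State} (hq : q.elasticEnergy ≠ ⊤) :
    P.energy t q = (q.realEnergy t : EReal) := by
  rw [energy, State.realEnergy, EReal.coe_add, EReal.coe_ennreal_toReal hq]

/-- Coercivity: the energy controls the norms of the deformation and of the internal
variables. -/
theorem exists_coercivity (hgeom : P.GeometryAssumptions) (hexp : P.ExponentAssumptions)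
    (hW₁ : P.ElasticAssumptions) (hW₂ : P.PlasticAssumptions) {Λ : ℝ} (hΛ : 0 < Λ)
    (hload : ∀ y : P.Deformation, ∀ t ∈ Icc 0 P.T, |P.load t y| ≤ Λ * y.y.sobolevNorm.toReal) :
    ∃ A B : ℝ, 0 < A ∧ ∀ q : P.State, q.elasticEnergy ≠ ⊤ → ∀ t ∈ Icc 0 P.T,
      q.y.y.sobolevNorm.toReal + q.z.sobolevNorm.toReal ≤ A * q.realEnergy t + B := by
  have hn2 : (2 : ℝ) ≤ n := by exact_mod_cast hgeom.two_le
  have hd1 : 1 < P.d := by linarith [hexp.d_gt]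
  obtain ⟨K₁, K₂, hK₁, hK₂, hplast⟩ := exists_powerSum_le hgeom hexp hW₂
  obtain ⟨K₃, K₄, hK₃, hK₄, helast⟩ := exists_grad_rpow_le hgeom hexp hW₁
  obtain ⟨C, hC, hfr⟩ := hgeom.domain.exists_friedrichs (ι := Fin n) hgeom.two_le hexp.d_gt
    hgeom.positive.ne'
  set J := eLpNorm P.y₀ (ENNReal.ofReal P.d) ((surfaceMeasure P.Ω).restrict P.Γ₀) with hJ
  have hJt : J ≠ ⊤ := hgeom.boundary_data.1.2.ne
  set c := C.toReal with hc
  set j := J.toReal with hj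
  have hc0 : 0 ≤ c := ENNReal.toReal_nonneg
  have hj0 : 0 ≤ j := ENNReal.toReal_nonneg
  -- Inserting the plastic bound twice into the elastic one gives the coefficients K₃ of E₁ and 2K₁
  -- of E₂. A common coefficient `k` is reached by adding the non-negative terms 2K₁E₁ and K₃(E₂ +
  -- K₂/K₁), whence the last term of `K₅`.
  set k := 2 * K₁ + K₃ with hk
  have hk0 : 0 < k := by positivity
  -- The factor 2 lets the load consume only half of G^d, so that the other half survives on the
  -- left.
  obtain ⟨R, hR, hsup⟩ := exists_mul_le_rpow_add hd1 (2 * k * (Λ * c))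
  set K₅ := 2 * K₂ + K₄ + K₃ * (K₂ / K₁) with hK₅
  refine ⟨(c + 1) * (2 * k), (c + 1) * (R + 2 * (k * (Λ * c * j)) + 2 * K₅) +
    c * (1 + j) + 4, by positivity, fun q hq t ht => ?_⟩
  set G := (eLpNorm q.y.y.grad (ENNReal.ofReal P.d) (volume.restrict P.Ω)).toReal with hG
  have hG0 : 0 ≤ G := ENNReal.toReal_nonneg
  have hGd : 0 ≤ G ^ P.d := Real.rpow_nonneg hG0 _
  set S := ∫ x in P.Ω, q.z.powerSum x with hS
  have hS0 : 0 ≤ S := integral_nonneg fun x => by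
    simp only [PlasticState.powerSum, Pi.zero_apply]; positivity
  set Y := q.y.y.sobolevNorm.toReal with hY
  set Z := q.z.sobolevNorm.toReal with hZ
  have hYle : Y ≤ c * (G + j) := by
    have h1 := hfr q.y.y q.y.trace q.y.isTrace
    -- On Γ₀ the trace is the prescribed `y₀`, so the boundary term is a constant of the problem.
    rw [eLpNorm_congr_ae q.y.trace_eq] at h1
    have hgt := q.y.y.memLp_grad.2.ne
    have h2 := ENNReal.toReal_mono (ENNReal.mul_ne_top hC (ENNReal.add_ne_top.2 ⟨hgt, hJt⟩)) h1
    rwa [ENNReal.toReal_mul, ENNReal.toReal_add hgt hJt] at h2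
  have hZle : Z ≤ 4 + S := q.z.toReal_sobolevNorm_le (by linarith [hexp.beta])
    (by linarith [hexp.omega])
  set E₁ := q.elasticEnergy.toReal with hE₁
  have hE₁0 : 0 ≤ E₁ := ENNReal.toReal_nonneg
  set E₂ := q.z.plasticEnergy with hE₂
  have hp : S ≤ K₁ * E₂ + K₂ := hplast q.z
  have he : G ^ P.d ≤ K₃ * E₁ + S + K₄ := helast q hq
  have hl := (abs_le.1 (hload q.y t ht)).2
  set I := q.realEnergy t with hI
  have hIdef : I = E₁ + (E₂ - P.load t q.y) := rfl
  have hsum : G ^ P.d + S ≤ k * (E₁ + E₂) + K₅ := by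
    have h1 : 0 ≤ E₂ + K₂ / K₁ := by
      have h2 : E₂ + K₂ / K₁ = (K₁ * E₂ + K₂) / K₁ := by field_simp
      rw [h2]
      exact div_nonneg (hS0.trans hp) hK₁.le
    have h3 : 0 ≤ K₃ * (E₂ + K₂ / K₁) := mul_nonneg hK₃.le h1
    have h4 : 0 ≤ K₁ * E₁ := mul_nonneg hK₁.le hE₁0
    rw [hk, hK₅]
    linarith
  have hLY : k * (Λ * Y) ≤ (G ^ P.d + R) / 2 + k * (Λ * c * j) := by
    have h1 := hsup G hG0
    have h2 : k * (Λ * Y) ≤ k * (Λ * (c * (G + j))) := by gcongr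
    nlinarith
  have hmain : G ^ P.d + S ≤ 2 * k * I + (R + 2 * (k * (Λ * c * j)) + 2 * K₅) := by
    have h1 : k * (E₁ + E₂) ≤ k * I + k * (Λ * Y) := by
      rw [← mul_add]
      exact mul_le_mul_of_nonneg_left (by linarith) hk0.le
    linarith
  have hGle : G ≤ 1 + G ^ P.d := le_one_add_rpow hG0 hd1.le
  calc Y + Z ≤ c * (G + j) + (4 + S) := add_le_add hYle hZle
    _ ≤ c * (1 + (G ^ P.d + S) + j) + (4 + (G ^ P.d + S)) := by
        gcongr
        · linarith
        · linarith
    _ = (c + 1) * (G ^ P.d + S) + c * (1 + j) + 4 := by ring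
    _ ≤ (c + 1) * (2 * k * I + (R + 2 * (k * (Λ * c * j)) + 2 * K₅)) +
          c * (1 + j) + 4 := by gcongr
    _ = _ := by ring

end Data

end Coercivity

namespace Data

/-! ### The incremental problems -/

variable {n m : ℕ} {P : Data n m}

theorem dissipation_self (hD : P.DissipationAssumptions) (z : P.PlasticState) :
    P.dissipation z z = 0 :=
  (hD.eq_zero_iff z z).2 (ae_eq_refl _)

theorem elasticEnergy_ne_top_of_energy_lt_top {t : ℝ} {q : P.State} (h : P.energy t q < ⊤) :
    q.elasticEnergy ≠ ⊤ := by
  intro h1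
  rw [energy, h1, EReal.coe_ennreal_top, EReal.top_add_coe] at h
  exact lt_irrefl _ h

/-- One time step: comparison of the minimizer with the preceding state. -/
theorem IsIncrementalSolution.step (hD : P.DissipationAssumptions) {τ : ℝ} {N : ℕ} {q₀ : P.State}
    {q : ℕ → P.State} (hq : P.IsIncrementalSolution τ N q₀ q) {k : ℕ} (hk : k + 1 ≤ N)
    (hfin : (q k).elasticEnergy ≠ ⊤) :
    (q (k + 1)).elasticEnergy ≠ ⊤ ∧ P.dissipation (q k).z (q (k + 1)).z ≠ ⊤ ∧
      (q (k + 1)).realEnergy ((k + 1 : ℕ) * τ) + (P.dissipation (q k).z (q (k + 1)).z).toReal ≤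
        (q k).realEnergy ((k + 1 : ℕ) * τ) := by
  -- Staying at the preceding state costs no dissipation and has finite energy; hence the minimum is
  -- finite, and so are its two summands.
  have h := hq.2 (k + 1) (by omega) hk (q k)
  rw [Nat.add_sub_cancel, dissipation_self hD, EReal.coe_ennreal_zero, add_zero,
    energy_eq_coe hfin] at h
  have hE : (q (k + 1)).elasticEnergy ≠ ⊤ := by
    intro h1
    rw [energy, h1, EReal.coe_ennreal_top, EReal.top_add_coe,
      EReal.top_add_of_ne_bot (EReal.coe_ennreal_ne_bot _)] at h
    exact (EReal.coe_lt_top _).not_ge h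
  rw [energy_eq_coe hE] at h
  have hd : P.dissipation (q k).z (q (k + 1)).z ≠ ⊤ := by
    intro h1
    rw [h1, EReal.coe_ennreal_top, EReal.coe_add_top] at h
    exact (EReal.coe_lt_top _).not_ge h
  refine ⟨hE, hd, ?_⟩
  rw [← EReal.coe_ennreal_toReal hd, ← EReal.coe_add, EReal.coe_le_coe_iff] at h
  exact h

/-- The discrete energy estimate. -/
theorem IsIncrementalSolution.bound (hD : P.DissipationAssumptions) {Λ A B : ℝ} (hΛ : 0 < Λ)
    (hA : 0 < A)
    (hload : ∀ y : P.Deformation, ∀ s ∈ Icc 0 P.T, ∀ t ∈ Icc 0 P.T,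
      |P.load t y - P.load s y| ≤ Λ * |t - s| * y.y.sobolevNorm.toReal)
    (hcoer : ∀ q : P.State, q.elasticEnergy ≠ ⊤ → ∀ t ∈ Icc 0 P.T,
      q.y.y.sobolevNorm.toReal + q.z.sobolevNorm.toReal ≤ A * q.realEnergy t + B)
    {τ : ℝ} (hτ : 0 < τ) {N : ℕ} (hN : N * τ = P.T) {q₀ : P.State} (hq₀ : q₀.elasticEnergy ≠ ⊤)
    {q : ℕ → P.State} (hq : P.IsIncrementalSolution τ N q₀ q) {k : ℕ} (hk : k ≤ N) :
    (q k).elasticEnergy ≠ ⊤ ∧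
      (∀ i ∈ Finset.range k, P.dissipation (q i).z (q (i + 1)).z ≠ ⊤) ∧
      (A * (q k).realEnergy (k * τ) + B) +
        A * ∑ i ∈ Finset.range k, (P.dissipation (q i).z (q (i + 1)).z).toReal ≤
        (1 + A * Λ * τ) ^ k * (A * q₀.realEnergy 0 + B) := by
  have htime : ∀ j : ℕ, j ≤ N → (j : ℝ) * τ ∈ Icc 0 P.T := fun j hj => by
    refine ⟨by positivity, ?_⟩
    rw [← hN]
    gcongr
  induction k with
  | zero => simp [hq.1, hq₀]
  | succ k ih =>
    obtain ⟨hE, hfin, hle⟩ := ih (by omega)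
    obtain ⟨hE', hd, hstep⟩ := hq.step hD hk hE
    refine ⟨hE', fun i hi => ?_, ?_⟩
    · rcases Finset.mem_range_succ_iff.1 hi |>.eq_or_lt with rfl | h
      · exact hd
      · exact hfin i (Finset.mem_range.2 h)
    rw [Finset.sum_range_succ, pow_succ]
    set S := ∑ i ∈ Finset.range k, (P.dissipation (q i).z (q (i + 1)).z).toReal with hS
    have hS0 : 0 ≤ S := Finset.sum_nonneg fun _ _ => ENNReal.toReal_nonneg
    set d := (P.dissipation (q k).z (q (k + 1)).z).toReal
    -- By coercivity `a` dominates the norm of the deformation, so the power of the load over one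
    -- step is at most Λτa and the estimate closes on `a` itself.
    set a := A * (q k).realEnergy (k * τ) + B with ha
    have hYa : (q k).y.y.sobolevNorm.toReal ≤ a := by
      have := hcoer (q k) hE _ (htime k (by omega))
      have h0 : 0 ≤ (q k).z.sobolevNorm.toReal := ENNReal.toReal_nonneg
      linarith
    have hl := hload (q k).y _ (htime k (by omega)) _ (htime (k + 1) hk)
    have hdt : |((k + 1 : ℕ) : ℝ) * τ - k * τ| = τ := by
      rw [Nat.cast_add_one, add_mul, one_mul, add_sub_cancel_left, abs_of_pos hτ]
    rw [hdt] at hl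
    have hpow : (q k).realEnergy ((k + 1 : ℕ) * τ) ≤
        (q k).realEnergy (k * τ) + Λ * τ * a := by
      have h1 : Λ * τ * (q k).y.y.sobolevNorm.toReal ≤ Λ * τ * a := by gcongr
      have h2 := (abs_le.1 hl).1
      simp only [State.realEnergy]
      linarith
    have h3 : A * ((q (k + 1)).realEnergy ((k + 1 : ℕ) * τ) + d) ≤
        A * ((q k).realEnergy (k * τ) + Λ * τ * a) :=
      mul_le_mul_of_nonneg_left (hstep.trans hpow) hA.le
    -- The dissipation already accumulated is multiplied by the growth factor as well; this only
    -- weakens the bound and lets the induction hypothesis apply to the whole sum.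
    have h4 : 0 ≤ A * Λ * τ * (A * S) := by positivity
    calc _ ≤ a + A * Λ * τ * a + A * S := by rw [ha] at h3 ⊢; linarith
      _ ≤ (1 + A * Λ * τ) * (a + A * S) := by linarith
      _ ≤ (1 + A * Λ * τ) * ((1 + A * Λ * τ) ^ k * (A * q₀.realEnergy 0 + B)) := by gcongr
      _ = _ := by ring

theorem dissipation_le_sum_Ico (hD : P.DissipationAssumptions) (q : ℕ → P.State) {a b : ℕ}
    (hab : a ≤ b) :
    P.dissipation (q a).z (q b).z ≤
      ∑ k ∈ Finset.Ico a b, P.dissipation (q k).z (q (k + 1)).z := by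
  induction b, hab using Nat.le_induction with
  | base => simp [dissipation_self hD]
  | succ b hab ih =>
    rw [Finset.sum_Ico_succ_top hab]
    exact (hD.triangle _ (q b).z _).trans (by gcongr)

/-- The total dissipation of the interpolation is at most the sum of the increments. -/
theorem var_interpolate_le (hD : P.DissipationAssumptions) {τ : ℝ} (hτ : 0 < τ) {N : ℕ}
    (hN : N * τ = P.T) (q : ℕ → P.State) :
    P.var (P.interpolate τ q) 0 P.T ≤
      ∑ k ∈ Finset.range N, P.dissipation (q k).z (q (k + 1)).z := by
  refine iSup₂_le fun L t => iSup_le fun ⟨hmono, ht0, htL⟩ => ?_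
  -- A partition enters only through the step indices of its points. These are non-decreasing, so
  -- successive jumps use consecutive blocks of increments; equal indices give an empty block.
  have key : ∀ j, j ≤ L → ⌊t 0 / τ⌋₊ ≤ ⌊t j / τ⌋₊ ∧ ∑ i ∈ Finset.range j,
      P.dissipation (P.interpolate τ q (t i)).z (P.interpolate τ q (t (i + 1))).z ≤
      ∑ k ∈ Finset.Ico ⌊t 0 / τ⌋₊ ⌊t j / τ⌋₊, P.dissipation (q k).z (q (k + 1)).z := by
    intro j hj
    induction j with
    | zero => simp
    | succ j ih =>
      obtain ⟨h1, h2⟩ := ih (by omega)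
      have hle : ⌊t j / τ⌋₊ ≤ ⌊t (j + 1) / τ⌋₊ := by
        refine Nat.floor_mono (div_le_div_of_nonneg_right ?_ hτ.le)
        exact hmono.monotoneOn (by simp; omega) (by simpa using hj) (Nat.le_succ j)
      refine ⟨h1.trans hle, ?_⟩
      rw [Finset.sum_range_succ, ← Finset.sum_Ico_consecutive _ h1 hle]
      exact add_le_add h2 (dissipation_le_sum_Ico hD q hle)
  have h := (key L le_rfl).2
  -- At the final time the index is exactly `N`, so the last increment is included.
  rwa [ht0, htL, zero_div, Nat.floor_zero, ← hN, mul_div_cancel_right₀ _ hτ.ne', Nat.floor_natCast,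
    Nat.Ico_zero_eq_range] at h

end Data

end GPCPlasticity

end

/-! ### The a priori bounds -/

theorem mainTheorem7 {n m : ℕ} (P : GPCPlasticity.Data n m)
    (hgeom : P.GeometryAssumptions) (hexp : P.ExponentAssumptions)
    (hW₁ : P.ElasticAssumptions) (hW₂ : P.PlasticAssumptions)
    (hD : P.DissipationAssumptions) (hload : P.LoadingAssumptions)
    (q₀ : P.State) (hstable : P.IsStable 0 q₀) (hfinite : P.energy 0 q₀ < ⊤) :
    ∃ κ : ℝ, ∀ (τ : ℝ) (N : ℕ) (q : ℕ → P.State),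
      0 < τ → (N : ℝ) * τ = P.T → P.IsIncrementalSolution τ N q₀ q →
        essSup (fun t => (P.interpolate τ q t).y.y.sobolevNorm)
            (MeasureTheory.volume.restrict (Set.Ioo 0 P.T)) < ENNReal.ofReal κ ∧
        P.var (P.interpolate τ q) 0 P.T < ENNReal.ofReal κ ∧
        essSup (fun t => (P.interpolate τ q t).z.sobolevNorm)
            (MeasureTheory.volume.restrict (Set.Ioo 0 P.T)) < ENNReal.ofReal κ := by
  obtain ⟨Λ, hΛ, hL⟩ := GPCPlasticity.Data.exists_load_bound hgeom hexp hload
  obtain ⟨A, B, hA, hcoer⟩ := GPCPlasticity.Data.exists_coercivity hgeom hexp hW₁ hW₂ hΛ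
    fun y => (hL y).1
  have hq₀ := GPCPlasticity.Data.elasticEnergy_ne_top_of_energy_lt_top hfinite
  have hT := hgeom.time_pos
  set a₀ := A * q₀.realEnergy 0 + B with ha₀
  -- The sign comes from coercivity at the initial state; it is needed to replace the growth factor
  -- in front of a₀ by an exponential.
  have ha₀0 : 0 ≤ a₀ :=
    (add_nonneg ENNReal.toReal_nonneg ENNReal.toReal_nonneg).trans
      (hcoer q₀ hq₀ 0 ⟨le_rfl, hT.le⟩)
  set M := Real.exp (A * Λ * P.T) * a₀ with hM
  have hM0 : 0 ≤ M := by positivity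
  -- `M` bounds the norms and M / A the sum of the dissipations; the summand 1 makes the
  -- inequalities strict.
  refine ⟨M + M / A + 1, fun τ N q hτ hN hq => ?_⟩
  have hbound : ∀ k, k ≤ N →
      (q k).y.y.sobolevNorm.toReal + (q k).z.sobolevNorm.toReal +
        A * ∑ i ∈ Finset.range k, (P.dissipation (q i).z (q (i + 1)).z).toReal ≤ M := by
    intro k hk
    obtain ⟨hE, -, hle⟩ := hq.bound hD hΛ hA (fun y => (hL y).2) hcoer hτ hN hq₀ hk
    have hkT : (k : ℝ) * τ ≤ P.T := by rw [← hN]; gcongr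
    have h1 := hcoer (q k) hE (k * τ) ⟨by positivity, hkT⟩
    have h2 : (1 + A * Λ * τ) ^ k ≤ Real.exp (A * Λ * P.T) := by
      calc (1 + A * Λ * τ) ^ k ≤ Real.exp (A * Λ * τ) ^ k := by
            gcongr
            linarith [Real.add_one_le_exp (A * Λ * τ)]
        _ = Real.exp (A * Λ * (k * τ)) := by rw [← Real.exp_nat_mul]; congr 1; ring
        _ ≤ _ := by gcongr
    have h3 : (1 + A * Λ * τ) ^ k * a₀ ≤ M := by rw [hM]; gcongr
    linarith
  have hsum0 : ∀ k, 0 ≤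
      A * ∑ i ∈ Finset.range k, (P.dissipation (q i).z (q (i + 1)).z).toReal := fun k =>
    mul_nonneg hA.le (Finset.sum_nonneg fun _ _ => ENNReal.toReal_nonneg)
  have hMA : 0 ≤ M / A := by positivity
  have hfloor : ∀ t ∈ Set.Ioo 0 P.T, ⌊t / τ⌋₊ ≤ N := fun t ht => by
    refine Nat.floor_le_of_le ?_
    rw [div_le_iff₀ hτ, hN]
    exact ht.2.le
  have hlt : ENNReal.ofReal M < ENNReal.ofReal (M + M / A + 1) :=
    (ENNReal.ofReal_lt_ofReal_iff (by linarith)).2 (by linarith)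
  refine ⟨?_, ?_, ?_⟩
  · refine lt_of_le_of_lt (essSup_le_of_ae_le _ ?_) hlt
    filter_upwards [MeasureTheory.ae_restrict_mem measurableSet_Ioo] with t ht
    refine (ENNReal.le_ofReal_iff_toReal_le
      (GPCPlasticity.SobolevFun.sobolevNorm_ne_top _) hM0).2 ?_
    have h1 := hbound _ (hfloor t ht)
    have h2 := hsum0 ⌊t / τ⌋₊
    have h3 : 0 ≤ (q ⌊t / τ⌋₊).z.sobolevNorm.toReal := ENNReal.toReal_nonneg
    exact (by linarith : (q ⌊t / τ⌋₊).y.y.sobolevNorm.toReal ≤ M)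
  · refine (GPCPlasticity.Data.var_interpolate_le hD hτ hN q).trans_lt ?_
    have hfin := (hq.bound hD hΛ hA (fun y => (hL y).2) hcoer hτ hN hq₀ le_rfl).2.1
    rw [← ENNReal.ofReal_toReal (ENNReal.sum_ne_top.2 hfin),
      ENNReal.ofReal_lt_ofReal_iff (by linarith), ENNReal.toReal_sum hfin]
    have h1 := hbound N le_rfl
    have h2 : 0 ≤ (q N).y.y.sobolevNorm.toReal := ENNReal.toReal_nonneg
    have h3 : 0 ≤ (q N).z.sobolevNorm.toReal := ENNReal.toReal_nonneg
    have h4 : ∑ i ∈ Finset.range N, (P.dissipation (q i).z (q (i + 1)).z).toReal ≤ M / A := by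
      rw [le_div_iff₀ hA]; linarith
    linarith
  · refine lt_of_le_of_lt (essSup_le_of_ae_le _ ?_) hlt
    filter_upwards [MeasureTheory.ae_restrict_mem measurableSet_Ioo] with t ht
    refine (ENNReal.le_ofReal_iff_toReal_le
      (GPCPlasticity.Data.PlasticState.sobolevNorm_ne_top _) hM0).2 ?_
    have h1 := hbound _ (hfloor t ht)
    have h2 := hsum0 ⌊t / τ⌋₊
    have h3 : 0 ≤ (q ⌊t / τ⌋₊).y.y.sobolevNorm.toReal := ENNReal.toReal_nonneg
    exact (by linarith : (q ⌊t / τ⌋₊).z.sobolevNorm.toReal ≤ M)
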